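/- **Proposition 2.2.** Let $(X,\mu)$ be a standard probability space, i.e. a standard Borel space with a non-atomic Borel probability measure, and let $\mathcal R$ be a countable, ergodic, measure preserving equivalence relation on $(X,\mu)$: $\mathcal R\subset X\times X$ is Borel with countable classes, it is the orbit equivalence relation of a Borel $\mu$-preserving action of a countable group, and every $\mathcal R$-invariant Borel set is null or co-null. Let $[\mathcal R]$ be the full group, i.e. the set of Borel automorphisms $\theta$ of $X$ preserving $\mu$ with $(x,\theta(x))\in\mathcal R$ for $\mu$-almost every $x$. Put $\Delta=\{(x,x):x\in X\}$, let $p^1,p^2:X\times X\to X$ be the coordinate projections, let $B(X)$ be the bounded Borel functions $X\to\mathbb C$, and for Borel probability measures set $\|\nu-\nu'\|=\sup\{|\int f\,d\nu-\int f\,d\nu'| : f \text{ complex-valued Borel},\ \|f\|_\infty\le 1\}$. Assume that there is no sequence $(\nu_n)_{n\ge1}$ of Borel probability measures on $X\times X$ such that $\nu_n(\Delta)=0$ and $p^i_*\nu_n=\mu$ for all $n$ and $i\in\{1,2\}$, and (i) $\lim_{n\to\infty}\int_{X\times X} f_1(x)f_2(y)\,d\nu_n(x,y)=\int_X f_1f_2\,d\mu$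 for all $f_1,f_2\in B(X)$, (ii) $\lim_{n\to\infty}\|(\theta\times\theta)_*\nu_n-\nu_n\|=0$ for all $\theta\in[\mathcal R]$. Then $\mathcal R$ is rigid, i.e. the inclusion $L^\infty(X,\mu)\subset L(\mathcal R)$ is rigid. Here $L(\mathcal R)$ is the von Neumann algebra on $L^2(\mathcal R,m)$, where $m(A)=\int_X|\{y:(x,y)\in A\}|\,d\mu(x)$ for Borel $A\subset\mathcal R$, generated by the operators $(L_fg)(x,y)=f(x)g(x,y)$ for $f\in L^\infty(X,\mu)$ and $(u_\theta g)(x,y)=g(\theta^{-1}(x),y)$ for $\theta\in[\mathcal R]$. It carries the trace $\tau(y)=\langle y1_\Delta,1_\Delta\rangle$, and $L^\infty(X,\mu)$ is identified with $\{L_f\}$. For a von Neumann algebra $M$ with trace $\tau$, a Hilbert $M$-bimodule is a Hilbert space with commuting normal unital left and right $*$-actions of $M$. An inclusion $B\subset M$ is *rigid* if for every $\varepsilon>0$ there are a finite set $F\subset M$ and $\delta>0$ such that, whenever $\mathcal H$ is a Hilbert $M$-bimodule and $\xi\in\mathcal H$ is a unit vector with $\langle x\xi,\xi\rangle=\langle\xi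 x,\xi\rangle=\tau(x)$ for all $x\in M$ and $\|x\xi-\xi x\|\le\delta$ for all $x\in F$, there is $\eta\in\mathcal H$ with $b\eta=\eta b$ for all $b\in B$ and $\|\eta-\xi\|\le\varepsilon$. -/

import Mathlib

open MeasureTheory Filter Topology
open scoped ENNReal

universe u v

noncomputable section

/-! ### Countable measure preserving equivalence relations -/

/-- A countable measure preserving equivalence relation on `(X, μ)`: a Borel equivalence relation
with countable classes which is the orbit equivalence relation of a Borel, `μ`-preserving action
of a countable group. -/
structure CountablePMPEquivRel (X : Type u) [MeasurableSpace X] (μ : Measure X) where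
  /-- the equivalence relation -/
  rel : Setoid X
  measurableSet_rel : MeasurableSet {p : X × X | rel p.1 p.2}
  countable_class : ∀ x, {y | rel x y}.Countable
  measure_preserving : ∃ (Γ : Type) (_ : Group Γ) (_ : Countable Γ) (_ : MulAction Γ X),
    (∀ γ : Γ, MeasurePreserving (fun x : X => γ • x) μ μ) ∧ rel = MulAction.orbitRel Γ X

/-- Bounded Borel complex-valued functions. -/
def IsBddBorel {X : Type u} [MeasurableSpace X] (f : X → ℂ) : Prop :=
  Measurable f ∧ ∃ C : ℝ, ∀ x, ‖f x‖ ≤ C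

/-- The norm of the difference of two measures: the supremum of `|∫ f dm₁ - ∫ f dm₂|` over the
Borel functions `f : Y → ℂ` with `‖f‖_∞ ≤ 1`. -/
def measureDist {Y : Type u} [MeasurableSpace Y] (m₁ m₂ : Measure Y) : ℝ≥0∞ :=
  ⨆ (f : Y → ℂ) (_ : Measurable f ∧ ∀ y, ‖f y‖ ≤ 1), ‖(∫ y, f y ∂m₁) - ∫ y, f y ∂m₂‖ₑ

namespace CountablePMPEquivRel

variable {X : Type u} [MeasurableSpace X] {μ : Measure X} (R : CountablePMPEquivRel X μ)

/-- Ergodicity: every `R`-invariant Borel set is null or co-null. -/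
def IsErgodic : Prop :=
  ∀ A : Set X, MeasurableSet A → (∀ x y, R.rel x y → x ∈ A → y ∈ A) → μ A = 0 ∨ μ Aᶜ = 0

/-- The full group `[R]`: Borel automorphisms `θ` of `X` preserving `μ` such that `θ x` is
equivalent to `x` for almost every `x`. -/
def fullGroup : Set (X ≃ᵐ X) :=
  {θ | MeasurePreserving θ μ μ ∧ ∀ᵐ x ∂μ, R.rel x (θ x)}

/-- The counting measure on the vertical fibre `{x} × [x]_R` over `x`. -/
def fibreMeasure (x : X) : Measure (X × X) :=
  (Measure.count.restrict {y | R.rel x y}).map (Prod.mk x)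

/-- The measure `ν(A) = ∫ |{y : (x, y) ∈ A ∩ R}| dμ(x)`, as a measure on `X × X` that is
concentrated on `R`; see `relMeasure_apply`. -/
def relMeasure : Measure (X × X) := μ.bind R.fibreMeasure

theorem measurableSet_class (x : X) : MeasurableSet {y | R.rel x y} :=
  measurable_prodMk_left R.measurableSet_rel

theorem fibreMeasure_apply (x : X) {A : Set (X × X)} (hA : MeasurableSet A) :
    R.fibreMeasure x A = Measure.count {y | (x, y) ∈ A ∧ R.rel x y} := by
  rw [fibreMeasure, Measure.map_apply measurable_prodMk_left hA,
    Measure.restrict_apply (measurable_prodMk_left hA)]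
  rfl

theorem memLp_comp_fst {f : X → ℂ} (hf : IsBddBorel f) :
    MemLp (fun p : X × X => f p.1) ∞ R.relMeasure :=
  memLp_top_of_bound (hf.1.comp measurable_fst).aestronglyMeasurable hf.2.choose
    (Eventually.of_forall fun p => hf.2.choose_spec p.1)

section Standard

variable [StandardBorelSpace X]

theorem measurable_fibreMeasure : Measurable R.fibreMeasure := by
  refine Measure.measurable_of_measurable_coe _ fun A hA => ?_
  obtain ⟨Γ, _, _, _, hpres, hrel⟩ := R.measure_preserving
  obtain ⟨e, he⟩ := exists_surjective_nat Γ
  have hm : ∀ n, Measurable fun x : X => e n • x := fun n => (hpres (e n)).measurable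
  let S : ℕ → Set X := fun n =>
    {x | (x, e n • x) ∈ A} ∩ ⋂ k, ⋂ (_ : k < n), {x | e k • x = e n • x}ᶜ
  have hS : ∀ n, MeasurableSet (S n) := fun n =>
    ((measurable_id.prodMk (hm n)) hA).inter <| MeasurableSet.iInter fun k =>
      MeasurableSet.iInter fun _ => (measurableSet_eq_fun (hm k) (hm n)).compl
  have key : ∀ x, R.fibreMeasure x A = ∑' n, (S n).indicator (fun _ => (1 : ℝ≥0∞)) x := by
    intro x
    rw [R.fibreMeasure_apply x hA]
    have hU : {y | (x, y) ∈ A ∧ R.rel x y} = ⋃ n, {y | x ∈ S n ∧ y = e n • x} := by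
      ext y
      simp only [Set.mem_ofPred_eq, Set.mem_iUnion]
      constructor
      · rintro ⟨hy, hxy⟩
        have hxy' : ∃ n, y = e n • x := by
          have h2 : R.rel y x := R.rel.symm hxy
          rw [hrel] at h2
          obtain ⟨γ, hγ⟩ := h2
          obtain ⟨n, rfl⟩ := he γ
          exact ⟨n, hγ.symm⟩
        classical
        refine ⟨Nat.find hxy', ⟨?_, ?_⟩, Nat.find_spec hxy'⟩
        · show (x, _) ∈ A
          rw [← Nat.find_spec hxy']
          exact hy
        · simp only [Set.mem_iInter, Set.mem_compl_iff, Set.mem_ofPred_eq]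
          intro k hk h
          exact Nat.find_min hxy' hk ((Nat.find_spec hxy').trans h.symm)
      · rintro ⟨n, hx, rfl⟩
        refine ⟨hx.1, ?_⟩
        apply R.rel.symm
        rw [hrel]
        exact ⟨e n, rfl⟩
    rw [hU, measure_iUnion]
    · congr 1
      ext n
      by_cases hx : x ∈ S n
      · simp [hx]
      · simp [hx]
    · have aux : ∀ i j, i < j →
          Disjoint {y | x ∈ S i ∧ y = e i • x} {y | x ∈ S j ∧ y = e j • x} := by
        intro i j hij
        rw [Set.disjoint_left]
        rintro y ⟨-, hy⟩ ⟨hx, hy'⟩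
        have := hx.2
        simp only [Set.mem_iInter, Set.mem_compl_iff, Set.mem_ofPred_eq] at this
        exact this i hij (hy.symm.trans hy')
      intro i j hij
      rcases lt_or_gt_of_ne hij with h | h
      · exact aux i j h
      · exact (aux j i h).symm
    · intro n
      by_cases hx : x ∈ S n
      · simp [hx]
      · simp [hx]
  simp_rw [key]
  exact Measurable.tsum fun n => measurable_const.indicator (hS n)

theorem relMeasure_apply {A : Set (X × X)} (hA : MeasurableSet A) :
    R.relMeasure A = ∫⁻ x, Measure.count {y | (x, y) ∈ A ∧ R.rel x y} ∂μ := by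
  rw [relMeasure, Measure.bind_apply hA R.measurable_fibreMeasure.aemeasurable]
  exact lintegral_congr fun x => R.fibreMeasure_apply x hA

theorem relMeasure_diagonal : R.relMeasure (Set.diagonal X) = μ Set.univ := by
  rw [R.relMeasure_apply measurableSet_diagonal]
  have : ∀ x, {y | (x, y) ∈ Set.diagonal X ∧ R.rel x y} = {x} := by
    intro x
    ext y
    simp only [Set.mem_diagonal_iff, Set.mem_ofPred_eq, Set.mem_singleton_iff]
    exact ⟨fun h => h.1.symm, fun h => ⟨h.symm, h ▸ R.rel.refl _⟩⟩
  simp_rw [this]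
  simp

/-- The map `(x, y) ↦ (θ⁻¹ x, y)` preserves the measure of the relation. -/
theorem measurePreserving_symm_prod {θ : X ≃ᵐ X} (hθ : θ ∈ R.fullGroup) :
    MeasurePreserving (fun p : X × X => (θ.symm p.1, p.2)) R.relMeasure R.relMeasure := by
  have hm : Measurable fun p : X × X => (θ.symm p.1, p.2) :=
    (θ.symm.measurable.comp measurable_fst).prodMk measurable_snd
  refine ⟨hm, Measure.ext fun A hA => ?_⟩
  rw [Measure.map_apply hm hA, R.relMeasure_apply (hm hA), R.relMeasure_apply hA,
    ← hθ.1.lintegral_comp_emb θ.measurableEmbedding]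
  refine lintegral_congr_ae ?_
  filter_upwards [hθ.2] with x hx
  congr 1
  ext y
  simp only [Set.mem_preimage, Set.mem_ofPred_eq, MeasurableEquiv.symm_apply_apply]
  exact and_congr_right fun _ =>
    ⟨fun h => R.rel.trans hx h, fun h => R.rel.trans (R.rel.symm hx) h⟩

/-! ### The von Neumann algebra of the relation -/

/-- The Hilbert space `L²(R, ν)`. -/
abbrev L2 : Type u := Lp ℂ 2 R.relMeasure

/-- The unitary `u_θ`, `(u_θ g)(x, y) = g(θ⁻¹ x, y)`. -/
def unitary (θ : X ≃ᵐ X) (hθ : θ ∈ R.fullGroup) : R.L2 →L[ℂ] R.L2 :=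
  (Lp.compMeasurePreservingₗᵢ ℂ _ (R.measurePreserving_symm_prod hθ)).toContinuousLinearMap

theorem unitary_ae (θ : X ≃ᵐ X) (hθ : θ ∈ R.fullGroup) (g : R.L2) :
    ⇑(R.unitary θ hθ g) =ᵐ[R.relMeasure] fun p => g (θ.symm p.1, p.2) :=
  Lp.coeFn_compMeasurePreserving g (R.measurePreserving_symm_prod hθ)

/-- The multiplication operator `L_f`, `(L_f g)(x, y) = f(x) g(x, y)`. (Every class in
`L^∞(X, μ)` has a bounded Borel representative `f`.) -/
def mulOp (f : X → ℂ) (hf : IsBddBorel f) : R.L2 →L[ℂ] R.L2 :=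
  (ContinuousLinearMap.mul ℂ ℂ).holderL R.relMeasure ∞ 2 2 ((R.memLp_comp_fst hf).toLp _)

theorem mulOp_ae (f : X → ℂ) (hf : IsBddBorel f) (g : R.L2) :
    ⇑(R.mulOp f hf g) =ᵐ[R.relMeasure] fun p => f p.1 * g p := by
  have h1 := (ContinuousLinearMap.mul ℂ ℂ).coeFn_holder (r := 2)
    ((R.memLp_comp_fst hf).toLp _) g
  filter_upwards [h1, (R.memLp_comp_fst hf).coeFn_toLp] with p h1 h2
  simp only [mulOp, ContinuousLinearMap.holderL_apply_apply]
  rw [h1, h2]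
  rfl

theorem mulOp_eq_iff (f : X → ℂ) (hf : IsBddBorel f) (T : R.L2 →L[ℂ] R.L2) :
    T = R.mulOp f hf ↔ ∀ g : R.L2, ⇑(T g) =ᵐ[R.relMeasure] fun p => f p.1 * g p := by
  constructor
  · rintro rfl g
    exact R.mulOp_ae f hf g
  · intro h
    ext1 g
    exact Lp.ext ((h g).trans (R.mulOp_ae f hf g).symm)

/-- The subalgebra `L^∞(X, μ) = {L_f}` of the bounded operators on `L²(R, ν)`. -/
def cartan : StarSubalgebra ℂ (R.L2 →L[ℂ] R.L2) where
  carrier := {T | ∃ (f : X → ℂ) (hf : IsBddBorel f), T = R.mulOp f hf}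
  mul_mem' := by
    rintro _ _ ⟨f, hf, rfl⟩ ⟨g, hg, rfl⟩
    obtain ⟨hfm, C, hC⟩ := id hf
    obtain ⟨hgm, D, hD⟩ := id hg
    have hfg : IsBddBorel fun x => f x * g x := ⟨hfm.mul hgm, C * D, fun x => by
      rw [norm_mul]
      exact mul_le_mul (hC x) (hD x) (norm_nonneg _) ((norm_nonneg _).trans (hC x))⟩
    refine ⟨_, hfg, (R.mulOp_eq_iff _ hfg _).2 fun k => ?_⟩
    filter_upwards [R.mulOp_ae f hf (R.mulOp g hg k), R.mulOp_ae g hg k] with p h1 h2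
    rw [mul_apply_eq_comp, h1, h2, mul_assoc]
  add_mem' := by
    rintro _ _ ⟨f, hf, rfl⟩ ⟨g, hg, rfl⟩
    obtain ⟨hfm, C, hC⟩ := id hf
    obtain ⟨hgm, D, hD⟩ := id hg
    have hfg : IsBddBorel fun x => f x + g x :=
      ⟨hfm.add hgm, C + D, fun x => (norm_add_le _ _).trans (add_le_add (hC x) (hD x))⟩
    refine ⟨_, hfg, (R.mulOp_eq_iff _ hfg _).2 fun k => ?_⟩
    filter_upwards [R.mulOp_ae f hf k, R.mulOp_ae g hg k,
      Lp.coeFn_add (R.mulOp f hf k) (R.mulOp g hg k)] with p h1 h2 h3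
    rw [add_apply, h3, Pi.add_apply, h1, h2, add_mul]
  algebraMap_mem' := by
    intro c
    have hc : IsBddBorel fun _ : X => c := ⟨measurable_const, ‖c‖, fun _ => le_rfl⟩
    refine ⟨_, hc, (R.mulOp_eq_iff _ hc _).2 fun k => ?_⟩
    have : (algebraMap ℂ (R.L2 →L[ℂ] R.L2) c) k = c • k := rfl
    rw [this]
    exact Lp.coeFn_smul c k
  star_mem' := by
    rintro _ ⟨f, hf, rfl⟩
    have hf' : IsBddBorel fun x => star (f x) :=
      ⟨continuous_star.measurable.comp hf.1, hf.2.choose, fun x => by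
        rw [norm_star]; exact hf.2.choose_spec x⟩
    refine ⟨fun x => star (f x), hf', ?_⟩
    rw [ContinuousLinearMap.star_eq_adjoint]
    symm
    rw [ContinuousLinearMap.eq_adjoint_iff]
    intro g k
    rw [L2.inner_def, L2.inner_def]
    refine integral_congr_ae ?_
    filter_upwards [R.mulOp_ae f hf k, R.mulOp_ae _ hf' g] with p h1 h2
    rw [h1, h2]
    simp only [RCLike.inner_apply, map_mul, RCLike.star_def, Complex.conj_conj]
    ring

/-- The generators `L_f`, `f ∈ L^∞(X, μ)`, and `u_θ`, `θ ∈ [R]`, of `L(R)`. -/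
def generators : Set (R.L2 →L[ℂ] R.L2) :=
  (R.cartan : Set (R.L2 →L[ℂ] R.L2)) ∪
    {T | ∃ (θ : X ≃ᵐ X) (hθ : θ ∈ R.fullGroup), T = R.unitary θ hθ}

/-- The von Neumann algebra `L(R)` generated by the `L_f` and the `u_θ`, as the double commutant
of the generators and their adjoints. By von Neumann's theorem this is the strong operator closure
of the unital `*`-algebra `span {L_f u_θ}`. -/
def vonNeumann : VonNeumannAlgebra R.L2 where
  toStarSubalgebra := StarSubalgebra.centralizer ℂ
    (StarSubalgebra.centralizer ℂ R.generators : Set (R.L2 →L[ℂ] R.L2))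
  centralizer_centralizer' := by
    show Set.centralizer (Set.centralizer (SetLike.coe (StarSubalgebra.centralizer ℂ _))) =
      SetLike.coe (StarSubalgebra.centralizer ℂ _)
    rw [StarSubalgebra.coe_centralizer, Set.centralizer_centralizer_centralizer]

theorem generators_subset : R.generators ⊆ (R.vonNeumann : Set (R.L2 →L[ℂ] R.L2)) := by
  intro T hT
  show T ∈ StarSubalgebra.centralizer ℂ _
  rw [StarSubalgebra.mem_centralizer_iff]
  intro S hS
  have h1 := (StarSubalgebra.mem_centralizer_iff ℂ).1 hS T hT
  refine ⟨h1.1.symm, ?_⟩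
  have h2 := congrArg star h1.2
  simpa using h2

theorem cartan_le : R.cartan ≤ R.vonNeumann.toStarSubalgebra :=
  fun _ hT => R.generators_subset (Or.inl hT)

variable [IsFiniteMeasure μ]

/-- The vector `1_Δ ∈ L²(R, ν)`. -/
def diagVector : R.L2 :=
  indicatorConstLp 2 (s := Set.diagonal X) measurableSet_diagonal
    (by rw [R.relMeasure_diagonal]; exact measure_ne_top μ _) 1

/-- The trace `τ(y) = ⟨y 1_Δ, 1_Δ⟩` on `L(R)`. (Mathlib's inner product is linear in the second
variable.) -/
def trace (y : R.vonNeumann) : ℂ :=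
  inner ℂ R.diagVector ((y : R.L2 →L[ℂ] R.L2) R.diagVector)

end Standard

end CountablePMPEquivRel

/-! ### Hilbert bimodules and relative property (T) -/

section Bimodules

variable {K : Type u} [NormedAddCommGroup K] [InnerProductSpace ℂ K] [CompleteSpace K]

/-- Normality of a positive map from a von Neumann algebra to the bounded operators on `H`:
suprema of upward directed families of positive elements are preserved. -/
def IsNormalMap (M : VonNeumannAlgebra K) {H : Type v} [NormedAddCommGroup H]
    [InnerProductSpace ℂ H] [CompleteSpace H] (φ : M.toStarSubalgebra → (H →L[ℂ] H)) : Prop :=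
  ∀ (D : Set M.toStarSubalgebra) (s : M.toStarSubalgebra), D.Nonempty →
    DirectedOn (fun x y : M.toStarSubalgebra => (x : K →L[ℂ] K) ≤ (y : K →L[ℂ] K)) D → (∀ x ∈ D, 0 ≤ (x : K →L[ℂ] K)) →
    IsLUB ((fun x : M.toStarSubalgebra => (x : K →L[ℂ] K)) '' D) s → IsLUB (φ '' D) (φ s)

/-- A Hilbert `M`-bimodule structure on the Hilbert space `H`: commuting normal unital
`*`-representations of `M` (left action) and of its opposite algebra (right action). -/
structure HilbertBimodule (M : VonNeumannAlgebra K) (H : Type v) [NormedAddCommGroup H]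
    [InnerProductSpace ℂ H] [CompleteSpace H] where
  /-- the left action `x ↦ (η ↦ x η)` -/
  left : M.toStarSubalgebra →⋆ₐ[ℂ] (H →L[ℂ] H)
  /-- the right action `x ↦ (η ↦ η x)` -/
  right : (M.toStarSubalgebra)ᵐᵒᵖ →⋆ₐ[ℂ] (H →L[ℂ] H)
  commute : ∀ x y, Commute (left x) (right y)
  normal_left : IsNormalMap M left
  normal_right : IsNormalMap M fun x => right (MulOpposite.op x)

namespace HilbertBimodule

variable {M : VonNeumannAlgebra K} {H : Type v} [NormedAddCommGroup H] [InnerProductSpace ℂ H]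
  [CompleteSpace H] (E : HilbertBimodule M H)

/-- `x ξ` -/
def lact (x : M.toStarSubalgebra) (ξ : H) : H := E.left x ξ

/-- `ξ x` -/
def ract (ξ : H) (x : M.toStarSubalgebra) : H := E.right (MulOpposite.op x) ξ

/-- `ξ` is tracial: `⟨x ξ, ξ⟩ = ⟨ξ x, ξ⟩ = τ(x)` for all `x ∈ M`. -/
def IsTracial (τ : M.toStarSubalgebra → ℂ) (ξ : H) : Prop :=
  ∀ x, inner ℂ ξ (E.lact x ξ) = τ x ∧ inner ℂ ξ (E.ract ξ x) = τ x

/-- `η` is `B`-central: `b η = η b` for all `b ∈ B`. -/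
def IsCentral {B : StarSubalgebra ℂ (K →L[ℂ] K)} (hB : B ≤ M.toStarSubalgebra) (η : H) : Prop :=
  ∀ (b : K →L[ℂ] K) (hb : b ∈ B), E.lact ⟨b, hB hb⟩ η = E.ract η ⟨b, hB hb⟩

end HilbertBimodule

/-- Rigidity (relative property (T)) of an inclusion `B ⊆ M`, where `M` carries the trace `τ`. -/
def IsRigidInclusion (M : VonNeumannAlgebra K) (τ : M.toStarSubalgebra → ℂ)
    {B : StarSubalgebra ℂ (K →L[ℂ] K)} (hB : B ≤ M.toStarSubalgebra) : Prop :=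
  ∀ ε : ℝ, 0 < ε → ∃ (F : Finset M.toStarSubalgebra) (δ : ℝ), 0 < δ ∧
    ∀ (H : Type v) [NormedAddCommGroup H] [InnerProductSpace ℂ H] [CompleteSpace H]
      (E : HilbertBimodule M H) (ξ : H), ‖ξ‖ = 1 → E.IsTracial τ ξ →
      (∀ x ∈ F, ‖E.lact x ξ - E.ract ξ x‖ ≤ δ) →
      ∃ η : H, E.IsCentral hB η ∧ ‖η - ξ‖ ≤ ε

end Bimodules

/-- `R` is rigid: the inclusion `L^∞(X, μ) ⊆ L(R)` is rigid. -/
def CountablePMPEquivRel.IsRigid {X : Type u} [MeasurableSpace X] [StandardBorelSpace X]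
    {μ : Measure X} [IsFiniteMeasure μ] (R : CountablePMPEquivRel X μ) : Prop :=
  IsRigidInclusion.{u, v} R.vonNeumann R.trace R.cartan_le

end

/-! The argument is by contraposition. If the inclusion is not rigid, some `ε > 0` admits, for every
finite set of elements and every tolerance, a tracial unit vector `ξ` in a bimodule that almost
commutes with these elements, while every `L^∞`-central vector is farther than `ε` from `ξ`. The
left and right actions of the projections `1_A` form commuting families `P` and `Q`, and `(A, B) ↦
‖P A (Q B ξ)‖²` is a bimeasure with both marginals `μ`. Since `X` is standard it extends to a
probability measure `ν` on `X × X` (`IsBimeasure.exists_measure_prod`). Almost commuting with `1_A`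
makes `ν (A ×ˢ Aᶜ)` small; almost commuting with `u_θ` makes `ν` almost invariant under `θ × θ`
(`measureClose_of_unitary`). Cutting `ξ` down to smaller and smaller neighbourhoods of the diagonal
yields a central vector at squared distance `1 - ν(Δ)` (`IsProjectionFamily.exists_central`), so `ν`
has mass at least `ε²` off the diagonal.

Discarding the diagonal and symmetrizing leaves almost invariant measures `ρ_n`, concentrating near
the diagonal, of mass bounded below, but with marginals only bounded above by `μ`. The main
difficulty is to obtain marginals equal to `μ`, and this is where ergodicity enters: the marginal of
`ρ_n` is weakly asymptotic to `ρ_n(X × X) μ` (`tendsto_integral_sub_mul_integral`). Let `ρ₀` have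
mass about `c`, and let `b` be the density of the missing part `μ - p¹_* ρ₀`. For large `n` the
measure `min (b x) (b y) ρ_n` fits into the missing part and is almost invariant, because `b` is.
Its mass is at least about `c (1 - c)`, because `b x ≈ b y` near the diagonal and the marginal of
`ρ_n` is nearly constant. Adding it to `ρ₀` turns the defect `1 - c` into `(1 - c)²`
(`HasAlmostInvariant.amplify`), and iteration brings the mass arbitrarily close to `1`. The last
defect `κ` is filled by the normalized product `κ × κ`, which does not charge the diagonal as there
are no atoms (`exists_measure_marginals_eq`).

Condition (i) then follows by approximation from a countable dense family of sets, and condition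
(ii) for an arbitrary element of the full group by cutting `X` into pieces on which it agrees with
members of a countable generating family (`tendsto_measureDist_of_ae_exists_eq`). -/

noncomputable section

/-! ### Bimeasures -/

/-- A positive set function on measurable rectangles which is finitely additive in each variable and
has marginals `μ` and `κ`. -/
structure IsBimeasure {X : Type*} {Y : Type*} [MeasurableSpace X] [MeasurableSpace Y]
    (μ : Measure X) (κ : Measure Y) (b : Set X → Set Y → ℝ≥0∞) : Prop where
  union_left : ∀ A A' B, MeasurableSet A → MeasurableSet A' → MeasurableSet B → Disjoint A A' →
    b (A ∪ A') B = b A B + b A' B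
  union_right : ∀ A B B', MeasurableSet A → MeasurableSet B → MeasurableSet B' → Disjoint B B' →
    b A (B ∪ B') = b A B + b A B'
  univ_right : ∀ A, MeasurableSet A → b A Set.univ = μ A
  univ_left : ∀ B, MeasurableSet B → b Set.univ B = κ B

/-- Domination by a finite measure forces continuity at `∅`, which upgrades finite additivity to
countable additivity. Applied to both sections of a bimeasure. -/
theorem exists_measure_eq_of_additive_of_le {X : Type*} [MeasurableSpace X] (μ : Measure X)
    [IsFiniteMeasure μ] (m : Set X → ℝ≥0∞)
    (hadd : ∀ A A', MeasurableSet A → MeasurableSet A' → Disjoint A A' → m (A ∪ A') = m A + m A')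
    (hle : ∀ A, MeasurableSet A → m A ≤ μ A) :
    ∃ ν : Measure X, ∀ A, MeasurableSet A → ν A = m A := by
  have h0 : m ∅ = 0 := by simpa using hle ∅ MeasurableSet.empty
  have hC : IsSetRing {s : Set X | MeasurableSet s} :=
    ⟨MeasurableSet.empty, fun _ _ hs ht => hs.union ht, fun _ _ hs ht => hs.diff ht⟩
  let M : AddContent ℝ≥0∞ {s : Set X | MeasurableSet s} :=
    hC.addContent_of_union m h0 fun hs ht hd => hadd _ _ hs ht hd
  have hM : ∀ s, M s = m s := fun _ => rfl
  refine ⟨Measure.ofMeasurable (fun s _ => m s) h0 fun f hf hd => ?_, fun A hA =>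
    Measure.ofMeasurable_apply A hA⟩
  refine addContent_iUnion_eq_sum_of_tendsto_zero hC M
    (fun s hs => ((hle s hs).trans_lt (measure_lt_top μ s)).ne) (fun s hs ha hi => ?_) hf
    (MeasurableSet.iUnion hf) hd
  have := tendsto_measure_iInter_atTop (μ := μ) (fun i => (hs i).nullMeasurableSet) ha
    ⟨0, measure_ne_top μ _⟩
  rw [hi, measure_empty] at this
  exact tendsto_of_tendsto_of_tendsto_of_le_of_le tendsto_const_nhds this (fun _ => zero_le)
    (fun n => hle _ (hs n))

namespace IsBimeasure

variable {X : Type*} {Y : Type*} [MeasurableSpace X] [MeasurableSpace Y]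
    {μ : Measure X} {κ : Measure Y} {b : Set X → Set Y → ℝ≥0∞}

theorem swap (h : IsBimeasure μ κ b) : IsBimeasure κ μ (fun B A => b A B) :=
  ⟨fun _ _ _ h1 h2 h3 h4 => h.union_right _ _ _ h3 h1 h2 h4,
    fun _ _ _ h1 h2 h3 h4 => h.union_left _ _ _ h2 h3 h1 h4, h.univ_left, h.univ_right⟩

theorem mono_right (h : IsBimeasure μ κ b) {A : Set X} {B B' : Set Y} (hA : MeasurableSet A)
    (hB : MeasurableSet B) (hB' : MeasurableSet B') (hBB' : B ⊆ B') : b A B ≤ b A B' := by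
  rw [← Set.union_sdiff_cancel hBB', h.union_right A B _ hA hB (hB'.diff hB) Set.disjoint_sdiff_right]
  exact le_self_add

theorem exists_measure_left [IsFiniteMeasure μ] (h : IsBimeasure μ κ b) {B : Set Y}
    (hB : MeasurableSet B) : ∃ ν : Measure X, ∀ A, MeasurableSet A → ν A = b A B :=
  exists_measure_eq_of_additive_of_le μ (fun A => b A B)
    (fun A A' hA hA' hd => h.union_left A A' B hA hA' hB hd)
    (fun A hA => (h.mono_right hA hB MeasurableSet.univ (Set.subset_univ _)).trans_eq
      (h.univ_right A hA))

theorem exists_measure_right [IsFiniteMeasure κ] (h : IsBimeasure μ κ b) {A : Set X}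
    (hA : MeasurableSet A) : ∃ ν : Measure Y, ∀ B, MeasurableSet B → ν B = b A B :=
  h.swap.exists_measure_left hA

/-- The density of `A ↦ b A B` with respect to `μ`. -/
theorem exists_density [IsFiniteMeasure μ] (h : IsBimeasure μ κ b) {B : Set Y}
    (hB : MeasurableSet B) : ∃ g : X → ℝ≥0∞, Measurable g ∧
      ∀ A, MeasurableSet A → ∫⁻ x in A, g x ∂μ = b A B := by
  obtain ⟨ν, hν⟩ := h.exists_measure_left hB
  have hle : ν ≤ μ := Measure.le_iff.2 fun A hA => by
    rw [hν A hA, ← h.univ_right A hA]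
    exact h.mono_right hA hB MeasurableSet.univ (Set.subset_univ _)
  have : IsFiniteMeasure ν := isFiniteMeasure_of_le μ hle
  exact ⟨ν.rnDeriv μ, Measure.measurable_rnDeriv _ _, fun A hA => by
    rw [Measure.setLIntegral_rnDeriv hle.absolutelyContinuous, hν A hA]⟩

/-- The densities for the half-lines `Iic q` behave almost everywhere like a distribution function
on `ℚ`. Inequalities between the set functions pass to the densities. Right continuity and the
limits at infinity come from a one-sided pointwise bound whose integrals, computed with `κ`, leave
no room for strict inequality. -/
theorem ae_isRatStieltjesPoint {κ : Measure ℝ} [IsProbabilityMeasure μ] [IsProbabilityMeasure κ]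
    {b : Set X → Set ℝ → ℝ≥0∞} (h : IsBimeasure μ κ b) {g : ℚ → X → ℝ≥0∞}
    (hg : ∀ q, Measurable (g q))
    (hgb : ∀ q A, MeasurableSet A → ∫⁻ x in A, g q x ∂μ = b A (Set.Iic (q : ℝ))) :
    (∀ᵐ x ∂μ, ∀ q, g q x ≤ 1) ∧
    ∀ᵐ x ∂μ, ProbabilityTheory.IsRatStieltjesPoint (fun x q => (g q x).toReal) x := by
  have hgi : ∀ q, ∫⁻ x, g q x ∂μ = κ (Set.Iic (q : ℝ)) := fun q => by
    rw [← setLIntegral_univ, hgb q _ MeasurableSet.univ, h.univ_left _ measurableSet_Iic]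
  have hmono : ∀ᵐ x ∂μ, ∀ q r : ℚ, q ≤ r → g q x ≤ g r x := by
    simp only [ae_all_iff]
    intro q r hqr
    refine ae_le_of_forall_setLIntegral_le_of_sigmaFinite (hg q) fun A hA _ => ?_
    rw [hgb q A hA, hgb r A hA]
    exact h.mono_right hA measurableSet_Iic measurableSet_Iic
      (Set.Iic_subset_Iic.2 (by exact_mod_cast hqr))
  have hone : ∀ᵐ x ∂μ, ∀ q, g q x ≤ 1 := by
    rw [ae_all_iff]
    intro q
    refine ae_le_of_forall_setLIntegral_le_of_sigmaFinite (hg q) fun A hA _ => ?_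
    rw [hgb q A hA, setLIntegral_one, ← h.univ_right A hA]
    exact h.mono_right hA measurableSet_Iic MeasurableSet.univ (Set.subset_univ _)
  have hright : ∀ q : ℚ, ∀ᵐ x ∂μ, ⨅ n : ℕ, g (q + 1 / ((n : ℚ) + 1)) x ≤ g q x := by
    intro q
    have hanti : Antitone fun n : ℕ => (q + 1 / ((n : ℚ) + 1)) := fun m n hmn => by
      dsimp only; gcongr
    have hle : g q ≤ᵐ[μ] fun x => ⨅ n : ℕ, g (q + 1 / ((n : ℚ) + 1)) x := by
      filter_upwards [hmono] with x hx
      refine le_iInf fun n => hx _ _ ?_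
      have : (0 : ℚ) ≤ 1 / ((n : ℚ) + 1) := by positivity
      linarith
    have hfin : ∫⁻ x, g q x ∂μ ≠ ∞ := by rw [hgi]; exact measure_ne_top _ _
    -- The reverse inequality need only hold for the integrals, where it is continuity of `κ` from
    -- above.
    refine (ae_eq_of_ae_le_of_lintegral_le hle hfin
      (Measurable.iInf fun n => hg _).aemeasurable ?_).symm.le
    have ht : Tendsto (fun n : ℕ => κ (Set.Iic ((q + 1 / ((n : ℚ) + 1) : ℚ) : ℝ))) atTop
        (𝓝 (κ (Set.Iic (q : ℝ)))) := by
      have := tendsto_measure_iInter_atTop (μ := κ)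
        (s := fun n : ℕ => Set.Iic ((q + 1 / ((n : ℚ) + 1) : ℚ) : ℝ))
        (fun i => measurableSet_Iic.nullMeasurableSet)
        (fun m n hmn => Set.Iic_subset_Iic.2 (by exact_mod_cast hanti hmn))
        ⟨0, measure_ne_top κ _⟩
      convert this using 3
      congr 1
      ext y
      simp only [Set.mem_Iic, Set.mem_iInter]
      constructor
      · intro hy n
        refine hy.trans ?_
        push_cast
        have : (0 : ℝ) ≤ 1 / ((n : ℝ) + 1) := by positivity
        linarith
      · intro hy
        refine le_of_tendsto' (f := fun n : ℕ => y - 1 / ((n : ℝ) + 1)) (x := atTop) ?_ fun n => ?_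
        · simpa using (tendsto_const_nhds (x := y)).sub
            (tendsto_one_div_add_atTop_nhds_zero_nat (𝕜 := ℝ))
        · have := hy n
          push_cast at this
          linarith
    rw [hgi]
    refine ge_of_tendsto' ht fun n => ?_
    rw [← hgi]
    exact lintegral_mono fun x => iInf_le _ n
  have htop : ∀ᵐ x ∂μ, 1 ≤ ⨆ n : ℕ, g (n : ℚ) x := by
    have hle : (fun x => ⨆ n : ℕ, g (n : ℚ) x) ≤ᵐ[μ] fun _ => 1 := by
      filter_upwards [hone] with x hx
      exact iSup_le fun n => hx _
    have hl : ∫⁻ x, (⨆ n : ℕ, g (n : ℚ) x) ∂μ ≤ 1 := by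
      refine (lintegral_mono_ae hle).trans ?_
      simp
    refine (ae_eq_of_ae_le_of_lintegral_le hle (hl.trans_lt ENNReal.one_lt_top).ne
      aemeasurable_const ?_).symm.le
    have ht : Tendsto (fun n : ℕ => κ (Set.Iic (n : ℝ))) atTop (𝓝 (κ Set.univ)) := by
      have := tendsto_measure_iUnion_atTop (μ := κ) (s := fun n : ℕ => Set.Iic (n : ℝ))
        (fun m n hmn => Set.Iic_subset_Iic.2 (by exact_mod_cast hmn))
      convert this using 3
      congr 1
      ext y
      simpa using exists_nat_ge y
    simp only [lintegral_const, measure_univ, mul_one] at ht ⊢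
    refine le_of_tendsto' ht fun n => ?_
    have := hgi n
    push_cast at this
    rw [← this]
    exact lintegral_mono fun x => le_iSup (fun n : ℕ => g (n : ℚ) x) n
  have hbot : ∀ᵐ x ∂μ, ⨅ n : ℕ, g (-(n : ℚ)) x = 0 := by
    refine (lintegral_eq_zero_iff' (f := fun x => ⨅ n : ℕ, g (-(n : ℚ)) x)
      (Measurable.iInf fun n => hg _).aemeasurable).1 ?_
    have ht : Tendsto (fun n : ℕ => κ (Set.Iic (-(n : ℝ)))) atTop (𝓝 0) := by
      have := tendsto_measure_iInter_atTop (μ := κ) (s := fun n : ℕ => Set.Iic (-(n : ℝ)))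
        (fun i => measurableSet_Iic.nullMeasurableSet)
        (fun m n hmn => Set.Iic_subset_Iic.2 (by
          have : (m : ℝ) ≤ n := by exact_mod_cast hmn
          linarith)) ⟨0, measure_ne_top κ _⟩
      have he : (⋂ n : ℕ, Set.Iic (-(n : ℝ))) = ∅ := by
        ext y
        simp only [Set.mem_iInter, Set.mem_Iic, Set.mem_empty_iff_false, iff_false, not_forall,
          not_le]
        obtain ⟨n, hn⟩ := exists_nat_gt (-y)
        exact ⟨n, by linarith⟩
      rw [he, measure_empty] at this
      exact this
    refine le_antisymm (ge_of_tendsto' ht fun n => ?_) zero_le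
    have := hgi (-n)
    push_cast at this
    rw [← this]
    exact lintegral_mono fun x => iInf_le _ n
  refine ⟨hone, ?_⟩
  filter_upwards [hmono, hone, ae_all_iff.2 hright, htop, hbot] with x h1 h2 h3 h4 h5
  have hfin : ∀ q, g q x ≠ ∞ := fun q => ((h2 q).trans_lt ENNReal.one_lt_top).ne
  have hm : Monotone fun q => g q x := fun q r hqr => h1 q r hqr
  have hmr : Monotone fun q => (g q x).toReal := fun q r hqr =>
    ENNReal.toReal_mono (hfin r) (h1 q r hqr)
  refine ⟨hmr, ?_, ?_, fun t => ?_⟩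
  · have : Tendsto (fun q => g q x) atTop (𝓝 1) := by
      have hs : ⨆ q, g q x = 1 := le_antisymm (iSup_le h2) (h4.trans (iSup_le fun n => le_iSup (fun q => g q x) _))
      rw [← hs]
      exact tendsto_atTop_iSup hm
    exact (ENNReal.tendsto_toReal ENNReal.one_ne_top).comp this
  · have : Tendsto (fun q => g q x) atBot (𝓝 0) := by
      have hs : ⨅ q, g q x = 0 := le_antisymm
        ((le_iInf fun n => iInf_le (fun q => g q x) _).trans h5.le) zero_le
      rw [← hs]
      exact tendsto_atBot_iInf hm
    exact (ENNReal.tendsto_toReal ENNReal.zero_ne_top).comp this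
  · have hbdd : BddBelow (Set.range fun r : Set.Ioi t => (g r x).toReal) :=
      ⟨0, by rintro _ ⟨r, rfl⟩; exact ENNReal.toReal_nonneg⟩
    refine le_antisymm ?_ (le_ciInf fun r => hmr r.2.le)
    have hs : ⨅ n : ℕ, g (t + 1 / ((n : ℚ) + 1)) x = g t x :=
      le_antisymm (h3 t) (le_iInf fun n => h1 _ _ (by
        have : (0 : ℚ) ≤ 1 / ((n : ℚ) + 1) := by positivity
        linarith))
    have hanti : Antitone fun n : ℕ => g (t + 1 / ((n : ℚ) + 1)) x := fun m n hmn =>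
      h1 _ _ (by gcongr)
    have ht := tendsto_atTop_iInf hanti
    rw [hs] at ht
    refine ge_of_tendsto' ((ENNReal.tendsto_toReal (hfin t)).comp ht) fun n => ?_
    refine ciInf_le hbdd ⟨t + 1 / ((n : ℚ) + 1), ?_⟩
    have : (0 : ℚ) < 1 / ((n : ℚ) + 1) := by positivity
    exact Set.mem_Ioi.2 (by linarith)

/-- Disintegration: the rational distribution functions define a Markov kernel from `X` to `ℝ`, and
the measure sought is its composition product with `μ`. -/
theorem exists_measure_prod_real {κ : Measure ℝ} [IsProbabilityMeasure μ] [IsProbabilityMeasure κ]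
    {b : Set X → Set ℝ → ℝ≥0∞} (h : IsBimeasure μ κ b) :
    ∃ ν : Measure (X × ℝ), ∀ A B, MeasurableSet A → MeasurableSet B → ν (A ×ˢ B) = b A B := by
  choose g hg hgb using fun q : ℚ => h.exists_density (measurableSet_Iic (a := (q : ℝ)))
  obtain ⟨hone, hpt⟩ := h.ae_isRatStieltjesPoint hg hgb
  have hf : Measurable fun x (q : ℚ) => (g q x).toReal :=
    measurable_pi_lambda _ fun q => (hg q).ennreal_toReal
  let K : ProbabilityTheory.Kernel X ℝ :=
    ⟨fun x => (ProbabilityTheory.stieltjesOfMeasurableRat _ hf x).measure,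
      ProbabilityTheory.measurable_measure_stieltjesOfMeasurableRat hf⟩
  have hK : ProbabilityTheory.IsMarkovKernel K :=
    ⟨fun x => ⟨ProbabilityTheory.measure_stieltjesOfMeasurableRat_univ hf x⟩⟩
  refine ⟨μ.compProd K, fun A B hA hB => ?_⟩
  obtain ⟨n, hn⟩ := h.exists_measure_right hA
  have hnfin : IsFiniteMeasure n := ⟨by
    rw [hn _ MeasurableSet.univ, h.univ_right A hA]; exact measure_lt_top μ A⟩
  rw [← hn B hB]
  have hIic : ∀ q : ℚ, (μ.compProd K) (A ×ˢ Set.Iic (q : ℝ)) = n (Set.Iic (q : ℝ)) := by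
    intro q
    rw [Measure.compProd_apply_prod hA measurableSet_Iic, hn _ measurableSet_Iic, ← hgb q A hA]
    refine lintegral_congr_ae (ae_restrict_of_ae ?_)
    filter_upwards [hone, hpt] with x h1 h2
    show (ProbabilityTheory.stieltjesOfMeasurableRat _ hf x).measure _ = _
    rw [ProbabilityTheory.measure_stieltjesOfMeasurableRat_Iic,
      ProbabilityTheory.stieltjesOfMeasurableRat_eq,
      ProbabilityTheory.toRatCDF_of_isRatStieltjesPoint h2,
      ENNReal.ofReal_toReal ((h1 q).trans_lt ENNReal.one_lt_top).ne]
  have huniv : (μ.compProd K) (A ×ˢ Set.univ) = n Set.univ := by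
    rw [Measure.compProd_apply_prod hA MeasurableSet.univ, hn _ MeasurableSet.univ,
      h.univ_right A hA]
    simp
  have hmap : ∀ B, MeasurableSet B →
      (((μ.compProd K).restrict (A ×ˢ Set.univ)).map Prod.snd) B = (μ.compProd K) (A ×ˢ B) := by
    intro B hB
    rw [Measure.map_apply measurable_snd hB, Measure.restrict_apply (measurable_snd hB)]
    congr 1
    ext p
    simp [and_comm]
  -- With `A` fixed, both sides are finite measures in `B` of equal mass, so agreement on the
  -- π-system of rational half-lines suffices.
  rw [← hmap B hB]
  congr 1
  refine ext_of_generate_finite _ Real.borel_eq_generateFrom_Iic_rat.symm.symm ?_ ?_ ?_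
  · exact Real.isPiSystem_Iic_rat
  · intro s hs
    simp only [Set.mem_iUnion, Set.mem_singleton_iff] at hs
    obtain ⟨q, rfl⟩ := hs
    rw [hmap _ measurableSet_Iic, hIic]
  · rw [hmap _ MeasurableSet.univ, huniv]

/-- A bimeasure on a product with a standard Borel space extends to a measure on the product. -/
theorem exists_measure_prod [StandardBorelSpace Y] [IsProbabilityMeasure μ]
    [IsProbabilityMeasure κ] (h : IsBimeasure μ κ b) :
    ∃ ν : Measure (X × Y), ∀ A B, MeasurableSet A → MeasurableSet B → ν (A ×ˢ B) = b A B := by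
  obtain ⟨φ, hφ⟩ := exists_measurableEmbedding_real Y
  have h' : IsBimeasure μ (κ.map φ) (fun A B => b A (φ ⁻¹' B)) := by
    refine ⟨fun A A' B hA hA' hB hd => h.union_left _ _ _ hA hA' (hφ.measurable hB) hd,
      fun A B B' hA hB hB' hd => ?_, fun A hA => ?_, fun B hB => ?_⟩
    · rw [Set.preimage_union]
      exact h.union_right _ _ _ hA (hφ.measurable hB) (hφ.measurable hB') (hd.preimage φ)
    · rw [Set.preimage_univ, h.univ_right A hA]
    · rw [Measure.map_apply hφ.measurable hB, h.univ_left _ (hφ.measurable hB)]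
  have : IsProbabilityMeasure (κ.map φ) := Measure.isProbabilityMeasure_map hφ.measurable.aemeasurable
  obtain ⟨ν, hν⟩ := h'.exists_measure_prod_real
  have he : MeasurableEmbedding (Prod.map (id : X → X) φ) := MeasurableEmbedding.id.prodMap hφ
  -- The embedding carries rectangles to rectangles, so it is not necessary to check separately that
  -- `ν` lives on its range.
  refine ⟨ν.comap (Prod.map id φ), fun A B hA hB => ?_⟩
  rw [he.comap_apply, Set.prodMap_image_prod, Set.image_id, hν _ _ hA (hφ.measurableSet_image.2 hB),
    hφ.injective.preimage_image]

end IsBimeasure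

end

noncomputable section

/-! ### One-sided comparison of measures -/

/-- `m₁ E ≤ m₂ E + d` for all measurable sets `E`. -/
def MeasureClose {Y : Type*} [MeasurableSpace Y] (d : ℝ≥0∞) (m₁ m₂ : Measure Y) : Prop :=
  ∀ E, MeasurableSet E → m₁ E ≤ m₂ E + d

namespace MeasureClose

variable {Y : Type*} [MeasurableSpace Y] {d : ℝ≥0∞} {m₁ m₂ : Measure Y}

/-- `κ` is the positive part of `m₁ - m₂`. It is carried by the half of a Hahn decomposition where
`m₁` dominates, so its mass is bounded by a single instance of the hypothesis. -/
theorem exists_le_add [IsFiniteMeasure m₁] [IsFiniteMeasure m₂] (h : MeasureClose d m₁ m₂) :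
    ∃ κ : Measure Y, κ Set.univ ≤ d ∧ m₁ ≤ m₂ + κ := by
  obtain ⟨s, hs⟩ := exists_isHahnDecomposition m₁ m₂
  refine ⟨m₁.restrict sᶜ - m₂.restrict sᶜ, ?_, ?_⟩
  · rw [Measure.sub_apply MeasurableSet.univ hs.ge_on_compl]
    simp only [Measure.restrict_apply_univ]
    rw [tsub_le_iff_left]
    exact h _ hs.measurableSet.compl
  · have h1 : m₁.restrict sᶜ = m₁.restrict sᶜ - m₂.restrict sᶜ + m₂.restrict sᶜ :=
      (Measure.sub_add_cancel_of_le hs.ge_on_compl).symm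
    have e1 := Measure.restrict_add_restrict_compl (μ := m₁) hs.measurableSet
    have e2 := Measure.restrict_add_restrict_compl (μ := m₂) hs.measurableSet
    calc m₁ = m₁.restrict s + m₁.restrict sᶜ := e1.symm
      _ = m₁.restrict s + (m₁.restrict sᶜ - m₂.restrict sᶜ + m₂.restrict sᶜ) := by rw [← h1]
      _ ≤ m₂.restrict s + (m₁.restrict sᶜ - m₂.restrict sᶜ + m₂.restrict sᶜ) :=
          add_le_add_left hs.le_on _
      _ = m₂ + (m₁.restrict sᶜ - m₂.restrict sᶜ) := by
          conv_rhs => enter [1]; rw [← e2]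
          rw [add_assoc, add_comm (m₂.restrict sᶜ)]

theorem lintegral_le [IsFiniteMeasure m₁] [IsFiniteMeasure m₂] (h : MeasureClose d m₁ m₂)
    {f : Y → ℝ≥0∞} (hf : ∀ y, f y ≤ 1) : ∫⁻ y, f y ∂m₁ ≤ ∫⁻ y, f y ∂m₂ + d := by
  obtain ⟨κ, hκ, hle⟩ := h.exists_le_add
  calc ∫⁻ y, f y ∂m₁ ≤ ∫⁻ y, f y ∂(m₂ + κ) := lintegral_mono' hle le_rfl
    _ = ∫⁻ y, f y ∂m₂ + ∫⁻ y, f y ∂κ := lintegral_add_measure _ _ _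
    _ ≤ ∫⁻ y, f y ∂m₂ + d := by
        gcongr
        exact (lintegral_mono (g := fun _ => 1) hf).trans (by simpa using hκ)

theorem symm [IsFiniteMeasure m₁] (h : MeasureClose d m₁ m₂)
    (hu : m₁ Set.univ = m₂ Set.univ) : MeasureClose d m₂ m₁ := by
  intro E hE
  have h1 := measure_add_measure_compl (μ := m₁) hE
  have h2 := measure_add_measure_compl (μ := m₂) hE
  have h3 := h _ hE.compl
  refine (ENNReal.add_le_add_iff_right (a := m₁ Eᶜ) (measure_ne_top _ _)).1 ?_
  calc m₂ E + m₁ Eᶜ ≤ m₂ E + (m₂ Eᶜ + d) := by gcongr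
    _ = m₁ E + d + m₁ Eᶜ := by rw [← add_assoc, h2, ← hu, ← h1]; ring

/-- Write `m₁ + κ' = m₂ + κ`. Equality of the total masses gives `κ'` the mass of `κ`, and the
factor `2` counts both corrections. -/
theorem measureDist_le {Y : Type u} [MeasurableSpace Y] {m₁ m₂ : Measure Y}
    [IsProbabilityMeasure m₁] [IsProbabilityMeasure m₂] (hd : d ≠ ∞) (h : MeasureClose d m₁ m₂) :
    measureDist m₁ m₂ ≤ 2 * d := by
  obtain ⟨κ, hκ, hle⟩ := h.exists_le_add
  have hκf : IsFiniteMeasure κ := ⟨hκ.trans_lt hd.lt_top⟩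
  set κ' := m₂ + κ - m₁ with hκ'
  have e1 : κ' + m₁ = m₂ + κ := Measure.sub_add_cancel_of_le hle
  have hκ'u : κ' Set.univ = κ Set.univ := by
    have := congrArg (fun m : Measure Y => m Set.univ) e1
    simp only [Measure.add_apply, measure_univ] at this
    rw [add_comm] at this
    exact (ENNReal.add_right_inj ENNReal.one_ne_top).1 this
  have hκ'f : IsFiniteMeasure κ' := ⟨by rw [hκ'u]; exact measure_lt_top _ _⟩
  refine iSup₂_le fun f hf => ?_
  have hi : ∀ (m : Measure Y) [IsFiniteMeasure m], Integrable f m := fun m _ =>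
    Integrable.of_bound hf.1.aestronglyMeasurable 1 (Eventually.of_forall hf.2)
  have e2 : ∫ y, f y ∂κ' + ∫ y, f y ∂m₁ = ∫ y, f y ∂m₂ + ∫ y, f y ∂κ := by
    rw [← integral_add_measure (hi _) (hi _), ← integral_add_measure (hi _) (hi _), e1]
  have e3 : (∫ y, f y ∂m₁) - ∫ y, f y ∂m₂ = ∫ y, f y ∂κ - ∫ y, f y ∂κ' := by
    linear_combination e2
  have hb : ∀ m : Measure Y, ‖∫ y, f y ∂m‖ₑ ≤ m Set.univ := fun m => by
    refine (enorm_integral_le_lintegral_enorm _).trans ?_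
    refine (lintegral_mono (g := fun _ => 1) fun y => ?_).trans (by simp)
    have := ENNReal.ofReal_le_ofReal (hf.2 y)
    rwa [ofReal_norm, ENNReal.ofReal_one] at this
  rw [e3, two_mul]
  refine enorm_sub_le.trans (add_le_add ((hb _).trans hκ) ((hb _).trans ?_))
  rw [hκ'u]
  exact hκ

end MeasureClose

/-! ### Measures concentrating near the diagonal -/

section NearDiagonal

variable {X : Type*} [MeasurableSpace X] {μ : Measure X} {ν : ℕ → Measure (X × X)}

theorem measure_prod_univ_le {ρ : Measure (X × X)} (h : ρ.map Prod.fst ≤ μ) {A : Set X}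
    (hA : MeasurableSet A) : ρ (A ×ˢ Set.univ) ≤ μ A := by
  rw [Set.prod_univ, ← Measure.map_apply measurable_fst hA]
  exact h A

theorem measure_univ_prod_le {ρ : Measure (X × X)} (h : ρ.map Prod.snd ≤ μ) {A : Set X}
    (hA : MeasurableSet A) : ρ (Set.univ ×ˢ A) ≤ μ A := by
  rw [Set.univ_prod, ← Measure.map_apply measurable_snd hA]
  exact h A

/-- Replacing `A` by a nearby `S k` costs `μ (A ∆ S k)` in each coordinate, uniformly in `n`, since
both marginals are at most `μ`. -/
theorem tendsto_measure_prod_compl_of_dense [IsFiniteMeasure μ] {S : ℕ → Set X}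
    (hS : μ.MeasureDense (Set.range S))
    (h1 : ∀ n, (ν n).map Prod.fst ≤ μ) (h2 : ∀ n, (ν n).map Prod.snd ≤ μ)
    (hν : ∀ k, Tendsto (fun n => ν n (S k ×ˢ (S k)ᶜ)) atTop (𝓝 0)) {A : Set X}
    (hA : MeasurableSet A) : Tendsto (fun n => ν n (A ×ˢ Aᶜ)) atTop (𝓝 0) := by
  rw [ENNReal.tendsto_atTop_zero]
  intro ε hε
  by_cases hεt : ε = ∞
  · exact ⟨0, fun n _ => by rw [hεt]; exact le_top⟩
  have hε3 : 0 < ε.toReal / 3 := by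
    have := ENNReal.toReal_pos hε.ne' hεt
    positivity
  obtain ⟨_, ⟨k, rfl⟩, hk⟩ := hS.approx A hA (measure_ne_top _ _) _ hε3
  have hSk : MeasurableSet (S k) := hS.measurable _ ⟨k, rfl⟩
  obtain ⟨N, hN⟩ := (ENNReal.tendsto_atTop_zero.1 (hν k)) (ENNReal.ofReal (ε.toReal / 3))
    (by simpa using hε3)
  refine ⟨N, fun n hn => ?_⟩
  have hsub : A ×ˢ Aᶜ ⊆ S k ×ˢ (S k)ᶜ ∪ (symmDiff A (S k) ×ˢ Set.univ ∪
      Set.univ ×ˢ symmDiff A (S k)) := by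
    rintro ⟨x, y⟩ ⟨hx, hy⟩
    simp only [Set.mem_union, Set.mem_prod, Set.mem_compl_iff, Set.mem_univ, and_true, true_and,
      Set.mem_symmDiff] at *
    tauto
  have hd : MeasurableSet (symmDiff A (S k)) := hA.symmDiff hSk
  calc ν n (A ×ˢ Aᶜ) ≤ _ := measure_mono hsub
    _ ≤ ν n (S k ×ˢ (S k)ᶜ) + (ν n (symmDiff A (S k) ×ˢ Set.univ) +
        ν n (Set.univ ×ˢ symmDiff A (S k))) :=
      (measure_union_le _ _).trans (add_le_add_right (measure_union_le _ _) _)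
    _ ≤ ENNReal.ofReal (ε.toReal / 3) + (ENNReal.ofReal (ε.toReal / 3) +
        ENNReal.ofReal (ε.toReal / 3)) :=
      add_le_add (hN n hn) (add_le_add ((measure_prod_univ_le (h1 n) hd).trans hk.le)
        ((measure_univ_prod_le (h2 n) hd).trans hk.le))
    _ = ε := by
      rw [← ENNReal.ofReal_add hε3.le hε3.le, ← ENNReal.ofReal_add hε3.le (by positivity)]
      rw [show ε.toReal / 3 + (ε.toReal / 3 + ε.toReal / 3) = ε.toReal by ring,
        ENNReal.ofReal_toReal hεt]

theorem lintegral_comp_fst_le {ρ : Measure (X × X)} (h : ρ.map Prod.fst ≤ μ) {f : X → ℝ≥0∞}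
    (hf : AEMeasurable f μ) : ∫⁻ p, f p.1 ∂ρ ≤ ∫⁻ x, f x ∂μ := by
  rw [← lintegral_map' (hf.mono_measure h) measurable_fst.aemeasurable]
  exact lintegral_mono' h le_rfl

theorem lintegral_comp_snd_le {ρ : Measure (X × X)} (h : ρ.map Prod.snd ≤ μ) {f : X → ℝ≥0∞}
    (hf : AEMeasurable f μ) : ∫⁻ p, f p.2 ∂ρ ≤ ∫⁻ x, f x ∂μ := by
  rw [← lintegral_map' (hf.mono_measure h) measurable_snd.aemeasurable]
  exact lintegral_mono' h le_rfl

/-- For indicators this is the hypothesis on `A ×ˢ Aᶜ`. The bound on the marginals makes the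
integral stable, uniformly in `n`, under `L¹` perturbations of `g`, so the property extends to all
integrable functions. -/
theorem tendsto_lintegral_enorm_sub {E : Type*} [NormedAddCommGroup E]
    (h1 : ∀ n, (ν n).map Prod.fst ≤ μ) (h2 : ∀ n, (ν n).map Prod.snd ≤ μ)
    (hν : ∀ A, MeasurableSet A → Tendsto (fun n => ν n (A ×ˢ Aᶜ)) atTop (𝓝 0))
    {g : X → E} (hg : Integrable g μ) :
    Tendsto (fun n => ∫⁻ p, ‖g p.1 - g p.2‖ₑ ∂(ν n)) atTop (𝓝 0) := by
  have key : ∀ f g : X → E, Integrable f μ → Integrable g μ →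
      ∀ n, ∫⁻ p, ‖f p.1 - f p.2‖ₑ ∂(ν n) ≤
        ∫⁻ p, ‖g p.1 - g p.2‖ₑ ∂(ν n) + (∫⁻ x, ‖f x - g x‖ₑ ∂μ + ∫⁻ x, ‖f x - g x‖ₑ ∂μ) := by
    intro f g hf hg n
    have hm : AEMeasurable (fun x => ‖f x - g x‖ₑ) μ := (hf.sub hg).aestronglyMeasurable.enorm
    have q1 : Measure.QuasiMeasurePreserving Prod.fst (ν n) μ :=
      ⟨measurable_fst, Measure.absolutelyContinuous_of_le (h1 n)⟩
    have q2 : Measure.QuasiMeasurePreserving Prod.snd (ν n) μ :=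
      ⟨measurable_snd, Measure.absolutelyContinuous_of_le (h2 n)⟩
    have hm1 : AEMeasurable (fun p : X × X => ‖f p.1 - g p.1‖ₑ) (ν n) :=
      hm.comp_quasiMeasurePreserving q1
    have hm2 : AEMeasurable (fun p : X × X => ‖f p.2 - g p.2‖ₑ) (ν n) :=
      hm.comp_quasiMeasurePreserving q2
    have hm12 : AEMeasurable (fun p : X × X => ‖f p.1 - g p.1‖ₑ + ‖f p.2 - g p.2‖ₑ) (ν n) :=
      hm1.add hm2
    calc ∫⁻ p, ‖f p.1 - f p.2‖ₑ ∂(ν n) ≤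
        ∫⁻ p, (‖g p.1 - g p.2‖ₑ + (‖f p.1 - g p.1‖ₑ + ‖f p.2 - g p.2‖ₑ)) ∂(ν n) := by
          refine lintegral_mono fun p => ?_
          have : f p.1 - f p.2 = (g p.1 - g p.2) + ((f p.1 - g p.1) - (f p.2 - g p.2)) := by abel
          dsimp only
          rw [this]
          exact (enorm_add_le _ _).trans (add_le_add_right enorm_sub_le _)
      _ = ∫⁻ p, ‖g p.1 - g p.2‖ₑ ∂(ν n) + (∫⁻ p, ‖f p.1 - g p.1‖ₑ ∂(ν n) +
            ∫⁻ p, ‖f p.2 - g p.2‖ₑ ∂(ν n)) := by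
          rw [lintegral_add_right' _ hm12, lintegral_add_left' hm1]
      _ ≤ _ := add_le_add_right (add_le_add (lintegral_comp_fst_le (h1 n) hm)
            (lintegral_comp_snd_le (h2 n) hm)) _
  refine Integrable.induction
    (fun g : X → E => Tendsto (fun n => ∫⁻ p, ‖g p.1 - g p.2‖ₑ ∂(ν n)) atTop (𝓝 0))
    (fun c A hA _ => ?_) (fun f g _ hf hg hPf hPg => ?_) ?_ (fun f g hfg hf hPf => ?_) hg
  · have ht := ENNReal.Tendsto.const_mul (a := ‖c‖ₑ) ((hν A hA).add (hν Aᶜ hA.compl))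
      (Or.inr enorm_ne_top)
    rw [add_zero, mul_zero] at ht
    refine tendsto_of_tendsto_of_tendsto_of_le_of_le tendsto_const_nhds ht (fun _ => zero_le)
      fun n => ?_
    have hmA : MeasurableSet (A ×ˢ Aᶜ) := hA.prod hA.compl
    have hmA' : MeasurableSet (Aᶜ ×ˢ Aᶜᶜ) := hA.compl.prod hA.compl.compl
    calc ∫⁻ p, ‖A.indicator (fun _ => c) p.1 - A.indicator (fun _ => c) p.2‖ₑ ∂(ν n)
        ≤ ∫⁻ p, ((A ×ˢ Aᶜ).indicator (fun _ => ‖c‖ₑ) p +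
            (Aᶜ ×ˢ Aᶜᶜ).indicator (fun _ => ‖c‖ₑ) p) ∂(ν n) := by
          refine lintegral_mono fun p => ?_
          by_cases hx : p.1 ∈ A <;> by_cases hy : p.2 ∈ A <;> simp [Set.indicator, hx, hy]
      _ = ‖c‖ₑ * (ν n (A ×ˢ Aᶜ) + ν n (Aᶜ ×ˢ Aᶜᶜ)) := by
          rw [lintegral_add_left (measurable_const.indicator hmA),
            lintegral_indicator_const hmA, lintegral_indicator_const hmA', mul_add]
  · have ht := hPf.add hPg
    rw [add_zero] at ht
    have hd : ∀ p : X × X, (f + g) p.1 - (f + g) p.2 = (f p.1 - f p.2) + (g p.1 - g p.2) :=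
      fun p => by simp only [Pi.add_apply]; abel
    refine tendsto_of_tendsto_of_tendsto_of_le_of_le tendsto_const_nhds ht (fun _ => zero_le)
      fun n => ?_
    have q1 : Measure.QuasiMeasurePreserving Prod.fst (ν n) μ :=
      ⟨measurable_fst, Measure.absolutelyContinuous_of_le (h1 n)⟩
    have q2 : Measure.QuasiMeasurePreserving Prod.snd (ν n) μ :=
      ⟨measurable_snd, Measure.absolutelyContinuous_of_le (h2 n)⟩
    have hm : AEMeasurable (fun p : X × X => ‖f p.1 - f p.2‖ₑ) (ν n) :=
      ((hf.aestronglyMeasurable.comp_quasiMeasurePreserving q1).sub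
        (hf.aestronglyMeasurable.comp_quasiMeasurePreserving q2)).enorm
    dsimp only
    rw [← lintegral_add_left' hm]
    refine lintegral_mono fun p => ?_
    rw [hd]
    exact enorm_add_le _ _
  · refine isClosed_of_closure_subset fun f hf => ?_
    refine ENNReal.tendsto_atTop_zero.2 fun ε hε => ?_
    have hε4 : 0 < ε / 4 := ENNReal.div_pos hε.ne' (by simp)
    obtain ⟨g, hgP, hfg⟩ := EMetric.mem_closure_iff.1 hf (ε / 4) hε4
    obtain ⟨N, hN⟩ := (ENNReal.tendsto_atTop_zero.1 hgP) (ε / 4) hε4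
    refine ⟨N, fun n hn => ?_⟩
    have hd : ∫⁻ x, ‖f x - g x‖ₑ ∂μ ≤ ε / 4 := by
      refine le_of_eq_of_le ?_ hfg.le
      rw [L1.edist_def]
      simp only [edist_eq_enorm_sub]
    refine (key _ _ (L1.integrable_coeFn f) (L1.integrable_coeFn g) n).trans ?_
    calc _ ≤ ε / 4 + (ε / 4 + ε / 4) := add_le_add (hN n hn) (add_le_add hd hd)
      _ ≤ ε / 4 + ε / 4 + (ε / 4 + ε / 4) := by rw [← add_assoc, ← add_assoc]; exact le_self_add
      _ = ε := by
        have h2 : ε / 4 + ε / 4 = ε / 2 := by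
          rw [← two_mul, show (4 : ℝ≥0∞) = 2 * 2 by norm_num, ← mul_div_assoc,
            ENNReal.mul_div_mul_left _ _ (by simp) (by simp)]
        rw [h2, ENNReal.add_halves]
  · refine hPf.congr fun n => lintegral_congr_ae ?_
    have q1 : Measure.QuasiMeasurePreserving Prod.fst (ν n) μ :=
      ⟨measurable_fst, Measure.absolutelyContinuous_of_le (h1 n)⟩
    have q2 : Measure.QuasiMeasurePreserving Prod.snd (ν n) μ :=
      ⟨measurable_snd, Measure.absolutelyContinuous_of_le (h2 n)⟩
    filter_upwards [q1.ae_eq hfg, q2.ae_eq hfg] with p hp1 hp2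
    simp only [Function.comp_apply] at hp1 hp2
    rw [hp1, hp2]

end NearDiagonal

end

noncomputable section

/-! ### Weak asymptotic constancy of almost invariant densities -/

/-- For a bounded sequence, the vectors tested to zero form a closed subspace; it contains `S`,
whose orthogonal complement is trivial. -/
theorem tendsto_inner_of_orthogonal_eq_zero {H : Type*} [NormedAddCommGroup H]
    [InnerProductSpace ℝ H] [CompleteSpace H] {v : ℕ → H} {C : ℝ} (hv : ∀ n, ‖v n‖ ≤ C)
    {S : Set H} (hS : ∀ s ∈ S, Tendsto (fun n => inner ℝ (v n) s) atTop (𝓝 0))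
    (hort : ∀ w : H, (∀ s ∈ S, inner ℝ s w = 0) → w = 0) (g : H) :
    Tendsto (fun n => inner ℝ (v n) g) atTop (𝓝 0) := by
  let D : Submodule ℝ H :=
    { carrier := {g | Tendsto (fun n => inner ℝ (v n) g) atTop (𝓝 0)}
      add_mem' := fun {a b} ha hb => by
        have := Tendsto.add ha hb
        simp only [← inner_add_right, add_zero] at this
        exact this
      zero_mem' := by simp
      smul_mem' := fun c a ha => by
        have := Tendsto.const_mul c ha
        simp only [← real_inner_smul_right, mul_zero] at this
        exact this }
  have hC : 0 ≤ C := (norm_nonneg _).trans (hv 0)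
  have hcl : IsClosed (D : Set H) := by
    refine isClosed_of_closure_subset fun f hf => ?_
    refine Metric.tendsto_atTop.2 fun ε hε => ?_
    obtain ⟨g, hg, hfg⟩ := Metric.mem_closure_iff.1 hf (ε / (2 * (C + 1))) (by positivity)
    obtain ⟨N, hN⟩ := Metric.tendsto_atTop.1 (show Tendsto _ _ _ from hg) (ε / 2) (by positivity)
    refine ⟨N, fun n hn => ?_⟩
    have h1 := hN n hn
    rw [dist_zero_right, Real.norm_eq_abs] at h1 ⊢
    have h2 : inner ℝ (v n) f = inner ℝ (v n) g + inner ℝ (v n) (f - g) := by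
      rw [← inner_add_right]; simp
    have h3 : |inner ℝ (v n) (f - g)| ≤ C * (ε / (2 * (C + 1))) := by
      refine (abs_real_inner_le_norm _ _).trans (mul_le_mul (hv n) ?_ (norm_nonneg _) hC)
      rw [← dist_eq_norm]
      exact hfg.le
    have h4 : C * (ε / (2 * (C + 1))) ≤ ε / 2 := by
      rw [mul_div_assoc', div_le_div_iff₀ (by positivity) (by positivity)]
      nlinarith
    rw [h2]
    calc _ ≤ _ := abs_add_le _ _
      _ < ε / 2 + ε / 2 := by linarith
      _ = ε := by ring
  have hDc : IsComplete (D : Set H) := hcl.isComplete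
  have : CompleteSpace D := hDc.completeSpace_coe
  have hbot : Dᗮ = ⊥ := by
    rw [Submodule.eq_bot_iff]
    intro w hw
    exact hort w fun s hs => (Submodule.mem_orthogonal D w).1 hw s (hS s hs)
  have htop : D = ⊤ := Submodule.orthogonal_eq_bot_iff.1 hbot
  have : g ∈ D := htop ▸ Submodule.mem_top
  exact this

section Ergodic

variable {X : Type*} [MeasurableSpace X] {μ : Measure X}

/-- The hypothesis says that `w ∘ γ k = w` almost everywhere, so `{w > 0}` is invariant, hence null
or conull. Then `w` has constant sign, and its zero integral kills it. -/
theorem ae_eq_zero_of_setIntegral_preimage_eq {γ : ℕ → X ≃ᵐ X}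
    (hγ : ∀ k, MeasurePreserving (γ k) μ μ)
    (herg : ∀ A, MeasurableSet A → (∀ k, γ k ⁻¹' A =ᵐ[μ] A) → μ A = 0 ∨ μ Aᶜ = 0)
    {w : X → ℝ} (hwm : Measurable w) (hw : Integrable w μ) (h0 : ∫ x, w x ∂μ = 0)
    (h : ∀ k A, MeasurableSet A → ∫ x in γ k ⁻¹' A, w x ∂μ = ∫ x in A, w x ∂μ) :
    w =ᵐ[μ] 0 := by
  have hinv : ∀ k, (fun x => w (γ k x)) =ᵐ[μ] w := by
    intro k
    have hwk : Integrable (fun x => w (γ k x)) μ := (hγ k).integrable_comp_of_integrable hw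
    refine Integrable.ae_eq_of_forall_setIntegral_eq _ _ hwk hw fun s hs _ => ?_
    have hs' : s = γ k ⁻¹' ((γ k).symm ⁻¹' s) := by
      rw [← Set.preimage_comp]; simp
    have hm : MeasurableSet ((γ k).symm ⁻¹' s) := (γ k).symm.measurable hs
    rw [hs', (hγ k).setIntegral_preimage_emb (γ k).measurableEmbedding, h k _ hm]
  have hA : MeasurableSet {x | 0 < w x} := measurableSet_lt measurable_const hwm
  rcases herg _ hA fun k => by
      filter_upwards [hinv k] with x hx
      show (0 < w (γ k x)) = (0 < w x)
      rw [hx] with h1 | h1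
  · have h2 : 0 ≤ᵐ[μ] fun x => - w x := by
      have : ∀ᵐ x ∂μ, ¬ (0 < w x) := measure_eq_zero_iff_ae_notMem.1 h1
      filter_upwards [this] with x hx
      simpa using hx
    have h3 : ∫ x, - w x ∂μ = 0 := by rw [integral_neg, h0, neg_zero]
    filter_upwards [(integral_eq_zero_iff_of_nonneg_ae h2 hw.neg).1 h3] with x hx
    simpa using hx
  · have h2 : 0 ≤ᵐ[μ] w := by
      have : ∀ᵐ x ∂μ, x ∉ {x | 0 < w x}ᶜ := measure_eq_zero_iff_ae_notMem.1 h1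
      filter_upwards [this] with x hx
      simp only [Set.mem_compl_iff, not_not] at hx
      exact le_of_lt hx
    exact (integral_eq_zero_iff_of_nonneg_ae h2 hw).1 h0

/-- The centred densities `dm_n/dμ - m_n(X)` are bounded in `L²`. They are asymptotically orthogonal
to constants and to the differences `1_{γ⁻¹A} - 1_A`, and ergodicity says that nothing nonzero is
orthogonal to all of these. The masses `m_n(X)` themselves need not converge. -/
theorem tendsto_integral_sub_mul_integral [IsProbabilityMeasure μ] {γ : ℕ → X ≃ᵐ X}
    (hγ : ∀ k, MeasurePreserving (γ k) μ μ)
    (herg : ∀ A, MeasurableSet A → (∀ k, γ k ⁻¹' A =ᵐ[μ] A) → μ A = 0 ∨ μ Aᶜ = 0)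
    {m : ℕ → Measure X} (hm : ∀ n, m n ≤ μ)
    (hinv : ∀ k A, MeasurableSet A →
      Tendsto (fun n => (m n).real (γ k ⁻¹' A) - (m n).real A) atTop (𝓝 0))
    {g : X → ℝ} (hg : MemLp g 2 μ) :
    Tendsto (fun n => ∫ x, g x ∂(m n) - (m n).real Set.univ * ∫ x, g x ∂μ) atTop (𝓝 0) := by
  have hfin : ∀ n, IsFiniteMeasure (m n) := fun n => isFiniteMeasure_of_le μ (hm n)
  have hac : ∀ n, m n ≪ μ := fun n => Measure.absolutelyContinuous_of_le (hm n)
  let c : ℕ → ℝ := fun n => (m n).real Set.univ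
  have hc0 : ∀ n, 0 ≤ c n := fun n => measureReal_nonneg
  have hc1 : ∀ n, c n ≤ 1 := fun n => by
    have := ENNReal.toReal_mono (measure_ne_top μ _) (hm n Set.univ)
    rw [measure_univ (μ := μ), ENNReal.toReal_one] at this
    exact this
  let r : ℕ → X → ℝ := fun n x => ((m n).rnDeriv μ x).toReal - c n
  have hrm : ∀ n, Measurable (r n) := fun n =>
    (Measure.measurable_rnDeriv _ _).ennreal_toReal.sub measurable_const
  have hr1 : ∀ n, ∀ᵐ x ∂μ, ‖r n x‖ ≤ 1 := fun n => by
    filter_upwards [Measure.rnDeriv_le_one_of_le (hm n)] with x hx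
    have h1 : ((m n).rnDeriv μ x).toReal ≤ 1 := by
      simpa using ENNReal.toReal_mono ENNReal.one_ne_top hx
    have h2 : 0 ≤ ((m n).rnDeriv μ x).toReal := ENNReal.toReal_nonneg
    rw [Real.norm_eq_abs, abs_le]
    constructor <;> simp only [r] <;> linarith [hc0 n, hc1 n]
  have hrL : ∀ n, MemLp (r n) 2 μ := fun n =>
    MemLp.of_bound (hrm n).aestronglyMeasurable 1 (hr1 n)
  have hrg : ∀ n, ∀ f : X → ℝ, Integrable f μ →
      ∫ x, r n x * f x ∂μ = ∫ x, f x ∂(m n) - c n * ∫ x, f x ∂μ := by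
    intro n f hf
    have hb : ∀ᵐ x ∂μ, ‖((m n).rnDeriv μ x).toReal‖ ≤ 1 := by
      filter_upwards [Measure.rnDeriv_le_one_of_le (hm n)] with x hx
      rw [Real.norm_of_nonneg ENNReal.toReal_nonneg]
      simpa using ENNReal.toReal_mono ENNReal.one_ne_top hx
    have hi : Integrable (fun x => ((m n).rnDeriv μ x).toReal * f x) μ :=
      hf.bdd_mul (Measure.measurable_rnDeriv _ _).ennreal_toReal.aestronglyMeasurable hb
    have := integral_rnDeriv_smul (hac n) (f := f)
    simp only [smul_eq_mul] at this
    rw [← this, ← integral_const_mul, ← integral_sub hi (hf.const_mul _)]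
    refine integral_congr_ae (Eventually.of_forall fun x => ?_)
    simp only [r]
    ring
  let v : ℕ → Lp ℝ 2 μ := fun n => (hrL n).toLp
  have hin : ∀ n, ∀ f : X → ℝ, ∀ hf : MemLp f 2 μ,
      inner ℝ (v n) hf.toLp = ∫ x, f x ∂(m n) - c n * ∫ x, f x ∂μ := by
    intro n f hf
    rw [← hrg n f (hf.integrable (by norm_num)), L2.inner_def]
    refine integral_congr_ae ?_
    filter_upwards [(hrL n).coeFn_toLp, hf.coeFn_toLp] with x h1 h2
    simp only [v]
    rw [h1, h2]
    simp [mul_comm]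
  have hind : ∀ A : Set X, MeasurableSet A → MemLp (A.indicator fun _ => (1 : ℝ)) 2 μ :=
    fun A hA => (memLp_const 1).indicator hA
  have hind_int : ∀ (A : Set X), MeasurableSet A → ∀ κ : Measure X,
      ∫ x, A.indicator (fun _ => (1 : ℝ)) x ∂κ = κ.real A := fun A hA κ => by
    rw [integral_indicator hA]; simp
  let S : Set (Lp ℝ 2 μ) := {f | (∃ hf : MemLp (fun _ : X => (1 : ℝ)) 2 μ, f = hf.toLp) ∨
    ∃ (k : ℕ) (A : Set X) (hA : MeasurableSet A),
      f = (hind _ ((γ k).measurable hA)).toLp - (hind _ hA).toLp}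
  have hone : MemLp (fun _ : X => (1 : ℝ)) 2 μ := memLp_const 1
  have hmain := tendsto_inner_of_orthogonal_eq_zero (v := v) (C := 1) (S := S) (fun n => ?_) ?_ ?_
    hg.toLp
  · simpa only [hin] using hmain
  · refine (Lp.norm_le_of_ae_bound (C := 1) zero_le_one ?_).trans ?_
    · filter_upwards [(hrL n).coeFn_toLp, hr1 n] with x h1 h2
      simp only [v]
      rwa [h1]
    · simp [measureUnivNNReal]
  · rintro f (⟨hf, rfl⟩ | ⟨k, A, hA, rfl⟩)
    · refine tendsto_const_nhds.congr fun n => ?_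
      rw [hin]
      simp [c]
    · refine (hinv k A hA).congr fun n => ?_
      have h3 : μ.real (γ k ⁻¹' A) = μ.real A := (hγ k).measureReal_preimage hA.nullMeasurableSet
      rw [inner_sub_right, hin, hin, hind_int _ hA, hind_int _ ((γ k).measurable hA), hind_int _ hA,
        hind_int _ ((γ k).measurable hA), h3]
      ring
  · intro w hw
    have hwi : Integrable w μ := (Lp.memLp w).integrable (by norm_num)
    have hset : ∀ A : Set X, ∀ hA : MeasurableSet A,
        inner ℝ (hind A hA).toLp w = ∫ x in A, w x ∂μ := by
      intro A hA
      rw [L2.inner_def, ← integral_indicator hA]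
      refine integral_congr_ae ?_
      filter_upwards [(hind A hA).coeFn_toLp] with x h1
      rw [h1]
      by_cases hx : x ∈ A <;> simp [hx]
    have h0 : ∫ x, w x ∂μ = 0 := by
      rw [← hw _ (Or.inl ⟨hone, rfl⟩), L2.inner_def]
      refine integral_congr_ae ?_
      filter_upwards [hone.coeFn_toLp] with x h1
      rw [h1]
      simp
    refine (Lp.eq_zero_iff_ae_eq_zero).2 (ae_eq_zero_of_setIntegral_preimage_eq hγ herg
      (Lp.stronglyMeasurable w).measurable hwi h0 fun k A hA => ?_)
    have := hw _ (Or.inr ⟨k, A, hA, rfl⟩)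
    rw [inner_sub_left, hset _ ((γ k).measurable hA), hset _ hA, sub_eq_zero] at this
    exact this

end Ergodic

end

noncomputable section

/-! ### Amplification of almost invariant measures off the diagonal -/

/-- The tolerance `1 / (N + 1)`. -/
def tol (N : ℕ) : ℝ≥0∞ := ENNReal.ofReal (1 / ((N : ℝ) + 1))

theorem tol_antitone {M N : ℕ} (h : M ≤ N) : tol N ≤ tol M :=
  ENNReal.ofReal_le_ofReal (Nat.one_div_le_one_div h)

theorem tol_ne_top (N : ℕ) : tol N ≠ ∞ := ENNReal.ofReal_ne_top

theorem tendsto_tol : Tendsto tol atTop (𝓝 0) := by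
  have := (ENNReal.continuous_ofReal.tendsto 0).comp
    (tendsto_one_div_add_atTop_nhds_zero_nat (𝕜 := ℝ))
  rwa [ENNReal.ofReal_zero] at this

/-- The index `4 * N + 3` quarters the tolerance exactly, matching the four invariance errors of one
amplification. -/
theorem four_mul_tol (N : ℕ) :
    tol (4 * N + 3) + (tol (4 * N + 3) + (tol (4 * N + 3) + tol (4 * N + 3))) = tol N := by
  have h : (0 : ℝ) ≤ 1 / (((4 * N + 3 : ℕ) : ℝ) + 1) := by positivity
  rw [tol, tol, ← ENNReal.ofReal_add h h, ← ENNReal.ofReal_add h (by positivity),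
    ← ENNReal.ofReal_add h (by positivity)]
  congr 1
  push_cast
  field_simp
  ring

theorem two_mul_tol_le (N : ℕ) : tol (4 * N + 3) + tol (4 * N + 3) ≤ tol N := by
  rw [← four_mul_tol N, ← add_assoc]
  exact le_self_add

/-- Symmetric measures off the diagonal, with marginals at most `μ`, which are almost concentrated
on the diagonal as far as `S 0, …, S N` can see and almost invariant under `γ 0, …, γ N`. -/
structure IsAlmostInvariant {X : Type*} [MeasurableSpace X] (μ : Measure X) (S : ℕ → Set X)
    (γ : ℕ → X ≃ᵐ X) (N : ℕ) (ρ : Measure (X × X)) : Prop where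
  swap : ρ.map Prod.swap = ρ
  diag : ρ (Set.diagonal X) = 0
  fst_le : ρ.map Prod.fst ≤ μ
  near : ∀ k ≤ N, ρ (S k ×ˢ (S k)ᶜ) ≤ tol N
  close : ∀ k ≤ N, MeasureClose (tol N) (ρ.map (Prod.map (γ k) (γ k))) ρ

/-- The Radon–Nikodym derivative is at most `1` only almost everywhere; truncation makes the bound
hold at every point, so that weights built from `b` are bounded on all of `X × X`. -/
theorem exists_density_of_le {X : Type*} [MeasurableSpace X] {μ κ : Measure X} [IsFiniteMeasure μ]
    (h : κ ≤ μ) : ∃ b : X → ℝ≥0∞, Measurable b ∧ (∀ x, b x ≤ 1) ∧ μ.withDensity b = κ := by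
  have : IsFiniteMeasure κ := isFiniteMeasure_of_le μ h
  refine ⟨fun x => min (κ.rnDeriv μ x) 1, (Measure.measurable_rnDeriv _ _).min measurable_const,
    fun x => min_le_right _ _, ?_⟩
  rw [← Measure.withDensity_rnDeriv_eq κ μ (Measure.absolutelyContinuous_of_le h)]
  refine withDensity_congr_ae ?_
  rw [Measure.withDensity_rnDeriv_eq κ μ (Measure.absolutelyContinuous_of_le h)]
  filter_upwards [Measure.rnDeriv_le_one_of_le h] with x hx
  exact min_eq_left hx

section Amplify

variable {X : Type*} [MeasurableSpace X] {μ : Measure X}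

theorem map_snd_of_map_swap {ρ : Measure (X × X)} (h : ρ.map Prod.swap = ρ) :
    ρ.map Prod.snd = ρ.map Prod.fst := by
  conv_rhs => rw [← h]
  rw [Measure.map_map measurable_fst measurable_swap]
  rfl

theorem min_le_min_add (a b c d : ℝ≥0∞) : min a b ≤ min c d + ((a - c) + (b - d)) := by
  rcases le_total c d with h | h
  · rw [min_eq_left h]
    calc min a b ≤ a := min_le_left _ _
      _ ≤ c + (a - c) := le_add_tsub
      _ ≤ _ := add_le_add_right le_self_add _
  · rw [min_eq_right h]
    calc min a b ≤ b := min_le_right _ _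
      _ ≤ d + (b - d) := le_add_tsub
      _ ≤ _ := add_le_add_right le_add_self _

/-- Almost invariance of `m` passes to the density of `μ - m`. The subtraction is truncated, so only
`P = {b ∘ θ ≤ b} = θ⁻¹ Q` contributes. There the integral is `κ P - κ Q = m Q - m P`, because `μ P =
μ Q`. -/
theorem lintegral_sub_comp_le [IsFiniteMeasure μ] {m κ : Measure X} (hm : m + κ = μ)
    {b : X → ℝ≥0∞} (hb : Measurable b) (hb1 : ∀ x, b x ≤ 1) (hbκ : μ.withDensity b = κ)
    {θ : X ≃ᵐ X} (hθ : MeasurePreserving θ μ μ) {d : ℝ≥0∞}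
    (hd : ∀ A, MeasurableSet A → m A ≤ m (θ ⁻¹' A) + d) :
    ∫⁻ x, (b x - b (θ x)) ∂μ ≤ d := by
  have hbθ : Measurable fun x => b (θ x) := hb.comp θ.measurable
  have hbi : ∀ A, MeasurableSet A → ∫⁻ x in A, b x ∂μ = κ A := fun A hA => by
    rw [← hbκ, withDensity_apply _ hA]
  have hbne : ∀ x, b x ≠ ∞ := fun x => ((hb1 x).trans_lt ENNReal.one_lt_top).ne
  set P : Set X := {x | b (θ x) ≤ b x} with hP
  have hPm : MeasurableSet P := measurableSet_le hbθ hb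
  obtain ⟨Q, hQ, hPQ⟩ : ∃ Q, MeasurableSet Q ∧ P = θ ⁻¹' Q :=
    ⟨θ.symm ⁻¹' P, θ.symm.measurable hPm, by rw [← Set.preimage_comp]; simp⟩
  have h1 : ∫⁻ x, (b x - b (θ x)) ∂μ = ∫⁻ x in P, (b x - b (θ x)) ∂μ := by
    rw [← lintegral_indicator hPm]
    refine lintegral_congr fun x => ?_
    by_cases hx : x ∈ P
    · simp [hx]
    · have : b x ≤ b (θ x) := (not_le.1 hx).le
      simp [hx, tsub_eq_zero_of_le this]
  have h2 : ∫⁻ x in P, b (θ x) ∂μ = κ Q := by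
    rw [hPQ, ← hbi Q hQ, hθ.setLIntegral_comp_preimage hQ hb]
  have hμP : μ P = μ Q := by rw [hPQ]; exact hθ.measure_preimage hQ.nullMeasurableSet
  have hκle : κ ≤ μ := hm ▸ le_add_of_nonneg_left (Measure.zero_le _)
  have hmle : m ≤ μ := hm ▸ le_add_of_nonneg_right (Measure.zero_le _)
  have hfin : m Q ≠ ∞ := ((hmle Q).trans_lt (measure_lt_top μ Q)).ne
  rw [h1, lintegral_sub' hbθ.aemeasurable (by
      rw [h2]; exact ((hκle Q).trans_lt (measure_lt_top μ Q)).ne)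
      (ae_restrict_of_forall_mem hPm fun x hx => hx), h2, hbi P hPm, tsub_le_iff_left]
  have e1 : m P + κ P = μ P := by rw [← hm]; rfl
  have e2 : m Q + κ Q = μ Q := by rw [← hm]; rfl
  have e3 := hd Q hQ
  rw [← hPQ] at e3
  have hfinP : m P ≠ ∞ := ((hmle P).trans_lt (measure_lt_top μ P)).ne
  refine (ENNReal.add_le_add_iff_left hfinP).1 ?_
  rw [e1, hμP, ← e2]
  calc m Q + κ Q ≤ m P + d + κ Q := by gcongr
    _ = _ := by ring

variable {S : ℕ → Set X} {γ : ℕ → X ≃ᵐ X}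

namespace IsAlmostInvariant

variable {N : ℕ} {ρ : Measure (X × X)}

theorem snd_le (h : IsAlmostInvariant μ S γ N ρ) : ρ.map Prod.snd ≤ μ := by
  rw [map_snd_of_map_swap h.swap]; exact h.fst_le

theorem isFiniteMeasure [IsFiniteMeasure μ] (h : IsAlmostInvariant μ S γ N ρ) : IsFiniteMeasure ρ :=
  ⟨by
    have := measure_prod_univ_le h.fst_le MeasurableSet.univ
    rw [Set.univ_prod_univ] at this
    exact this.trans_lt (measure_lt_top _ _)⟩

theorem close_symm [IsFiniteMeasure μ] (h : IsAlmostInvariant μ S γ N ρ) {k : ℕ} (hk : k ≤ N) :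
    MeasureClose (tol N) ρ (ρ.map (Prod.map (γ k) (γ k))) := by
  have := h.isFiniteMeasure
  refine (h.close k hk).symm ?_
  rw [Measure.map_apply ((γ k).measurable.prodMap (γ k).measurable) MeasurableSet.univ,
    Set.preimage_univ]

/-- Adding `min (b x) (b y) ρ` to `ρ₀`, where `b` is the density of the defect of `ρ₀`. -/
theorem add_withDensity [IsFiniteMeasure μ] (hγ : ∀ k, MeasurePreserving (γ k) μ μ) {n : ℕ} {ρ₀ ρ : Measure (X × X)}
    (h₀ : IsAlmostInvariant μ S γ (4 * N + 3) ρ₀) (h : IsAlmostInvariant μ S γ n ρ)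
    (hn : 4 * N + 3 ≤ n) {κ : Measure X} (hκ : ρ₀.map Prod.fst + κ = μ) {b : X → ℝ≥0∞}
    (hb : Measurable b) (hb1 : ∀ x, b x ≤ 1) (hbκ : μ.withDensity b = κ) :
    IsAlmostInvariant μ S γ N (ρ₀ + ρ.withDensity fun p => min (b p.1) (b p.2)) := by
  have := h.isFiniteMeasure
  set w : X × X → ℝ≥0∞ := fun p => min (b p.1) (b p.2) with hw
  have hwm : Measurable w := (hb.comp measurable_fst).min (hb.comp measurable_snd)
  have hw1 : ∀ p, w p ≤ 1 := fun p => (min_le_left _ _).trans (hb1 _)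
  have hle : ρ.withDensity w ≤ ρ := by
    conv_rhs => rw [← withDensity_one (μ := ρ)]
    exact withDensity_mono (Eventually.of_forall hw1)
  refine ⟨?_, ?_, ?_, fun k hk => ?_, fun k hk => ?_⟩
  · rw [Measure.map_add _ _ measurable_swap, h₀.swap]
    congr 1
    ext E hE
    rw [Measure.map_apply measurable_swap hE, withDensity_apply _ (measurable_swap hE),
      withDensity_apply _ hE]
    conv_rhs => rw [← h.swap]
    rw [setLIntegral_map hE hwm measurable_swap]
    refine lintegral_congr fun p => ?_
    simp only [hw, Prod.fst_swap, Prod.snd_swap, min_comm]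
  · rw [Measure.add_apply, h₀.diag, zero_add]
    exact withDensity_absolutelyContinuous _ _ h.diag
  -- The weight is at most `b p.1` and the marginal of `ρ` is at most `μ`, so the added marginal is
  -- below `b μ = κ`, the room left by `ρ₀`.
  · conv_rhs => rw [← hκ]
    rw [Measure.map_add _ _ measurable_fst]
    refine add_le_add_right (Measure.le_iff.2 fun A hA => ?_) _
    rw [Measure.map_apply measurable_fst hA, withDensity_apply _ (measurable_fst hA), ← hbκ,
      withDensity_apply _ hA]
    calc ∫⁻ p in Prod.fst ⁻¹' A, w p ∂ρ ≤ ∫⁻ p in Prod.fst ⁻¹' A, b p.1 ∂ρ :=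
          lintegral_mono fun p => min_le_left _ _
      _ = ∫⁻ x in A, b x ∂(ρ.map Prod.fst) := (setLIntegral_map hA hb measurable_fst).symm
      _ ≤ ∫⁻ x in A, b x ∂μ := lintegral_mono' (Measure.restrict_mono le_rfl h.fst_le) le_rfl
  · rw [Measure.add_apply]
    calc _ ≤ tol (4 * N + 3) + tol (4 * N + 3) :=
          add_le_add (h₀.near k (by omega)) ((hle _).trans ((h.near k (by omega)).trans
            (tol_antitone hn)))
      _ ≤ tol N := two_mul_tol_le N
  -- Four errors arise: one from moving `ρ₀`, one from moving `ρ` with the weight carried along, and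
  -- one in each coordinate from replacing the weight `w` by `w ∘ T`.
  · intro E hE
    set T : X × X → X × X := Prod.map (γ k) (γ k) with hT
    have hTm : Measurable T := (γ k).measurable.prodMap (γ k).measurable
    have hTE : MeasurableSet (T ⁻¹' E) := hTm hE
    rw [Measure.map_apply hTm hE, Measure.add_apply, Measure.add_apply, withDensity_apply _ hTE,
      withDensity_apply _ hE]
    have e1 : ρ₀ (T ⁻¹' E) ≤ ρ₀ E + tol (4 * N + 3) := by
      rw [← Measure.map_apply hTm hE]; exact h₀.close k (by omega) E hE
    have hdef : ∫⁻ x, (b x - b (γ k x)) ∂μ ≤ tol (4 * N + 3) := by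
      refine lintegral_sub_comp_le hκ hb hb1 hbκ (hγ k) fun A hA => ?_
      rw [Measure.map_apply measurable_fst hA,
        Measure.map_apply measurable_fst ((γ k).measurable hA)]
      have := h₀.close_symm (k := k) (by omega) _ (measurable_fst hA)
      rwa [Measure.map_apply hTm (measurable_fst hA)] at this
    have hdm : Measurable fun x => b x - b (γ k x) := hb.sub (hb.comp (γ k).measurable)
    have e2 : ∫⁻ p in T ⁻¹' E, w (T p) ∂ρ ≤ ∫⁻ p in E, w p ∂ρ + tol (4 * N + 3) := by
      have := (h.close k (by omega)).lintegral_le (f := E.indicator w) (fun p => by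
        by_cases hp : p ∈ E
        · simpa [hp] using hw1 p
        · simp [hp])
      rw [lintegral_indicator hE, lintegral_indicator hE, setLIntegral_map hE hwm hTm] at this
      exact this.trans (add_le_add_right (tol_antitone hn) _)
    have e3 : ∫⁻ p in T ⁻¹' E, w p ∂ρ ≤ ∫⁻ p in T ⁻¹' E, w (T p) ∂ρ +
        (tol (4 * N + 3) + tol (4 * N + 3)) := by
      calc ∫⁻ p in T ⁻¹' E, w p ∂ρ ≤ ∫⁻ p in T ⁻¹' E, (w (T p) +
            ((b p.1 - b (γ k p.1)) + (b p.2 - b (γ k p.2)))) ∂ρ :=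
            lintegral_mono fun p => min_le_min_add _ _ _ _
        _ = ∫⁻ p in T ⁻¹' E, w (T p) ∂ρ + (∫⁻ p in T ⁻¹' E, (b p.1 - b (γ k p.1)) ∂ρ +
              ∫⁻ p in T ⁻¹' E, (b p.2 - b (γ k p.2)) ∂ρ) := by
            have hwT : Measurable fun p => w (T p) := hwm.comp hTm
            have hd1 : Measurable fun p : X × X => b p.1 - b (γ k p.1) := hdm.comp measurable_fst
            rw [lintegral_add_left hwT, lintegral_add_left hd1]
        _ ≤ _ := by
            refine add_le_add_right (add_le_add ?_ ?_) _
            · exact (setLIntegral_le_lintegral _ _).trans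
                ((lintegral_comp_fst_le h.fst_le hdm.aemeasurable).trans hdef)
            · exact (setLIntegral_le_lintegral _ _).trans
                ((lintegral_comp_snd_le h.snd_le hdm.aemeasurable).trans hdef)
    calc _ ≤ ρ₀ E + tol (4 * N + 3) + (∫⁻ p in E, w p ∂ρ + tol (4 * N + 3) +
          (tol (4 * N + 3) + tol (4 * N + 3))) :=
          add_le_add e1 (e3.trans (add_le_add_left e2 _))
      _ = ρ₀ E + ∫⁻ p in E, w p ∂ρ + tol N := by rw [← four_mul_tol N]; ring

end IsAlmostInvariant

/-- For every tolerance there is an almost invariant measure of mass almost `c`. -/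
def HasAlmostInvariant (μ : Measure X) (S : ℕ → Set X) (γ : ℕ → X ≃ᵐ X) (c : ℝ) : Prop :=
  ∀ N, ∃ ρ, IsAlmostInvariant μ S γ N ρ ∧ c ≤ ρ.real Set.univ + 1 / ((N : ℝ) + 1)

/-- A fraction close to `c` of the missing mass `1 - c` is recovered. Concentration near the
diagonal makes `min (b x) (b y)` as good as `b x`, and weak asymptotic constancy evaluates `∫ b x
dρ_n` as `ρ_n(X × X) ∫ b dμ`. -/
theorem HasAlmostInvariant.amplify [IsProbabilityMeasure μ] (hγ : ∀ k, MeasurePreserving (γ k) μ μ)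
    (herg : ∀ A, MeasurableSet A → (∀ k, γ k ⁻¹' A =ᵐ[μ] A) → μ A = 0 ∨ μ Aᶜ = 0)
    (hS : μ.MeasureDense (Set.range S)) {c : ℝ} (hc0 : 0 ≤ c) (hc1 : c ≤ 1)
    (h : HasAlmostInvariant μ S γ c) : HasAlmostInvariant μ S γ (1 - (1 - c) ^ 2) := by
  intro N
  obtain ⟨ρ₀, h₀, hm₀⟩ := h (4 * N + 3)
  -- The hypothesis is used twice: `ρ₀` is fixed first, and the index `n` of the second measure is
  -- chosen only after the defect density `b` of `ρ₀` is known.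
  choose ρ hρ hm using h
  have hfin : ∀ n, IsFiniteMeasure (ρ n) := fun n => (hρ n).isFiniteMeasure
  have hfin₀ := h₀.isFiniteMeasure
  set κ := μ - ρ₀.map Prod.fst with hκdef
  have hκ : ρ₀.map Prod.fst + κ = μ := by
    rw [add_comm]; exact Measure.sub_add_cancel_of_le h₀.fst_le
  have hκle : κ ≤ μ := Measure.sub_le
  obtain ⟨b, hb, hb1, hbκ⟩ := exists_density_of_le hκle
  have hbne : ∀ x, b x ≠ ∞ := fun x => ((hb1 x).trans_lt ENNReal.one_lt_top).ne
  have hfinw : ∀ n, IsFiniteMeasure ((ρ n).withDensity fun p => min (b p.1) (b p.2)) := fun n => by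
    refine isFiniteMeasure_of_le (ρ n) ?_
    conv_rhs => rw [← withDensity_one (μ := ρ n)]
    exact withDensity_mono (Eventually.of_forall fun p => (min_le_left _ _).trans (hb1 _))
  set g : X → ℝ := fun x => (b x).toReal with hg
  have hgm : Measurable g := hb.ennreal_toReal
  have hg0 : ∀ x, 0 ≤ g x := fun x => ENNReal.toReal_nonneg
  have hg1 : ∀ x, ‖g x‖ ≤ 1 := fun x => by
    rw [Real.norm_of_nonneg (hg0 x)]
    simpa using ENNReal.toReal_mono ENNReal.one_ne_top (hb1 x)
  have hbg : ∀ x, b x = ENNReal.ofReal (g x) := fun x => (ENNReal.ofReal_toReal (hbne x)).symm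
  have hnear : ∀ A, MeasurableSet A → Tendsto (fun n => ρ n (A ×ˢ Aᶜ)) atTop (𝓝 0) := fun A hA =>
    tendsto_measure_prod_compl_of_dense hS (fun n => (hρ n).fst_le) (fun n => (hρ n).snd_le)
      (fun k => tendsto_of_tendsto_of_tendsto_of_le_of_le' tendsto_const_nhds tendsto_tol
        (Eventually.of_forall fun _ => zero_le)
        (eventually_atTop.2 ⟨k, fun n hn => (hρ n).near k hn⟩)) hA
  have hgi : Integrable g μ :=
    Integrable.of_bound hgm.aestronglyMeasurable 1 (Eventually.of_forall hg1)
  have ht1 := tendsto_lintegral_enorm_sub (fun n => (hρ n).fst_le) (fun n => (hρ n).snd_le) hnear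
    hgi
  have hreal : ∀ n A, MeasurableSet A →
      ((ρ n).map Prod.fst).real A = (ρ n).real (Prod.fst ⁻¹' A) := fun n A hA =>
    map_measureReal_apply measurable_fst hA
  have hTm : ∀ k, Measurable (Prod.map (γ k) (γ k)) := fun k =>
    (γ k).measurable.prodMap (γ k).measurable
  have htr : Tendsto (fun n : ℕ => (1 : ℝ) / ((n : ℝ) + 1)) atTop (𝓝 0) :=
    tendsto_one_div_add_atTop_nhds_zero_nat
  have ht2 := tendsto_integral_sub_mul_integral hγ herg (fun n => (hρ n).fst_le)
    (fun k A hA => by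
      refine squeeze_zero_norm' (eventually_atTop.2 ⟨k, fun n hn => ?_⟩) htr
      have hA' : MeasurableSet (Prod.fst ⁻¹' A : Set (X × X)) := measurable_fst hA
      have e1 := (hρ n).close k hn _ hA'
      have e2 := (hρ n).close_symm hn _ hA'
      rw [Measure.map_apply (hTm k) hA'] at e1 e2
      have hpre : Prod.map (γ k) (γ k) ⁻¹' (Prod.fst ⁻¹' A) = Prod.fst ⁻¹' (γ k ⁻¹' A) := rfl
      rw [hpre] at e1 e2
      rw [hreal n A hA, hreal n _ ((γ k).measurable hA), Real.norm_eq_abs, abs_sub_le_iff]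
      have hpos : (0 : ℝ) ≤ 1 / ((n : ℝ) + 1) := by positivity
      constructor
      · have := ENNReal.toReal_mono (ENNReal.add_ne_top.2 ⟨measure_ne_top _ _, tol_ne_top n⟩) e1
        rw [ENNReal.toReal_add (measure_ne_top _ _) (tol_ne_top n), tol,
          ENNReal.toReal_ofReal hpos] at this
        rw [sub_le_iff_le_add']
        exact this
      · have := ENNReal.toReal_mono (ENNReal.add_ne_top.2 ⟨measure_ne_top _ _, tol_ne_top n⟩) e2
        rw [ENNReal.toReal_add (measure_ne_top _ _) (tol_ne_top n), tol,
          ENNReal.toReal_ofReal hpos] at this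
        rw [sub_le_iff_le_add']
        exact this)
    (g := g) (MemLp.of_bound hgm.aestronglyMeasurable 1 (Eventually.of_forall hg1))
  have hM : (1 : ℝ) / ((N : ℝ) + 1) = 4 * (1 / (((4 * N + 3 : ℕ) : ℝ) + 1)) := by
    push_cast
    field_simp
    ring
  set δ : ℝ := 1 / (((4 * N + 3 : ℕ) : ℝ) + 1) with hδ
  have hδ0 : 0 < δ := by positivity
  have E1 := (ENNReal.tendsto_atTop_zero.1 ht1) (ENNReal.ofReal δ) (by simpa using hδ0)
  obtain ⟨N1, hN1⟩ := E1
  obtain ⟨N2, hN2⟩ := Metric.tendsto_atTop.1 ht2 δ hδ0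
  obtain ⟨n, hnN, hn1, hn2⟩ : ∃ n, 4 * N + 3 ≤ n ∧ N1 ≤ n ∧ N2 ≤ n :=
    ⟨(4 * N + 3) + N1 + N2, by omega, by omega, by omega⟩
  refine ⟨_, h₀.add_withDensity hγ (hρ n) hnN hκ hb hb1 hbκ, ?_⟩
  have hgint : ∀ m : Measure X, ∫ x, g x ∂m = (∫⁻ x, b x ∂m).toReal := fun m => by
    rw [integral_eq_lintegral_of_nonneg_ae (Eventually.of_forall hg0) hgm.aestronglyMeasurable]
    simp only [hbg]
  have hgμ : ∫ x, g x ∂μ = 1 - ρ₀.real Set.univ := by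
    have e1 : ∫⁻ x, b x ∂μ = κ Set.univ := by
      rw [← hbκ, withDensity_apply _ MeasurableSet.univ, setLIntegral_univ]
    have e2 : (ρ₀ Set.univ + κ Set.univ).toReal = 1 := by
      have := congrArg (fun m : Measure X => m Set.univ) hκ
      simp only [Measure.add_apply, measure_univ] at this
      rw [Measure.map_apply measurable_fst MeasurableSet.univ, Set.preimage_univ] at this
      rw [this, ENNReal.toReal_one]
    have hκf : IsFiniteMeasure κ := isFiniteMeasure_of_le μ hκle
    rw [ENNReal.toReal_add (measure_ne_top _ _) (measure_ne_top _ _)] at e2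
    rw [hgint, e1]
    simp only [Measure.real]
    linarith
  have hgρ : ∫ x, g x ∂((ρ n).map Prod.fst) ≤
      ((ρ n).withDensity fun p => min (b p.1) (b p.2)).real Set.univ + δ := by
    rw [hgint, lintegral_map hb measurable_fst]
    have hle : ∫⁻ p, b p.1 ∂(ρ n) ≤
        ((ρ n).withDensity fun p => min (b p.1) (b p.2)) Set.univ + ENNReal.ofReal δ := by
      rw [withDensity_apply _ MeasurableSet.univ, setLIntegral_univ]
      refine le_trans ?_ (add_le_add_right (hN1 n hn1) _)
      have hwm : Measurable fun p : X × X => min (b p.1) (b p.2) :=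
        (hb.comp measurable_fst).min (hb.comp measurable_snd)
      rw [← lintegral_add_left hwm]
      refine lintegral_mono fun p => ?_
      rcases le_total (b p.1) (b p.2) with hp | hp
      · simp only [min_eq_left hp]; exact le_self_add
      · simp only [min_eq_right hp]
        rw [hbg, hbg, ← ofReal_norm, ← ENNReal.ofReal_add (hg0 _) (norm_nonneg _)]
        refine ENNReal.ofReal_le_ofReal ?_
        have := le_abs_self (g p.1 - g p.2)
        rw [Real.norm_eq_abs]
        linarith
    have := ENNReal.toReal_mono (ENNReal.add_ne_top.2
      ⟨measure_ne_top _ _, ENNReal.ofReal_ne_top⟩) hle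
    rwa [ENNReal.toReal_add (measure_ne_top _ _) ENNReal.ofReal_ne_top,
      ENNReal.toReal_ofReal hδ0.le] at this
  have e4 := hN2 n hn2
  rw [dist_zero_right, Real.norm_eq_abs, abs_lt, hgμ, hreal n _ MeasurableSet.univ,
    Set.preimage_univ] at e4
  have e5 := hm n
  have e6 : (1 : ℝ) / ((n : ℝ) + 1) ≤ δ := Nat.one_div_le_one_div hnN
  rw [measureReal_add_apply, hM]
  set t := ρ₀.real Set.univ with ht
  set s := (ρ n).real Set.univ with hs
  have ht1' : t ≤ 1 := by
    have : 0 ≤ ∫ x, g x ∂μ := integral_nonneg hg0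
    rw [hgμ] at this
    linarith
  have ht0 : 0 ≤ t := measureReal_nonneg
  -- The new mass is at least `t + s (1 - t) - 2 δ`, one `δ` for replacing `b x` by the minimum and
  -- one for weak constancy. Inserting `s ≥ c - δ` and `t ≥ c - δ` costs at most `δ` each, for a
  -- total of `4 δ = 1 / (N + 1)`.
  have f1 : (c - δ) * (1 - t) ≤ s * (1 - t) :=
    mul_le_mul_of_nonneg_right (by linarith) (by linarith)
  have f2 : δ * (1 - t) ≤ δ := by nlinarith
  have f3 : (1 - c) * (c - δ) ≤ (1 - c) * t :=
    mul_le_mul_of_nonneg_left (by linarith) (by linarith)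
  have f4 : (1 - c) * δ ≤ δ := by nlinarith
  nlinarith

end Amplify

end

noncomputable section

/-! ### Iterating the amplification and completing the marginals -/

section Completion

variable {X : Type*} [MeasurableSpace X] {μ : Measure X} {S : ℕ → Set X} {γ : ℕ → X ≃ᵐ X}

theorem IsAlmostInvariant.mono {M N : ℕ} {ρ : Measure (X × X)} (h : IsAlmostInvariant μ S γ M ρ)
    (hNM : N ≤ M) : IsAlmostInvariant μ S γ N ρ :=
  ⟨h.swap, h.diag, h.fst_le, fun k hk => (h.near k (hk.trans hNM)).trans (tol_antitone hNM),
    fun k hk E hE => (h.close k (hk.trans hNM) E hE).trans (add_le_add_right (tol_antitone hNM) _)⟩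

/-- Each amplification squares the defect, so after `j` rounds it is `(1 - c) ^ (2 ^ j)`, which
tends to zero as `c > 0`. -/
theorem HasAlmostInvariant.one [IsProbabilityMeasure μ] (hγ : ∀ k, MeasurePreserving (γ k) μ μ)
    (herg : ∀ A, MeasurableSet A → (∀ k, γ k ⁻¹' A =ᵐ[μ] A) → μ A = 0 ∨ μ Aᶜ = 0)
    (hS : μ.MeasureDense (Set.range S)) {c : ℝ} (hc0 : 0 < c) (hc1 : c ≤ 1)
    (h : HasAlmostInvariant μ S γ c) : HasAlmostInvariant μ S γ 1 := by
  have hpow : ∀ j : ℕ, HasAlmostInvariant μ S γ (1 - (1 - c) ^ (2 ^ j)) := by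
    intro j
    induction j with
    | zero => simpa using h
    | succ j ih =>
      have h0 : 0 ≤ (1 - c) ^ (2 ^ j) := pow_nonneg (by linarith) _
      have h1 : (1 - c) ^ (2 ^ j) ≤ 1 := pow_le_one₀ (by linarith) (by linarith)
      have := ih.amplify hγ herg hS (by linarith) (by linarith)
      rwa [sub_sub_cancel, ← pow_mul, ← pow_succ] at this
  intro N
  have hlim : Tendsto (fun j : ℕ => (1 - c) ^ (2 ^ j)) atTop (𝓝 0) :=
    (tendsto_pow_atTop_nhds_zero_of_lt_one (by linarith) (by linarith)).comp
      (tendsto_pow_atTop_atTop_of_one_lt one_lt_two)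
  obtain ⟨j, hj⟩ := (hlim.eventually_lt_const
    (show (0 : ℝ) < 1 / (2 * ((N : ℝ) + 1)) by positivity)).exists
  -- The index `2 * N + 1` halves the error `1 / (N + 1)`; the other half absorbs the remaining
  -- defect.
  obtain ⟨ρ, hρ, hm⟩ := hpow j (2 * N + 1)
  refine ⟨ρ, hρ.mono (by omega), ?_⟩
  have e : (1 : ℝ) / (((2 * N + 1 : ℕ) : ℝ) + 1) = 1 / (2 * ((N : ℝ) + 1)) := by
    push_cast; ring_nf
  have e2 : (1 : ℝ) / ((N : ℝ) + 1) = 2 * (1 / (2 * ((N : ℝ) + 1))) := by field_simp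
  rw [e] at hm
  rw [e2]
  linarith

theorem prod_self_diagonal [MeasurableEq X] {κ : Measure X} [SFinite κ] [NullSingletonClass κ] :
    (κ.prod κ) (Set.diagonal X) = 0 := by
  rw [Measure.prod_apply measurableSet_diagonal, lintegral_eq_zero_iff
    (measurable_measure_prodMk_left measurableSet_diagonal)]
  refine Eventually.of_forall fun x => ?_
  have : Prod.mk x ⁻¹' Set.diagonal X = {x} := by
    ext y; simp [eq_comm]
  show κ (Prod.mk x ⁻¹' Set.diagonal X) = 0
  rw [this]
  exact measure_singleton x

/-- By symmetry `ρ` misses the same measure `κ` in both coordinates, and `κ × κ / κ(X)` supplies it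
twice. Its mass is at most `tol N`, so it spoils the other estimates by at most that amount. -/
theorem exists_measure_marginals_eq [MeasurableEq X] [IsProbabilityMeasure μ]
    [NullSingletonClass μ] {N : ℕ} {ρ : Measure (X × X)} (hρ : IsAlmostInvariant μ S γ N ρ)
    (hm : 1 ≤ ρ.real Set.univ + 1 / ((N : ℝ) + 1)) :
    ∃ ν : Measure (X × X), ν (Set.diagonal X) = 0 ∧ ν.map Prod.fst = μ ∧ ν.map Prod.snd = μ ∧
      (∀ k ≤ N, ν (S k ×ˢ (S k)ᶜ) ≤ tol N + tol N) ∧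
      ∀ k ≤ N, MeasureClose (tol N + tol N) (ν.map (Prod.map (γ k) (γ k))) ν := by
  have := hρ.isFiniteMeasure
  set κ := μ - ρ.map Prod.fst with hκdef
  have hκ : ρ.map Prod.fst + κ = μ := by
    rw [add_comm]; exact Measure.sub_add_cancel_of_le hρ.fst_le
  have hκle : κ ≤ μ := Measure.sub_le
  have : IsFiniteMeasure κ := isFiniteMeasure_of_le μ hκle
  have : NullSingletonClass κ := ⟨fun x => le_antisymm ((hκle {x}).trans (measure_singleton x).le)
    zero_le⟩
  set π := (κ Set.univ)⁻¹ • κ.prod κ with hπ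
  -- If `κ = 0` the scalar is `∞`, but it multiplies the zero measure.
  have hmarg : (κ Set.univ)⁻¹ • (κ Set.univ • κ) = κ := by
    by_cases h0 : κ = 0
    · simp [h0]
    · rw [smul_smul, ENNReal.inv_mul_cancel (by simpa using h0) (measure_ne_top _ _), one_smul]
  have hfst : π.map Prod.fst = κ := by
    rw [hπ, Measure.map_smul, Measure.map_fst_prod, hmarg]
  have hsnd : π.map Prod.snd = κ := by
    rw [hπ, Measure.map_smul, Measure.map_snd_prod, hmarg]
  have hmass : π Set.univ ≤ tol N := by
    have e1 : π Set.univ = κ Set.univ := by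
      rw [← hfst, Measure.map_apply measurable_fst MeasurableSet.univ, Set.preimage_univ]
    have e2 : (ρ Set.univ + κ Set.univ).toReal = 1 := by
      have := congrArg (fun m : Measure X => m Set.univ) hκ
      simp only [Measure.add_apply, measure_univ] at this
      rw [Measure.map_apply measurable_fst MeasurableSet.univ, Set.preimage_univ] at this
      rw [this, ENNReal.toReal_one]
    rw [ENNReal.toReal_add (measure_ne_top _ _) (measure_ne_top _ _)] at e2
    rw [e1, tol, ← ENNReal.ofReal_toReal (measure_ne_top κ Set.univ)]
    refine ENNReal.ofReal_le_ofReal ?_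
    simp only [Measure.real] at hm
    linarith
  have hπle : ∀ E, π E ≤ tol N := fun E => (measure_mono (Set.subset_univ E)).trans hmass
  refine ⟨ρ + π, ?_, ?_, ?_, fun k hk => ?_, fun k hk E hE => ?_⟩
  · rw [Measure.add_apply, hρ.diag, hπ, Measure.smul_apply, prod_self_diagonal, smul_zero, zero_add]
  · rw [Measure.map_add _ _ measurable_fst, hfst, hκ]
  · rw [Measure.map_add _ _ measurable_snd, hsnd, map_snd_of_map_swap hρ.swap, hκ]
  · exact add_le_add (hρ.near k hk) (hπle _)
  · have hT : Measurable (Prod.map (γ k) (γ k)) := (γ k).measurable.prodMap (γ k).measurable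
    have h1 := hρ.close k hk E hE
    rw [Measure.map_apply hT hE] at h1 ⊢
    rw [Measure.add_apply, Measure.add_apply]
    calc _ ≤ ρ E + tol N + tol N := add_le_add h1 (hπle _)
      _ ≤ ρ E + π E + (tol N + tol N) := by
        rw [add_assoc]
        exact add_le_add_left le_self_add _

end Completion

/-! ### From countably many automorphisms to the full group, and condition (i) -/

section FullGroup

variable {X : Type u} [MeasurableSpace X] [MeasurableEq X] {μ : Measure X} [IsProbabilityMeasure μ]
  {γ : ℕ → X ≃ᵐ X} {ν : ℕ → Measure (X × X)}

/-- On the piece `D k` the map `θ` agrees with `γ k`. Near the diagonal both coordinates usually lie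
in the same piece, where `θ × θ` is `γ k × γ k`; the images of the squares `D k ×ˢ D k` are
disjoint, so the estimates for different `k` add up to a bound on all of `E`. -/
theorem tendsto_measureDist_of_ae_exists_eq (hν : ∀ n, IsProbabilityMeasure (ν n))
    (h1 : ∀ n, (ν n).map Prod.fst = μ)
    (hnear : ∀ A, MeasurableSet A → Tendsto (fun n => ν n (A ×ˢ Aᶜ)) atTop (𝓝 0))
    {d : ℕ → ℕ → ℝ≥0∞} (hd : ∀ k, Tendsto (d k) atTop (𝓝 0))
    (hclose : ∀ k n, MeasureClose (d k n) ((ν n).map (Prod.map (γ k) (γ k))) (ν n))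
    {θ : X ≃ᵐ X} (hθ : ∀ᵐ x ∂μ, ∃ k, θ x = γ k x) :
    Tendsto (fun n => measureDist ((ν n).map (Prod.map θ θ)) (ν n)) atTop (𝓝 0) := by
  set D : ℕ → Set X := disjointed fun k => {x | θ x = γ k x} with hD
  have hDm : ∀ k, MeasurableSet (D k) := fun k => by
    refine MeasurableSet.disjointed (fun k => ?_) k
    exact measurableSet_eq_fun θ.measurable (γ k).measurable
  have hDdisj : Pairwise (Function.onFun Disjoint D) := disjoint_disjointed _
  have hDeq : ∀ k, ∀ x ∈ D k, θ x = γ k x := fun k x hx => disjointed_subset _ k hx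
  set B : ℕ → Set X := fun K => (⋃ k ∈ Finset.range K, D k)ᶜ with hB
  have hBm : ∀ K, MeasurableSet (B K) := fun K =>
    (Finset.measurableSet_biUnion _ fun k _ => hDm k).compl
  have hBlim : Tendsto (fun K => μ (B K)) atTop (𝓝 0) := by
    have hanti : Antitone B := fun K L hKL => Set.compl_subset_compl.2
      (Set.biUnion_mono (by simpa using hKL) fun _ _ => le_rfl)
    have := tendsto_measure_iInter_atTop (μ := μ) (fun K => (hBm K).nullMeasurableSet) hanti
      ⟨0, measure_ne_top _ _⟩
    have h0 : μ (⋂ K, B K) = 0 := by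
      rw [measure_eq_zero_iff_ae_notMem]
      filter_upwards [hθ] with x ⟨k, hk⟩ hx
      have hxU : x ∈ ⋃ k, D k := by
        rw [hD, iUnion_disjointed]
        exact Set.mem_iUnion.2 ⟨k, hk⟩
      obtain ⟨j, hj⟩ := Set.mem_iUnion.1 hxU
      refine Set.mem_iInter.1 hx (j + 1) ?_
      simp only [Set.mem_iUnion]
      exact ⟨j, by simp, hj⟩
    rwa [h0] at this
  have hTθ : Measurable (Prod.map θ θ) := θ.measurable.prodMap θ.measurable
  have hTk : ∀ k, Measurable (Prod.map (γ k) (γ k)) := fun k =>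
    (γ k).measurable.prodMap (γ k).measurable
  -- The three terms bound the pairs with `x` outside the first `K` pieces, the pairs split between
  -- pieces, and the failure of invariance under each `γ k`.
  set e : ℕ → ℕ → ℝ≥0∞ := fun K n => μ (B K) +
    (∑ k ∈ Finset.range K, ν n (D k ×ˢ (D k)ᶜ) + ∑ k ∈ Finset.range K, d k n) with he
  have hmain : ∀ K n, MeasureClose (e K n) ((ν n).map (Prod.map θ θ)) (ν n) := by
    intro K n E hE
    rw [Measure.map_apply hTθ hE]
    have hIm : ∀ k, MeasurableSet (θ.symm ⁻¹' D k) := fun k => θ.symm.measurable (hDm k)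
    have hEm : ∀ k, MeasurableSet (E ∩ (θ.symm ⁻¹' D k) ×ˢ (θ.symm ⁻¹' D k)) := fun k =>
      hE.inter ((hIm k).prod (hIm k))
    have hsub : Prod.map θ θ ⁻¹' E ⊆ B K ×ˢ Set.univ ∪ ((⋃ k ∈ Finset.range K, D k ×ˢ (D k)ᶜ) ∪
        ⋃ k ∈ Finset.range K, Prod.map (γ k) (γ k) ⁻¹'
          (E ∩ (θ.symm ⁻¹' D k) ×ˢ (θ.symm ⁻¹' D k))) := by
      rintro ⟨x, y⟩ hxy
      by_cases hx : x ∈ B K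
      · exact Or.inl ⟨hx, Set.mem_univ _⟩
      · rw [hB, Set.notMem_compl_iff] at hx
        simp only [Set.mem_iUnion] at hx
        obtain ⟨k, hk, hxk⟩ := hx
        right
        by_cases hy : y ∈ D k
        · right
          simp only [Set.mem_iUnion]
          refine ⟨k, hk, ?_⟩
          simp only [Set.mem_preimage, Prod.map_apply, Set.mem_inter_iff, Set.mem_prod] at hxy ⊢
          rw [← hDeq k x hxk, ← hDeq k y hy]
          simp [hxy, hxk, hy]
        · left
          simp only [Set.mem_iUnion]
          exact ⟨k, hk, hxk, hy⟩
    calc ν n (Prod.map θ θ ⁻¹' E) ≤ _ := measure_mono hsub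
      _ ≤ ν n (B K ×ˢ Set.univ) + (ν n (⋃ k ∈ Finset.range K, D k ×ˢ (D k)ᶜ) +
          ν n (⋃ k ∈ Finset.range K, Prod.map (γ k) (γ k) ⁻¹'
            (E ∩ (θ.symm ⁻¹' D k) ×ˢ (θ.symm ⁻¹' D k)))) :=
        (measure_union_le _ _).trans (add_le_add_right (measure_union_le _ _) _)
      _ ≤ μ (B K) + (∑ k ∈ Finset.range K, ν n (D k ×ˢ (D k)ᶜ) +
          ∑ k ∈ Finset.range K,
            (ν n (E ∩ (θ.symm ⁻¹' D k) ×ˢ (θ.symm ⁻¹' D k)) + d k n)) := by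
        refine add_le_add (measure_prod_univ_le (h1 n).le (hBm K)) (add_le_add
          (measure_biUnion_finset_le _ _) ((measure_biUnion_finset_le _ _).trans
            (Finset.sum_le_sum fun k _ => ?_)))
        rw [← Measure.map_apply (hTk k) (hEm k)]
        exact hclose k n _ (hEm k)
      _ = (∑ k ∈ Finset.range K, ν n (E ∩ (θ.symm ⁻¹' D k) ×ˢ (θ.symm ⁻¹' D k))) + e K n := by
        rw [Finset.sum_add_distrib, he]; ring
      _ ≤ ν n E + e K n := by
        refine add_le_add_left ?_ _
        rw [← measure_biUnion_finset (fun i _ j _ hij => ?_) (fun k _ => hEm k)]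
        · exact measure_mono (Set.iUnion₂_subset fun k _ => Set.inter_subset_left)
        · refine Set.disjoint_left.2 ?_
          rintro ⟨x, y⟩ hi hj
          exact Set.disjoint_left.1 (hDdisj hij) hi.2.1 hj.2.1
  refine ENNReal.tendsto_nhds_zero.2 fun ε hε => ?_
  -- The bound by `1` only keeps the error finite when `ε = ∞`; the quarter accounts for two error
  -- terms and the factor `2` in `measureDist_le`.
  have hε4 : 0 < min (ε / 4) 1 := lt_min (ENNReal.div_pos hε.ne' (by simp)) one_pos
  obtain ⟨K, hK⟩ := (hBlim.eventually_lt_const hε4).exists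
  have hlim : Tendsto (fun n => ∑ k ∈ Finset.range K, ν n (D k ×ˢ (D k)ᶜ) +
      ∑ k ∈ Finset.range K, d k n) atTop (𝓝 0) := by
    have := (tendsto_finsetSum (Finset.range K) fun k _ => hnear _ (hDm k)).add
      (tendsto_finsetSum (Finset.range K) fun k _ => hd k)
    simpa using this
  filter_upwards [hlim.eventually_lt_const hε4] with n hn
  have hpm : IsProbabilityMeasure ((ν n).map (Prod.map θ θ)) :=
    Measure.isProbabilityMeasure_map hTθ.aemeasurable
  have hle : e K n ≤ min (ε / 4) 1 + min (ε / 4) 1 := add_le_add hK.le hn.le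
  have hne : e K n ≠ ∞ := by
    refine (hle.trans_lt ?_).ne
    exact ENNReal.add_lt_top.2 ⟨(min_le_right _ _).trans_lt ENNReal.one_lt_top,
      (min_le_right _ _).trans_lt ENNReal.one_lt_top⟩
  calc _ ≤ 2 * e K n := (hmain K n).measureDist_le hne
    _ ≤ 2 * (ε / 4 + ε / 4) := by
      gcongr
      exact hle.trans (add_le_add (min_le_left _ _) (min_le_left _ _))
    _ = ε := by
      rw [← two_mul, ← mul_assoc, show (2 : ℝ≥0∞) * 2 = 4 by norm_num,
        ENNReal.mul_div_cancel (by simp) (by simp)]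

end FullGroup

/-- Since the first marginal is `μ`, the limit equals `∫ f₁ x * f₂ x dν_n`. The difference is at
most a bound for `f₁` times `∫ ‖f₂ x - f₂ y‖ dν_n`. -/
theorem tendsto_integral_mul_of_near {X : Type u} [MeasurableSpace X] {μ : Measure X}
    [IsProbabilityMeasure μ] {ν : ℕ → Measure (X × X)}
    (h1 : ∀ n, (ν n).map Prod.fst = μ) (h2 : ∀ n, (ν n).map Prod.snd = μ)
    (hnear : ∀ A, MeasurableSet A → Tendsto (fun n => ν n (A ×ˢ Aᶜ)) atTop (𝓝 0))
    {f₁ f₂ : X → ℂ} (hf₁ : IsBddBorel f₁) (hf₂ : IsBddBorel f₂) :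
    Tendsto (fun n => ∫ p, f₁ p.1 * f₂ p.2 ∂(ν n)) atTop (𝓝 (∫ x, f₁ x * f₂ x ∂μ)) := by
  obtain ⟨hm₁, C, hC⟩ := hf₁
  obtain ⟨hm₂, D, hD⟩ := hf₂
  have hfin : ∀ n, IsFiniteMeasure (ν n) := fun n => ⟨by
    have := measure_prod_univ_le (h1 n).le MeasurableSet.univ
    rw [Set.univ_prod_univ] at this
    exact this.trans_lt (measure_lt_top _ _)⟩
  have ht := tendsto_lintegral_enorm_sub (fun n => (h1 n).le) (fun n => (h2 n).le) hnear
    (Integrable.of_bound hm₂.aestronglyMeasurable D (Eventually.of_forall hD) : Integrable f₂ μ)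
  have ht' := ENNReal.Tendsto.const_mul (a := ENNReal.ofReal C) ht (Or.inr ENNReal.ofReal_ne_top)
  rw [mul_zero] at ht'
  rw [tendsto_iff_edist_tendsto_0]
  refine tendsto_of_tendsto_of_tendsto_of_le_of_le tendsto_const_nhds ht' (fun _ => zero_le)
    fun n => ?_
  have hi1 : Integrable (fun p : X × X => f₁ p.1 * f₂ p.2) (ν n) := by
    refine Integrable.of_bound ((hm₁.comp measurable_fst).mul
      (hm₂.comp measurable_snd)).aestronglyMeasurable (C * D) (Eventually.of_forall fun p => ?_)
    rw [norm_mul]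
    exact mul_le_mul (hC _) (hD _) (norm_nonneg _) ((norm_nonneg _).trans (hC p.1))
  have hi2 : Integrable (fun p : X × X => f₁ p.1 * f₂ p.1) (ν n) := by
    refine Integrable.of_bound ((hm₁.comp measurable_fst).mul
      (hm₂.comp measurable_fst)).aestronglyMeasurable (C * D) (Eventually.of_forall fun p => ?_)
    rw [norm_mul]
    exact mul_le_mul (hC _) (hD _) (norm_nonneg _) ((norm_nonneg _).trans (hC p.1))
  have e1 : ∫ x, f₁ x * f₂ x ∂μ = ∫ p, f₁ p.1 * f₂ p.1 ∂(ν n) := by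
    conv_lhs => rw [← h1 n]
    have hm : Measurable fun x => f₁ x * f₂ x := hm₁.mul hm₂
    rw [integral_map measurable_fst.aemeasurable hm.aestronglyMeasurable]
  dsimp only
  rw [edist_comm, edist_eq_enorm_sub, e1, ← integral_sub hi2 hi1]
  refine (enorm_integral_le_lintegral_enorm _).trans ?_
  have hm : Measurable fun p : X × X => ‖f₂ p.1 - f₂ p.2‖ₑ :=
    ((hm₂.comp measurable_fst).sub (hm₂.comp measurable_snd)).enorm
  rw [← lintegral_const_mul _ hm]
  refine lintegral_mono fun p => ?_
  dsimp only
  rw [← mul_sub, enorm_mul]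
  gcongr
  rw [← ofReal_norm]
  exact ENNReal.ofReal_le_ofReal (hC _)

/-! ### Ergodicity of the relation and construction of the excluded sequence -/

namespace CountablePMPEquivRel

variable {X : Type u} [MeasurableSpace X] {μ : Measure X} (R : CountablePMPEquivRel X μ)

/-- An enumeration of the action by automorphisms of `(X, μ)` whose orbits are the classes. -/
theorem exists_enumeration : ∃ γ : ℕ → X ≃ᵐ X, (∀ k, MeasurePreserving (γ k) μ μ) ∧
    ∀ x y, R.rel x y ↔ ∃ k, γ k x = y := by
  obtain ⟨Γ, _, _, _, hpres, hrel⟩ := R.measure_preserving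
  obtain ⟨e, he⟩ := exists_surjective_nat Γ
  refine ⟨fun k => ⟨MulAction.toPerm (e k), (hpres (e k)).measurable,
    (hpres (e k)⁻¹).measurable⟩, fun k => hpres (e k), fun x y => ?_⟩
  constructor
  · intro h
    have h2 : R.rel y x := R.rel.symm h
    rw [hrel] at h2
    obtain ⟨g, hg⟩ := h2
    obtain ⟨k, rfl⟩ := he g
    exact ⟨k, hg⟩
  · rintro ⟨k, rfl⟩
    apply R.rel.symm
    rw [hrel]
    exact ⟨e k, rfl⟩

variable {R}

/-- Ergodicity concerns strictly invariant sets, so the almost invariant `A` is replaced by the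
intersection of all `γ k ⁻¹' A`. This set is saturated, because the `γ k` enumerate whole classes,
and agrees with `A` almost everywhere. -/
theorem IsErgodic.null_or_conull (hR : R.IsErgodic) {γ : ℕ → X ≃ᵐ X}
    (hrel : ∀ x y, R.rel x y ↔ ∃ k, γ k x = y) {A : Set X} (hA : MeasurableSet A)
    (h : ∀ k, γ k ⁻¹' A =ᵐ[μ] A) : μ A = 0 ∨ μ Aᶜ = 0 := by
  set B := ⋂ k, γ k ⁻¹' A with hB
  have hBA : B =ᵐ[μ] A := by
    filter_upwards [ae_all_iff.2 h] with x hx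
    refine propext ⟨fun hxB => ?_, fun hxA => Set.mem_iInter.2 fun k => (hx k).mpr hxA⟩
    obtain ⟨k, hk⟩ := (hrel x x).1 (R.rel.refl x)
    have := Set.mem_iInter.1 hxB k
    rw [Set.mem_preimage, hk] at this
    exact this
  have hBm : MeasurableSet B := MeasurableSet.iInter fun k => (γ k).measurable hA
  rcases hR B hBm (fun x y hxy hx => by
      refine Set.mem_iInter.2 fun k => ?_
      obtain ⟨j, hj⟩ := (hrel x (γ k y)).1 (R.rel.trans hxy ((hrel _ _).2 ⟨k, rfl⟩))
      rw [Set.mem_preimage, ← hj]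
      exact Set.mem_iInter.1 hx j) with h1 | h1
  · exact Or.inl ((measure_congr hBA).symm.trans h1)
  · exact Or.inr ((measure_congr hBA.compl).symm.trans h1)

theorem exists_seq_of_hasAlmostInvariant [StandardBorelSpace X] [IsProbabilityMeasure μ]
    [NullSingletonClass μ] (hR : R.IsErgodic) {S : ℕ → Set X} (hS : μ.MeasureDense (Set.range S))
    {γ : ℕ → X ≃ᵐ X} (hγ : ∀ k, MeasurePreserving (γ k) μ μ)
    (hrel : ∀ x y, R.rel x y ↔ ∃ k, γ k x = y) {c : ℝ} (hc0 : 0 < c) (hc1 : c ≤ 1)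
    (h : HasAlmostInvariant μ S γ c) :
    ∃ ν : ℕ → Measure (X × X),
      (∀ n, IsProbabilityMeasure (ν n)) ∧
      (∀ n, ν n (Set.diagonal X) = 0) ∧
      (∀ n, (ν n).map Prod.fst = μ ∧ (ν n).map Prod.snd = μ) ∧
      (∀ f₁ f₂ : X → ℂ, IsBddBorel f₁ → IsBddBorel f₂ →
        Tendsto (fun n => ∫ p, f₁ p.1 * f₂ p.2 ∂(ν n)) atTop (𝓝 (∫ x, f₁ x * f₂ x ∂μ))) ∧
      (∀ θ ∈ R.fullGroup,
        Tendsto (fun n => measureDist ((ν n).map (Prod.map θ θ)) (ν n)) atTop (𝓝 0)) := by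
  choose ρ hρ hm using h.one hγ (fun A hA hA' => hR.null_or_conull hrel hA hA') hS hc0 hc1
  choose ν hdiag h1 h2 hnearS hclose using fun n => exists_measure_marginals_eq (hρ n) (hm n)
  have hprob : ∀ n, IsProbabilityMeasure (ν n) := fun n => ⟨by
    have : ((ν n).map Prod.fst) Set.univ = 1 := by rw [h1 n, measure_univ]
    rwa [Measure.map_apply measurable_fst MeasurableSet.univ, Set.preimage_univ] at this⟩
  have htol : Tendsto (fun n => tol n + tol n) atTop (𝓝 0) := by
    simpa using tendsto_tol.add tendsto_tol
  have hnear : ∀ A, MeasurableSet A → Tendsto (fun n => ν n (A ×ˢ Aᶜ)) atTop (𝓝 0) := fun A hA =>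
    tendsto_measure_prod_compl_of_dense hS (fun n => (h1 n).le) (fun n => (h2 n).le)
      (fun k => tendsto_of_tendsto_of_tendsto_of_le_of_le' tendsto_const_nhds htol
        (Eventually.of_forall fun _ => zero_le)
        (eventually_atTop.2 ⟨k, fun n hn => hnearS n k hn⟩)) hA
  refine ⟨ν, hprob, hdiag, fun n => ⟨h1 n, h2 n⟩,
    fun f₁ f₂ hf₁ hf₂ => tendsto_integral_mul_of_near h1 h2 hnear hf₁ hf₂, fun θ hθ => ?_⟩
  -- Closeness under `γ k` is available only for `n ≥ k`; the value `∞` before that does not affect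
  -- the limit.
  refine tendsto_measureDist_of_ae_exists_eq (γ := γ) hprob h1 hnear
    (d := fun k n => if k ≤ n then tol n + tol n else ∞) (fun k => ?_) (fun k n => ?_) ?_
  · refine htol.congr' (eventually_atTop.2 ⟨k, fun n hn => ?_⟩)
    simp [show k ≤ n from hn]
  · by_cases hk : k ≤ n
    · simpa only [hk, if_true] using hclose n k hk
    · simp only [hk, if_false]
      intro E _
      simp
  · filter_upwards [hθ.2] with x hx
    obtain ⟨k, hk⟩ := (hrel _ _).1 hx
    exact ⟨k, hk.symm⟩

end CountablePMPEquivRel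

end

noncomputable section

/-! ### Commuting families of projections indexed by measurable sets -/

/-- A finitely additive projection-valued set function. -/
structure IsProjectionFamily {X : Type*} [MeasurableSpace X] {H : Type*} [NormedAddCommGroup H]
    [InnerProductSpace ℂ H] [CompleteSpace H] (P : Set X → H →L[ℂ] H) : Prop where
  univ : P Set.univ = 1
  inter : ∀ A B, MeasurableSet A → MeasurableSet B → P (A ∩ B) = P A * P B
  union : ∀ A B, MeasurableSet A → MeasurableSet B → Disjoint A B → P (A ∪ B) = P A + P B
  star_eq : ∀ A, MeasurableSet A → star (P A) = P A

/-! ### Orthogonal projections in a Hilbert space -/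

section Hilbert

variable {H : Type*} [NormedAddCommGroup H] [InnerProductSpace ℂ H]

theorem norm_add_sq_of_inner_eq_zero {a b : H} (h : inner ℂ a b = 0) :
    ‖a + b‖ ^ 2 = ‖a‖ ^ 2 + ‖b‖ ^ 2 := by
  rw [@norm_add_sq ℂ, h]; simp

theorem norm_sub_sq_of_inner_eq_zero {a b : H} (h : inner ℂ a b = 0) :
    ‖a - b‖ ^ 2 = ‖a‖ ^ 2 + ‖b‖ ^ 2 := by
  rw [@norm_sub_sq ℂ, h]; simp

variable [CompleteSpace H]

theorem inner_apply_apply_of_star_eq {T U : H →L[ℂ] H} (hT : star T = T) (a b : H) :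
    inner ℂ (T a) (U b) = inner ℂ a ((T * U) b) := by
  rw [ContinuousLinearMap.star_eq_adjoint] at hT
  conv_lhs => rw [← hT]
  rw [ContinuousLinearMap.adjoint_inner_left]
  rfl

theorem norm_sq_of_isStarProjection {T : H →L[ℂ] H} (hT : star T = T) (hT2 : T * T = T) (a : H) :
    ‖T a‖ ^ 2 = RCLike.re (inner ℂ a (T a)) := by
  rw [← inner_self_eq_norm_sq (𝕜 := ℂ), inner_apply_apply_of_star_eq hT, hT2]

/-- Finite families of mutually orthogonal projections with sum `1`. -/
theorem norm_sum_apply_sq {ι : Type*} {e : ι → H →L[ℂ] H} (hstar : ∀ i, star (e i) = e i)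
    (hmul : ∀ i j, i ≠ j → e i * e j = 0) (s : Finset ι) (a : H) :
    ‖∑ i ∈ s, e i a‖ ^ 2 = ∑ i ∈ s, ‖e i a‖ ^ 2 := by
  classical
  induction s using Finset.induction with
  | empty => simp
  | insert i s hi ih =>
    rw [Finset.sum_insert hi, Finset.sum_insert hi, norm_add_sq_of_inner_eq_zero, ih]
    rw [inner_sum]
    refine Finset.sum_eq_zero fun j hj => ?_
    rw [inner_apply_apply_of_star_eq (hstar i), hmul i j (fun h => hi (h ▸ hj))]
    simp

/-- Both sums are squared norms of the images of `a` and `b` under one contraction `∑ i ∈ s, e i`.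
For unit vectors a difference of squares is at most twice the difference of norms, so the bound does
not depend on the size of `s`. -/
theorem sum_norm_apply_sq_le {ι : Type*} [Fintype ι] {e : ι → H →L[ℂ] H}
    (hstar : ∀ i, star (e i) = e i) (hmul : ∀ i j, i ≠ j → e i * e j = 0) (hsum : ∑ i, e i = 1)
    (s : Finset ι) {a b : H} (ha : ‖a‖ = 1) (hb : ‖b‖ = 1) :
    ∑ i ∈ s, ‖e i a‖ ^ 2 ≤ ∑ i ∈ s, ‖e i b‖ ^ 2 + 2 * ‖a - b‖ := by
  have hcontr : ∀ x : H, ‖∑ i ∈ s, e i x‖ ≤ ‖x‖ := fun x => by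
    refine le_of_sq_le_sq ?_ (norm_nonneg x)
    have h1 : ∑ i, e i x = x := by
      rw [← sum_apply, hsum]; rfl
    conv_rhs => rw [← h1]
    rw [norm_sum_apply_sq hstar hmul, norm_sum_apply_sq hstar hmul]
    exact Finset.sum_le_sum_of_subset_of_nonneg (Finset.subset_univ s) fun _ _ _ => sq_nonneg _
  rw [← norm_sum_apply_sq hstar hmul, ← norm_sum_apply_sq hstar hmul]
  have h1 := hcontr a
  have h2 := hcontr b
  rw [ha] at h1
  rw [hb] at h2
  have h3 := hcontr (a - b)
  simp only [map_sub, Finset.sum_sub_distrib] at h3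
  have h4 := norm_sub_norm_le (∑ i ∈ s, e i a) (∑ i ∈ s, e i b)
  nlinarith [norm_nonneg (∑ i ∈ s, e i a), norm_nonneg (∑ i ∈ s, e i b), norm_nonneg (a - b)]

end Hilbert

/-- `E` is a finite union of products of cells of a finite measurable partition of `X`. -/
def IsCellUnion {X : Type*} [MeasurableSpace X] (E : Set (X × X)) : Prop :=
  ∃ (ι : Type) (_ : Fintype ι) (c : X → ι) (S : Set (ι × ι)), (∀ i, MeasurableSet (c ⁻¹' {i})) ∧
    E = {p | (c p.1, c p.2) ∈ S}

/-- Two partitions are handled together by their common refinement, indexed by the product of the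
index types. -/
theorem isSetAlgebra_isCellUnion (X : Type*) [MeasurableSpace X] :
    IsSetAlgebra {E : Set (X × X) | IsCellUnion E} where
  empty_mem := ⟨Unit, inferInstance, fun _ => (), ∅, fun _ => by simp, by ext; simp⟩
  compl_mem := by
    rintro _ ⟨ι, _, c, S, hc, rfl⟩
    exact ⟨ι, inferInstance, c, Sᶜ, hc, rfl⟩
  union_mem := by
    rintro _ _ ⟨ι, _, c, S, hc, rfl⟩ ⟨ι', _, c', S', hc', rfl⟩
    refine ⟨ι × ι', inferInstance, fun x => (c x, c' x),
      {q | (q.1.1, q.2.1) ∈ S ∨ (q.1.2, q.2.2) ∈ S'}, fun i => ?_, rfl⟩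
    have : (fun x => (c x, c' x)) ⁻¹' {i} = c ⁻¹' {i.1} ∩ c' ⁻¹' {i.2} := by
      ext x; simp [Prod.ext_iff]
    rw [this]
    exact (hc _).inter (hc' _)

theorem generateFrom_isCellUnion (X : Type*) [MeasurableSpace X] :
    (inferInstance : MeasurableSpace (X × X)) =
      MeasurableSpace.generateFrom {E : Set (X × X) | IsCellUnion E} := by
  refine le_antisymm ?_ (MeasurableSpace.generateFrom_le ?_)
  · rw [← generateFrom_prod]
    refine MeasurableSpace.generateFrom_mono ?_
    rintro _ ⟨A, hA, B, hB, rfl⟩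
    -- A rectangle is a single pattern of truth values of `x ∈ A` and `y ∈ B` for the four-cell
    -- partition generated by `A` and `B`.
    refine ⟨Prop × Prop, inferInstance, fun x => (x ∈ A, x ∈ B), {q | q.1.1 ∧ q.2.2}, fun i => ?_,
      rfl⟩
    have : (fun x => (x ∈ A, x ∈ B)) ⁻¹' {i} = {x | (x ∈ A) = i.1} ∩ {x | (x ∈ B) = i.2} := by
      ext x; simp [Prod.ext_iff]
    rw [this]
    have haux : ∀ (C : Set X), MeasurableSet C → ∀ p : Prop, MeasurableSet {x | (x ∈ C) = p} := by
      intro C hC p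
      by_cases hp : p
      · simpa [hp] using hC
      · have : {x | (x ∈ C) = p} = Cᶜ := by ext x; simp [hp]
        rw [this]; exact hC.compl
    exact (haux A hA _).inter (haux B hB _)
  · rintro _ ⟨ι, _, c, S, hc, rfl⟩
    have : {p : X × X | (c p.1, c p.2) ∈ S} = ⋃ q ∈ S, (c ⁻¹' {q.1}) ×ˢ (c ⁻¹' {q.2}) := by
      ext p
      simp only [Set.mem_ofPred_eq, Set.mem_iUnion, Set.mem_prod, Set.mem_preimage,
        Set.mem_singleton_iff, exists_prop]
      constructor
      · intro h
        exact ⟨_, h, rfl, rfl⟩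
      · rintro ⟨q, hq, h1, h2⟩
        rw [h1, h2]
        exact hq
    rw [this]
    exact MeasurableSet.biUnion (Set.toFinite S).countable fun q _ => (hc _).prod (hc _)

namespace IsProjectionFamily

variable {X : Type*} [MeasurableSpace X] {H : Type*} [NormedAddCommGroup H]
    [InnerProductSpace ℂ H] [CompleteSpace H] {P Q : Set X → H →L[ℂ] H}

theorem empty (hP : IsProjectionFamily P) : P ∅ = 0 := by
  have := hP.union ∅ ∅ MeasurableSet.empty MeasurableSet.empty (by simp)
  rwa [Set.union_self, left_eq_add] at this

theorem mul_self (hP : IsProjectionFamily P) {A : Set X} (hA : MeasurableSet A) :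
    P A * P A = P A := by
  rw [← hP.inter A A hA hA, Set.inter_self]

theorem mul_of_disjoint (hP : IsProjectionFamily P) {A B : Set X} (hA : MeasurableSet A)
    (hB : MeasurableSet B) (hAB : Disjoint A B) : P A * P B = 0 := by
  rw [← hP.inter A B hA hB, Set.disjoint_iff_inter_eq_empty.1 hAB, hP.empty]

theorem add_compl (hP : IsProjectionFamily P) {A : Set X} (hA : MeasurableSet A) :
    P A + P Aᶜ = 1 := by
  rw [← hP.union A Aᶜ hA hA.compl disjoint_compl_right, Set.union_compl_self, hP.univ]

theorem norm_union_sq (hP : IsProjectionFamily P) {A B : Set X} (hA : MeasurableSet A)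
    (hB : MeasurableSet B) (hAB : Disjoint A B) (a : H) :
    ‖P (A ∪ B) a‖ ^ 2 = ‖P A a‖ ^ 2 + ‖P B a‖ ^ 2 := by
  rw [hP.union A B hA hB hAB, add_apply, norm_add_sq_of_inner_eq_zero]
  rw [inner_apply_apply_of_star_eq (hP.star_eq A hA), hP.mul_of_disjoint hA hB hAB]
  simp

theorem sum_fiber (hP : IsProjectionFamily P) {ι : Type*} [Fintype ι] {c : X → ι}
    (hc : ∀ i, MeasurableSet (c ⁻¹' {i})) : ∑ i, P (c ⁻¹' {i}) = 1 := by
  classical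
  have key : ∀ s : Finset ι, P (c ⁻¹' s) = ∑ i ∈ s, P (c ⁻¹' {i}) := by
    intro s
    induction s using Finset.induction with
    | empty => simp [hP.empty]
    | insert i s hi ih =>
      have hs : MeasurableSet (c ⁻¹' (s : Set ι)) := by
        have : c ⁻¹' (s : Set ι) = ⋃ j ∈ s, c ⁻¹' {j} := by ext x; simp
        rw [this]
        exact Finset.measurableSet_biUnion _ fun j _ => hc j
      rw [Finset.sum_insert hi, ← ih, ← hP.union _ _ (hc i) hs, Finset.coe_insert, Set.insert_eq,
        Set.preimage_union]
      refine Set.disjoint_left.2 fun x hx hx' => hi ?_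
      have h1 : c x = i := hx
      have h2 : c x ∈ s := hx'
      exact h1 ▸ h2
  rw [← key, Finset.coe_univ, Set.preimage_univ, hP.univ]

/-- The bimeasure of a vector under a commuting pair of projection families. -/
theorem isBimeasure {μ : Measure X} [IsFiniteMeasure μ] (hP : IsProjectionFamily P)
    (hQ : IsProjectionFamily Q) (hPQ : ∀ A B, Commute (P A) (Q B)) {ξ : H}
    (hPμ : ∀ A, MeasurableSet A → ‖P A ξ‖ ^ 2 = μ.real A)
    (hQμ : ∀ A, MeasurableSet A → ‖Q A ξ‖ ^ 2 = μ.real A) :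
    IsBimeasure μ μ fun A B => ENNReal.ofReal (‖P A (Q B ξ)‖ ^ 2) := by
  refine ⟨fun A A' B hA hA' _ hd => ?_, fun A B B' _ hB hB' hd => ?_, fun A hA => ?_,
    fun B hB => ?_⟩
  · rw [hP.norm_union_sq hA hA' hd, ENNReal.ofReal_add (sq_nonneg _) (sq_nonneg _)]
  · have hcomm : ∀ B, P A (Q B ξ) = Q B (P A ξ) := fun B =>
      congrArg (fun T : H →L[ℂ] H => T ξ) (hPQ A B).eq
    simp only [hcomm]
    rw [hQ.norm_union_sq hB hB' hd, ENNReal.ofReal_add (sq_nonneg _) (sq_nonneg _)]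
  · have : P A (Q Set.univ ξ) = P A ξ := by rw [hQ.univ]; rfl
    rw [this, hPμ A hA, ofReal_measureReal]
  · have : P Set.univ (Q B ξ) = Q B ξ := by rw [hP.univ]; rfl
    rw [this, hQμ B hB, ofReal_measureReal]

/-- Adding up bounds over rectangles would not be uniform. Instead a whole finite union of cells
corresponds to one projection `∑ P (cell) Q (cell)`, which gives the uniform bound `2 ‖ξ - ζ‖`;
density of the algebra of cell unions extends it to every measurable set. -/
theorem measureClose (hP : IsProjectionFamily P) (hQ : IsProjectionFamily Q)
    (hPQ : ∀ A B, Commute (P A) (Q B)) {ξ ζ : H} (hξ : ‖ξ‖ = 1) (hζ : ‖ζ‖ = 1)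
    {ν₁ ν₂ : Measure (X × X)} [IsFiniteMeasure ν₁] [IsFiniteMeasure ν₂]
    (h₁ : ∀ A B, MeasurableSet A → MeasurableSet B →
      ν₁ (A ×ˢ B) = ENNReal.ofReal (‖P A (Q B ξ)‖ ^ 2))
    (h₂ : ∀ A B, MeasurableSet A → MeasurableSet B →
      ν₂ (A ×ˢ B) = ENNReal.ofReal (‖P A (Q B ζ)‖ ^ 2)) :
    MeasureClose (ENNReal.ofReal (2 * ‖ξ - ζ‖)) ν₁ ν₂ := by
  classical
  have hcell : ∀ E, IsCellUnion E → ν₁ E ≤ ν₂ E + ENNReal.ofReal (2 * ‖ξ - ζ‖) := by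
    rintro _ ⟨ι, _, c, S, hc, rfl⟩
    let e : ι × ι → H →L[ℂ] H := fun q => P (c ⁻¹' {q.1}) * Q (c ⁻¹' {q.2})
    have hdisj : ∀ i j, i ≠ j → Disjoint (c ⁻¹' {i}) (c ⁻¹' {j}) := fun i j hij =>
      (Set.disjoint_singleton.2 hij).preimage c
    have hstar : ∀ q, star (e q) = e q := fun q => by
      simp only [e]
      rw [star_mul, hP.star_eq _ (hc _), hQ.star_eq _ (hc _), (hPQ _ _).eq]
    have hmul : ∀ q r, q ≠ r → e q * e r = 0 := fun q r hqr => by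
      have h : e q * e r = (P (c ⁻¹' {q.1}) * P (c ⁻¹' {r.1})) *
          (Q (c ⁻¹' {q.2}) * Q (c ⁻¹' {r.2})) := by
        simp only [e]
        rw [mul_assoc, ← mul_assoc (Q _) (P _) (Q _), ← (hPQ (c ⁻¹' {r.1}) (c ⁻¹' {q.2})).eq]
        simp only [mul_assoc]
      rw [h]
      by_cases h1 : q.1 = r.1
      · have h2 : q.2 ≠ r.2 := fun h2 => hqr (Prod.ext h1 h2)
        rw [hQ.mul_of_disjoint (hc _) (hc _) (hdisj _ _ h2), mul_zero]
      · rw [hP.mul_of_disjoint (hc _) (hc _) (hdisj _ _ h1), zero_mul]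
    have hsum : ∑ q, e q = 1 := by
      rw [Fintype.sum_prod_type]
      simp only [e, ← Finset.mul_sum]
      rw [hQ.sum_fiber hc]
      simp only [mul_one]
      exact hP.sum_fiber hc
    have hν : ∀ (ν : Measure (X × X)) (a : H), (∀ A B, MeasurableSet A → MeasurableSet B →
        ν (A ×ˢ B) = ENNReal.ofReal (‖P A (Q B a)‖ ^ 2)) →
        ν {p | (c p.1, c p.2) ∈ S} = ENNReal.ofReal (∑ q ∈ S.toFinset, ‖e q a‖ ^ 2) := by
      intro ν a ha
      have hU : {p : X × X | (c p.1, c p.2) ∈ S} =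
          ⋃ q ∈ S.toFinset, (c ⁻¹' {q.1}) ×ˢ (c ⁻¹' {q.2}) := by
        ext p
        simp only [Set.mem_ofPred_eq, Set.mem_iUnion, Set.mem_prod, Set.mem_preimage,
          Set.mem_singleton_iff, exists_prop, Set.mem_toFinset]
        constructor
        · intro h
          exact ⟨_, h, rfl, rfl⟩
        · rintro ⟨q, hq, h1, h2⟩
          rw [h1, h2]
          exact hq
      rw [hU, measure_biUnion_finset (fun q _ r _ hqr => ?_) (fun q _ => (hc _).prod (hc _)),
        ENNReal.ofReal_sum_of_nonneg (fun _ _ => sq_nonneg _)]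
      · exact Finset.sum_congr rfl fun q _ => ha _ _ (hc _) (hc _)
      · refine Set.disjoint_left.2 ?_
        rintro ⟨x, y⟩ ⟨h1, h2⟩ ⟨h3, h4⟩
        simp only [Set.mem_preimage, Set.mem_singleton_iff] at h1 h2 h3 h4
        exact hqr (Prod.ext (h1.symm.trans h3) (h2.symm.trans h4))
    rw [hν ν₁ ξ h₁, hν ν₂ ζ h₂, ← ENNReal.ofReal_add (Finset.sum_nonneg fun _ _ => sq_nonneg _)
      (by positivity)]
    exact ENNReal.ofReal_le_ofReal (sum_norm_apply_sq_le hstar hmul hsum _ hξ hζ)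
  -- Density for the sum approximates `E` simultaneously for both measures.
  have hdense := Measure.MeasureDense.of_generateFrom_isSetAlgebra_finite (ν₁ + ν₂)
    (isSetAlgebra_isCellUnion X) (generateFrom_isCellUnion X)
  intro E hE
  refine ENNReal.le_of_forall_pos_le_add fun ε hε _ => ?_
  have hε2 : (0 : ℝ) < ε / 2 := by positivity
  obtain ⟨t, ht, htE⟩ := hdense.approx E hE (measure_ne_top _ _) _ hε2
  rw [Measure.add_apply] at htE
  have a1 : ν₁ E ≤ ν₁ t + ENNReal.ofReal (ε / 2) := by
    calc ν₁ E ≤ ν₁ (t ∪ symmDiff E t) := measure_mono fun x hx => by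
          by_cases hxt : x ∈ t
          · exact Or.inl hxt
          · exact Or.inr (Or.inl ⟨hx, hxt⟩)
      _ ≤ _ := (measure_union_le _ _).trans (add_le_add_right (le_self_add.trans htE.le) _)
  have a2 : ν₂ t ≤ ν₂ E + ENNReal.ofReal (ε / 2) := by
    calc ν₂ t ≤ ν₂ (E ∪ symmDiff E t) := measure_mono fun x hx => by
          by_cases hxt : x ∈ E
          · exact Or.inl hxt
          · exact Or.inr (Or.inr ⟨hx, hxt⟩)
      _ ≤ _ := (measure_union_le _ _).trans (add_le_add_right (le_add_self.trans htE.le) _)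
  have hεε : (ε : ℝ≥0∞) = ENNReal.ofReal (ε / 2) + ENNReal.ofReal (ε / 2) := by
    rw [← ENNReal.ofReal_add hε2.le hε2.le, add_halves, ENNReal.ofReal_coe_nnreal]
  calc ν₁ E ≤ ν₁ t + ENNReal.ofReal (ε / 2) := a1
    _ ≤ ν₂ t + ENNReal.ofReal (2 * ‖ξ - ζ‖) + ENNReal.ofReal (ε / 2) := by
        gcongr; exact hcell t ht
    _ ≤ ν₂ E + ENNReal.ofReal (ε / 2) + ENNReal.ofReal (2 * ‖ξ - ζ‖) + ENNReal.ofReal (ε / 2) := by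
        gcongr
    _ = _ := by rw [hεε]; ring

end IsProjectionFamily

end

noncomputable section

/-! ### The projection onto the central vectors -/

/-- The hypothesis is what decreasing projections applied to one vector satisfy. By Pythagoras `‖v m
- v n‖²` is a difference of terms of a convergent decreasing sequence, so `v` is Cauchy. -/
theorem exists_tendsto_of_inner_eq {H : Type*} [NormedAddCommGroup H] [InnerProductSpace ℂ H]
    [CompleteSpace H] {v : ℕ → H} {r : ℝ} (hv : ∀ m n, m ≤ n → inner ℂ (v m - v n) (v n) = 0)
    (hr : Tendsto (fun n => ‖v n‖ ^ 2) atTop (𝓝 r)) :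
    ∃ η, Tendsto v atTop (𝓝 η) ∧ ‖η - v 0‖ ^ 2 = ‖v 0‖ ^ 2 - r := by
  have hsq : ∀ m n, m ≤ n → ‖v m - v n‖ ^ 2 = ‖v m‖ ^ 2 - ‖v n‖ ^ 2 := fun m n hmn => by
    have := norm_add_sq_of_inner_eq_zero (hv m n hmn)
    rw [sub_add_cancel] at this
    linarith
  have hanti : Antitone fun n => ‖v n‖ ^ 2 := fun m n hmn => by
    have := hsq m n hmn
    have := sq_nonneg ‖v m - v n‖
    dsimp only
    linarith
  have hc : CauchySeq v := by
    refine Metric.cauchySeq_iff'.2 fun ε hε => ?_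
    obtain ⟨N, hN⟩ := (hr.eventually_lt_const (lt_add_of_pos_right r (pow_pos hε 2))).exists
    refine ⟨N, fun n hn => ?_⟩
    rw [dist_comm, dist_eq_norm]
    refine lt_of_pow_lt_pow_left₀ 2 hε.le ?_
    have h1 := hsq N n hn
    have h2 := hanti.le_of_tendsto hr n
    linarith
  obtain ⟨η, hη⟩ := cauchySeq_tendsto_of_complete hc
  refine ⟨η, hη, ?_⟩
  refine tendsto_nhds_unique (f := fun n => ‖v n - v 0‖ ^ 2) (l := atTop)
    ((hη.sub_const _).norm.pow 2) ?_
  refine (hr.const_sub (‖v 0‖ ^ 2)).congr fun n => ?_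
  rw [norm_sub_rev, hsq 0 n (Nat.zero_le n)]

namespace IsProjectionFamily

variable {X : Type*} [MeasurableSpace X] {H : Type*} [NormedAddCommGroup H]
    [InnerProductSpace ℂ H] [CompleteSpace H] {P Q : Set X → H →L[ℂ] H}

/-- `P A - Q A = P A * Q Aᶜ - P Aᶜ * Q A`, and the two terms have orthogonal ranges. This converts
the commutator of `1_A` with a vector into the mass of `A ×ˢ Aᶜ` and `Aᶜ ×ˢ A`. -/
theorem norm_sub_apply_sq (hP : IsProjectionFamily P) (hQ : IsProjectionFamily Q)
    {A : Set X} (hA : MeasurableSet A) (a : H) :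
    ‖P A a - Q A a‖ ^ 2 = ‖P A (Q Aᶜ a)‖ ^ 2 + ‖P Aᶜ (Q A a)‖ ^ 2 := by
  rw [← norm_sub_sq_of_inner_eq_zero]
  · congr 2
    have h1 : P A a = P A (Q A a) + P A (Q Aᶜ a) := by
      rw [← map_add, ← add_apply, hQ.add_compl hA]; rfl
    have h2 : Q A a = P A (Q A a) + P Aᶜ (Q A a) := by
      rw [← add_apply (P A), hP.add_compl hA]; rfl
    rw [h1]
    conv_lhs => rw [h2]
    have h3 : P A (P A (Q A a) + P Aᶜ (Q A a)) = P A (Q A a) := by rw [← h2]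
    rw [h3]
    abel
  · rw [inner_apply_apply_of_star_eq (hP.star_eq A hA),
      hP.mul_of_disjoint hA hA.compl disjoint_compl_right]
    simp

/-- `P U Q U + P Uᶜ Q Uᶜ`. -/
def diagProj (P Q : Set X → H →L[ℂ] H) (U : Set X) : H →L[ℂ] H := P U * Q U + P Uᶜ * Q Uᶜ

/-- The product of the projections `diagProj P Q (U k)`, `k < n`. -/
def diagProjSeq (P Q : Set X → H →L[ℂ] H) (U : ℕ → Set X) : ℕ → H →L[ℂ] H
  | 0 => 1
  | n + 1 => diagProj P Q (U n) * diagProjSeq P Q U n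

theorem commute_of_inter (hP : IsProjectionFamily P) {A B : Set X} (hA : MeasurableSet A)
    (hB : MeasurableSet B) : Commute (P A) (P B) := by
  show P A * P B = P B * P A
  rw [← hP.inter A B hA hB, ← hP.inter B A hB hA, Set.inter_comm]

theorem commute_diagProj (hP : IsProjectionFamily P) (hPQ : ∀ A B, Commute (P A) (Q B))
    {A U : Set X} (hA : MeasurableSet A) (hU : MeasurableSet U) :
    Commute (P A) (diagProj P Q U) :=
  ((hP.commute_of_inter hA hU).mul_right (hPQ _ _)).add_right
    ((hP.commute_of_inter hA hU.compl).mul_right (hPQ _ _))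

theorem commute_diagProj' (hQ : IsProjectionFamily Q) (hPQ : ∀ A B, Commute (P A) (Q B))
    {B U : Set X} (hB : MeasurableSet B) (hU : MeasurableSet U) :
    Commute (Q B) (diagProj P Q U) :=
  ((hPQ _ _).symm.mul_right (hQ.commute_of_inter hB hU)).add_right
    ((hPQ _ _).symm.mul_right (hQ.commute_of_inter hB hU.compl))

theorem commute_diagProj_diagProj (hP : IsProjectionFamily P) (hQ : IsProjectionFamily Q)
    (hPQ : ∀ A B, Commute (P A) (Q B)) {U V : Set X} (hU : MeasurableSet U)
    (hV : MeasurableSet V) : Commute (diagProj P Q U) (diagProj P Q V) :=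
  ((hP.commute_diagProj hPQ hU hV).mul_left (hQ.commute_diagProj' hPQ hU hV)).add_left
    ((hP.commute_diagProj hPQ hU.compl hV).mul_left (hQ.commute_diagProj' hPQ hU.compl hV))

theorem star_diagProj (hP : IsProjectionFamily P) (hQ : IsProjectionFamily Q)
    (hPQ : ∀ A B, Commute (P A) (Q B)) {U : Set X} (hU : MeasurableSet U) :
    star (diagProj P Q U) = diagProj P Q U := by
  simp only [diagProj, star_add, star_mul]
  rw [hP.star_eq _ hU, hP.star_eq _ hU.compl, hQ.star_eq _ hU, hQ.star_eq _ hU.compl,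
    (hPQ _ _).eq, (hPQ _ _).eq]

theorem diagProj_mul_self (hP : IsProjectionFamily P) (hQ : IsProjectionFamily Q)
    (hPQ : ∀ A B, Commute (P A) (Q B)) {U : Set X} (hU : MeasurableSet U) :
    diagProj P Q U * diagProj P Q U = diagProj P Q U := by
  have h : ∀ A B : Set X, (P A * Q A) * (P B * Q B) = (P A * P B) * (Q A * Q B) := fun A B => by
    rw [mul_assoc, ← mul_assoc (Q _) (P _) (Q _), ← (hPQ _ _).eq]
    simp only [mul_assoc]
  simp only [diagProj, mul_add, add_mul, h]
  rw [hP.mul_self hU, hP.mul_self hU.compl, hQ.mul_self hU, hQ.mul_self hU.compl,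
    hP.mul_of_disjoint hU hU.compl disjoint_compl_right,
    hP.mul_of_disjoint hU.compl hU disjoint_compl_left]
  simp

section Seq

variable {U : ℕ → Set X}

theorem commute_diagProj_diagProjSeq (hP : IsProjectionFamily P) (hQ : IsProjectionFamily Q)
    (hPQ : ∀ A B, Commute (P A) (Q B)) (hU : ∀ n, MeasurableSet (U n)) {V : Set X}
    (hV : MeasurableSet V) (n : ℕ) : Commute (diagProj P Q V) (diagProjSeq P Q U n) := by
  induction n with
  | zero => exact Commute.one_right _
  | succ n ih => exact (commute_diagProj_diagProj hP hQ hPQ hV (hU n)).mul_right ih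

theorem star_diagProjSeq (hP : IsProjectionFamily P) (hQ : IsProjectionFamily Q)
    (hPQ : ∀ A B, Commute (P A) (Q B)) (hU : ∀ n, MeasurableSet (U n)) (n : ℕ) :
    star (diagProjSeq P Q U n) = diagProjSeq P Q U n := by
  induction n with
  | zero => exact star_one _
  | succ n ih =>
    rw [diagProjSeq, star_mul, ih, star_diagProj hP hQ hPQ (hU n)]
    exact (commute_diagProj_diagProjSeq hP hQ hPQ hU (hU n) n).eq.symm

theorem diagProjSeq_mul_of_le (hP : IsProjectionFamily P) (hQ : IsProjectionFamily Q)
    (hPQ : ∀ A B, Commute (P A) (Q B)) (hU : ∀ n, MeasurableSet (U n)) {m n : ℕ} (hmn : m ≤ n) :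
    diagProjSeq P Q U m * diagProjSeq P Q U n = diagProjSeq P Q U n := by
  induction n, hmn using Nat.le_induction with
  | base =>
    induction m with
    | zero => exact one_mul _
    | succ m ih =>
      have hc := (commute_diagProj_diagProjSeq hP hQ hPQ hU (hU m) m).eq
      rw [diagProjSeq]
      calc _ = diagProj P Q (U m) * (diagProjSeq P Q U m * diagProj P Q (U m)) *
            diagProjSeq P Q U m := by simp only [mul_assoc]
        _ = (diagProj P Q (U m) * diagProj P Q (U m)) *
            (diagProjSeq P Q U m * diagProjSeq P Q U m) := by rw [← hc]; simp only [mul_assoc]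
        _ = _ := by rw [ih, diagProj_mul_self hP hQ hPQ (hU m)]
  | succ n hmn ih =>
    rw [diagProjSeq, ← mul_assoc, ← (commute_diagProj_diagProjSeq hP hQ hPQ hU (hU n) m).eq,
      mul_assoc, ih]

/-- The pairs which are not separated by `U 0, …, U (n - 1)`. -/
def diagNhd (U : ℕ → Set X) (n : ℕ) : Set (X × X) := {p | ∀ k < n, p.1 ∈ U k ↔ p.2 ∈ U k}

theorem measurableSet_diagNhd (hU : ∀ n, MeasurableSet (U n)) (n : ℕ) :
    MeasurableSet (diagNhd U n) := by
  have : diagNhd U n = ⋂ k, ⋂ (_ : k < n), (U k ×ˢ U k ∪ (U k)ᶜ ×ˢ (U k)ᶜ) := by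
    ext p
    simp only [diagNhd, Set.mem_ofPred_eq, Set.mem_iInter, Set.mem_union, Set.mem_prod,
      Set.mem_compl_iff]
    refine forall₂_congr fun k _ => ?_
    tauto
  rw [this]
  exact MeasurableSet.iInter fun k => MeasurableSet.iInter fun _ =>
    ((hU k).prod (hU k)).union ((hU k).compl.prod (hU k).compl)

/-- Applying `diagProjSeq` to the vector restricts its measure to `diagNhd U n`. Each further factor
splits a rectangle along `U n` and its complement, with orthogonal contributions. -/
theorem norm_diagProjSeq_sq (hP : IsProjectionFamily P) (hQ : IsProjectionFamily Q)
    (hPQ : ∀ A B, Commute (P A) (Q B)) (hU : ∀ n, MeasurableSet (U n)) {ξ : H}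
    {ν : Measure (X × X)} [IsFiniteMeasure ν]
    (hν : ∀ A B, MeasurableSet A → MeasurableSet B → ‖P A (Q B ξ)‖ ^ 2 = ν.real (A ×ˢ B)) (n : ℕ) :
    ∀ A B, MeasurableSet A → MeasurableSet B →
      ‖P A (Q B (diagProjSeq P Q U n ξ))‖ ^ 2 = ν.real (A ×ˢ B ∩ diagNhd U n) := by
  induction n with
  | zero =>
    intro A B hA hB
    have : diagNhd U 0 = Set.univ := by ext; simp [diagNhd]
    rw [this, Set.inter_univ, ← hν A B hA hB]
    rfl
  | succ n ih =>
    intro A B hA hB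
    set a := diagProjSeq P Q U n ξ with ha
    have hUn := hU n
    have h1 : ∀ V, MeasurableSet V → (P A * Q B) * (P V * Q V) = P (A ∩ V) * Q (B ∩ V) := by
      intro V hV
      rw [hP.inter A V hA hV, hQ.inter B V hB hV, mul_assoc, ← mul_assoc (Q _) (P _) (Q _),
        ← (hPQ _ _).eq]
      simp only [mul_assoc]
    have h2 : P A (Q B (diagProjSeq P Q U (n + 1) ξ)) =
        P (A ∩ U n) (Q (B ∩ U n) a) + P (A ∩ (U n)ᶜ) (Q (B ∩ (U n)ᶜ) a) := by
      have : (P A * Q B) * diagProj P Q (U n) =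
          P (A ∩ U n) * Q (B ∩ U n) + P (A ∩ (U n)ᶜ) * Q (B ∩ (U n)ᶜ) := by
        rw [diagProj, mul_add, h1 _ hUn, h1 _ hUn.compl]
      exact congrArg (fun T : H →L[ℂ] H => T a) this
    rw [h2, norm_add_sq_of_inner_eq_zero]
    · rw [ih _ _ (hA.inter hUn) (hB.inter hUn), ih _ _ (hA.inter hUn.compl) (hB.inter hUn.compl),
        ← measureReal_union]
      · congr 1
        ext p
        simp only [diagNhd, Set.mem_union, Set.mem_inter_iff, Set.mem_prod, Set.mem_ofPred_eq,
          Set.mem_compl_iff, Nat.lt_succ_iff_lt_or_eq, or_imp, forall_and, forall_eq]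
        tauto
      · refine Set.disjoint_left.2 ?_
        rintro p ⟨⟨⟨_, h3⟩, _⟩, _⟩ ⟨⟨⟨_, h4⟩, _⟩, _⟩
        exact h4 h3
      · exact ((hA.inter hUn.compl).prod (hB.inter hUn.compl)).inter (measurableSet_diagNhd hU n)
    · rw [inner_apply_apply_of_star_eq (hP.star_eq _ (hA.inter hUn)),
        hP.mul_of_disjoint (hA.inter hUn) (hA.inter hUn.compl)
          (disjoint_compl_right.mono Set.inter_subset_right Set.inter_subset_right)]
      simp

/-- As `U` separates points, `diagNhd U n` decreases to the diagonal. The restricted vectors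
converge, their squared norms tend to `ν(Δ)`, and the part of `ν` on `A ×ˢ Aᶜ` and `Aᶜ ×ˢ A` that
obstructs `P A η = Q A η` vanishes in the limit. -/
theorem exists_central (hP : IsProjectionFamily P) (hQ : IsProjectionFamily Q)
    (hPQ : ∀ A B, Commute (P A) (Q B)) (hU : ∀ n, MeasurableSet (U n))
    (hsep : ∀ x y, (∀ n, x ∈ U n ↔ y ∈ U n) → x = y) {ξ : H}
    {ν : Measure (X × X)} [IsFiniteMeasure ν]
    (hν : ∀ A B, MeasurableSet A → MeasurableSet B → ‖P A (Q B ξ)‖ ^ 2 = ν.real (A ×ˢ B)) :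
    ∃ η, (∀ A, MeasurableSet A → P A η = Q A η) ∧
      ‖η - ξ‖ ^ 2 = ‖ξ‖ ^ 2 - ν.real (Set.diagonal X) := by
  have hlim : ∀ C : Set (X × X), MeasurableSet C → Tendsto (fun n => ν.real (C ∩ diagNhd U n)) atTop
      (𝓝 (ν.real (C ∩ Set.diagonal X))) := by
    intro C hC
    have hanti : Antitone fun n => C ∩ diagNhd U n := fun m n hmn =>
      Set.inter_subset_inter_right _ fun p hp k hk => hp k (hk.trans_le hmn)
    have := tendsto_measure_iInter_atTop (μ := ν)
      (fun n => (hC.inter (measurableSet_diagNhd hU n)).nullMeasurableSet) hanti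
      ⟨0, measure_ne_top _ _⟩
    have he : ⋂ n, C ∩ diagNhd U n = C ∩ Set.diagonal X := by
      rw [← Set.inter_iInter]
      congr 1
      ext p
      simp only [Set.mem_iInter, diagNhd, Set.mem_ofPred_eq, Set.mem_diagonal_iff]
      exact ⟨fun h => hsep _ _ fun n => h (n + 1) n (Nat.lt_succ_self n), fun h n k _ => by rw [h]⟩
    rw [he] at this
    exact (ENNReal.tendsto_toReal (measure_ne_top _ _)).comp this
  set v : ℕ → H := fun n => diagProjSeq P Q U n ξ with hvdef
  have hv0 : v 0 = ξ := rfl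
  have hsq : ∀ n A B, MeasurableSet A → MeasurableSet B →
      ‖P A (Q B (v n))‖ ^ 2 = ν.real (A ×ˢ B ∩ diagNhd U n) := fun n =>
    norm_diagProjSeq_sq hP hQ hPQ hU hν n
  have hr : Tendsto (fun n => ‖v n‖ ^ 2) atTop (𝓝 (ν.real (Set.diagonal X))) := by
    have := hlim Set.univ MeasurableSet.univ
    rw [Set.univ_inter] at this
    refine this.congr fun n => ?_
    have h1 := hsq n Set.univ Set.univ MeasurableSet.univ MeasurableSet.univ
    rw [hP.univ, hQ.univ, Set.univ_prod_univ] at h1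
    exact h1.symm
  obtain ⟨η, hη, hη'⟩ := exists_tendsto_of_inner_eq (v := v) (fun m n hmn => by
    rw [inner_sub_left, inner_apply_apply_of_star_eq (star_diagProjSeq hP hQ hPQ hU m),
      inner_apply_apply_of_star_eq (star_diagProjSeq hP hQ hPQ hU n),
      diagProjSeq_mul_of_le hP hQ hPQ hU hmn, diagProjSeq_mul_of_le hP hQ hPQ hU le_rfl, sub_self])
    hr
  rw [hv0] at hη'
  refine ⟨η, fun A hA => ?_, hη'⟩
  have h1 : Tendsto (fun n => ‖P A (v n) - Q A (v n)‖ ^ 2) atTop (𝓝 (‖P A η - Q A η‖ ^ 2)) :=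
    ((((P A).continuous.tendsto η).comp hη).sub (((Q A).continuous.tendsto η).comp hη)).norm.pow 2
  have h2 : Tendsto (fun n => ‖P A (v n) - Q A (v n)‖ ^ 2) atTop (𝓝 0) := by
    have h3 := (hlim _ (hA.prod hA.compl)).add (hlim _ (hA.compl.prod hA))
    have e1 : A ×ˢ Aᶜ ∩ Set.diagonal X = ∅ := by
      ext ⟨x, y⟩
      simp only [Set.mem_inter_iff, Set.mem_prod, Set.mem_compl_iff, Set.mem_diagonal_iff,
        Set.mem_empty_iff_false, iff_false]
      rintro ⟨⟨hx, hy⟩, rfl⟩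
      exact hy hx
    have e2 : Aᶜ ×ˢ A ∩ Set.diagonal X = ∅ := by
      ext ⟨x, y⟩
      simp only [Set.mem_inter_iff, Set.mem_prod, Set.mem_compl_iff, Set.mem_diagonal_iff,
        Set.mem_empty_iff_false, iff_false]
      rintro ⟨⟨hx, hy⟩, rfl⟩
      exact hx hy
    rw [e1, e2, measureReal_empty, add_zero] at h3
    refine h3.congr fun n => ?_
    rw [norm_sub_apply_sq hP hQ hA, hsq n _ _ hA hA.compl, hsq n _ _ hA.compl hA]
  have h4 := tendsto_nhds_unique h1 h2
  rw [sq_eq_zero_iff, norm_eq_zero, sub_eq_zero] at h4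
  exact h4

end Seq

end IsProjectionFamily

end

noncomputable section

/-! ### Symmetrization -/

/-- Remove the diagonal and average with the flip. Almost invariance survives because `γ k × γ k`
commutes with the flip and, `γ k` being injective, preserves the complement of the diagonal. -/
theorem IsAlmostInvariant.of_measure {X : Type*} [MeasurableSpace X] [MeasurableEq X]
    {μ : Measure X} {S : ℕ → Set X} {γ : ℕ → X ≃ᵐ X} {N : ℕ} {ν : Measure (X × X)}
    [IsProbabilityMeasure ν] (h1 : ν.map Prod.fst = μ) (h2 : ν.map Prod.snd = μ)
    (hS : ∀ k, MeasurableSet (S k))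
    (hnear : ∀ k ≤ N, ν (S k ×ˢ (S k)ᶜ) ≤ tol N) (hnear' : ∀ k ≤ N, ν ((S k)ᶜ ×ˢ S k) ≤ tol N)
    (hclose : ∀ k ≤ N, MeasureClose (tol N) (ν.map (Prod.map (γ k) (γ k))) ν) :
    ∃ ρ, IsAlmostInvariant μ S γ N ρ ∧ ρ.real Set.univ = 1 - ν.real (Set.diagonal X) := by
  set ν' := ν.restrict (Set.diagonal X)ᶜ with hν'
  have hdm : MeasurableSet (Set.diagonal X) := measurableSet_diagonal
  have hle : ν' ≤ ν := Measure.restrict_le_self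
  have hhalf : ∀ m : Measure X, (2 : ℝ≥0∞)⁻¹ • (m + m) = m := fun m => by
    rw [← two_smul ℝ≥0∞ m, smul_smul, ENNReal.inv_mul_cancel (by simp) (by simp), one_smul]
  have hhalf' : ∀ c : ℝ≥0∞, (2 : ℝ≥0∞)⁻¹ * (c + c) = c := fun c => by
    rw [← two_mul, ← mul_assoc, ENNReal.inv_mul_cancel (by simp) (by simp), one_mul]
  have happ : ∀ E, MeasurableSet E → ((2 : ℝ≥0∞)⁻¹ • (ν' + ν'.map Prod.swap)) E =
      2⁻¹ * (ν' E + ν' (Prod.swap ⁻¹' E)) := fun E hE => by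
    rw [Measure.smul_apply, Measure.add_apply, Measure.map_apply measurable_swap hE, smul_eq_mul]
  refine ⟨(2 : ℝ≥0∞)⁻¹ • (ν' + ν'.map Prod.swap), ⟨?_, ?_, ?_, fun k hk => ?_, fun k hk => ?_⟩, ?_⟩
  · rw [Measure.map_smul, Measure.map_add _ _ measurable_swap,
      Measure.map_map measurable_swap measurable_swap, Prod.swap_swap_eq, Measure.map_id, add_comm]
  · have h0 : ν' (Set.diagonal X) = 0 := by
      rw [hν', Measure.restrict_apply hdm, Set.inter_compl_self, measure_empty]
    have hsw : Prod.swap ⁻¹' Set.diagonal X = Set.diagonal X := by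
      ext p; simp [eq_comm]
    rw [happ _ hdm, hsw, h0, add_zero, mul_zero]
  · have e1 : (ν'.map Prod.swap).map Prod.fst = ν'.map Prod.snd := by
      rw [Measure.map_map measurable_fst measurable_swap]; rfl
    rw [Measure.map_smul, Measure.map_add _ _ measurable_fst, e1]
    conv_rhs => rw [← hhalf μ]
    have hsum : ν'.map Prod.fst + ν'.map Prod.snd ≤ μ + μ :=
      add_le_add (h1 ▸ Measure.map_mono hle measurable_fst)
        (h2 ▸ Measure.map_mono hle measurable_snd)
    intro E
    rw [Measure.smul_apply, Measure.smul_apply]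
    exact mul_le_mul_right (hsum E) _
  · have hsw : Prod.swap ⁻¹' (S k ×ˢ (S k)ᶜ) = (S k)ᶜ ×ˢ S k := Set.preimage_swap_prod _ _
    rw [happ _ ((hS k).prod (hS k).compl), hsw]
    calc _ ≤ 2⁻¹ * (tol N + tol N) := mul_le_mul_right
          (add_le_add ((hle _).trans (hnear k hk)) ((hle _).trans (hnear' k hk))) _
      _ = tol N := hhalf' _
  · intro E hE
    have hT : Measurable (Prod.map (γ k) (γ k)) := (γ k).measurable.prodMap (γ k).measurable
    have key : ∀ E, MeasurableSet E → ν' (Prod.map (γ k) (γ k) ⁻¹' E) ≤ ν' E + tol N := by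
      intro E hE
      have hEm : MeasurableSet (E ∩ (Set.diagonal X)ᶜ) := hE.inter hdm.compl
      rw [hν', Measure.restrict_apply (hT hE), Measure.restrict_apply hE]
      have hpre : Prod.map (γ k) (γ k) ⁻¹' E ∩ (Set.diagonal X)ᶜ =
          Prod.map (γ k) (γ k) ⁻¹' (E ∩ (Set.diagonal X)ᶜ) := by
        ext p
        simp only [Set.mem_inter_iff, Set.mem_preimage, Set.mem_compl_iff, Set.mem_diagonal_iff,
          Prod.map_fst, Prod.map_snd, (γ k).injective.eq_iff]
      rw [hpre, ← Measure.map_apply hT hEm]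
      exact hclose k hk _ hEm
    rw [Measure.map_apply hT hE, happ _ (hT hE), happ _ hE]
    have hcomm : Prod.swap ⁻¹' (Prod.map (γ k) (γ k) ⁻¹' E) =
        Prod.map (γ k) (γ k) ⁻¹' (Prod.swap ⁻¹' E) := rfl
    rw [hcomm]
    calc _ ≤ 2⁻¹ * ((ν' E + tol N) + (ν' (Prod.swap ⁻¹' E) + tol N)) :=
          mul_le_mul_right (add_le_add (key E hE) (key _ (measurable_swap hE))) _
      _ = 2⁻¹ * (ν' E + ν' (Prod.swap ⁻¹' E)) + 2⁻¹ * (tol N + tol N) := by ring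
      _ = _ := by rw [hhalf']
  · rw [Measure.real, happ _ MeasurableSet.univ, Set.preimage_univ, hhalf', hν',
      Measure.restrict_apply MeasurableSet.univ, Set.univ_inter]
    exact probReal_compl_eq_one_sub hdm

/-! ### Multiplication operators and unitaries -/

theorem isBddBorel_indicator {X : Type*} [MeasurableSpace X] {A : Set X} (hA : MeasurableSet A)
    (c : ℂ) : IsBddBorel (A.indicator fun _ => c) :=
  ⟨measurable_const.indicator hA, ‖c‖, fun x => by
    by_cases hx : x ∈ A <;> simp [hx]⟩

theorem IsBddBorel.add {X : Type*} [MeasurableSpace X] {f g : X → ℂ} (hf : IsBddBorel f)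
    (hg : IsBddBorel g) : IsBddBorel fun x => f x + g x := by
  obtain ⟨hfm, C, hC⟩ := hf
  obtain ⟨hgm, D, hD⟩ := hg
  exact ⟨hfm.add hgm, C + D, fun x => (norm_add_le _ _).trans (add_le_add (hC x) (hD x))⟩

theorem IsBddBorel.mul {X : Type*} [MeasurableSpace X] {f g : X → ℂ} (hf : IsBddBorel f)
    (hg : IsBddBorel g) : IsBddBorel fun x => f x * g x := by
  obtain ⟨hfm, C, hC⟩ := hf
  obtain ⟨hgm, D, hD⟩ := hg
  refine ⟨hfm.mul hgm, C * D, fun x => ?_⟩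
  rw [norm_mul]
  exact mul_le_mul (hC x) (hD x) (norm_nonneg _) ((norm_nonneg _).trans (hC x))

theorem IsBddBorel.star {X : Type*} [MeasurableSpace X] {f : X → ℂ} (hf : IsBddBorel f) :
    IsBddBorel fun x => star (f x) :=
  ⟨continuous_star.measurable.comp hf.1, hf.2.choose, fun x => by
    rw [norm_star]; exact hf.2.choose_spec x⟩

namespace CountablePMPEquivRel

variable {X : Type u} [MeasurableSpace X] {μ : Measure X} (R : CountablePMPEquivRel X μ)

variable [StandardBorelSpace X]

theorem mulOp_mul {f g : X → ℂ} (hf : IsBddBorel f) (hg : IsBddBorel g) :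
    R.mulOp f hf * R.mulOp g hg = R.mulOp (fun x => f x * g x) (hf.mul hg) := by
  refine (R.mulOp_eq_iff _ _ _).2 fun k => ?_
  filter_upwards [R.mulOp_ae f hf (R.mulOp g hg k), R.mulOp_ae g hg k] with p h1 h2
  rw [mul_apply_eq_comp, h1, h2, mul_assoc]

theorem mulOp_add {f g : X → ℂ} (hf : IsBddBorel f) (hg : IsBddBorel g) :
    R.mulOp f hf + R.mulOp g hg = R.mulOp (fun x => f x + g x) (hf.add hg) := by
  refine (R.mulOp_eq_iff _ _ _).2 fun k => ?_
  filter_upwards [R.mulOp_ae f hf k, R.mulOp_ae g hg k,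
    Lp.coeFn_add (R.mulOp f hf k) (R.mulOp g hg k)] with p h1 h2 h3
  rw [add_apply, h3, Pi.add_apply, h1, h2, add_mul]

theorem mulOp_const (c : ℂ) (hc : IsBddBorel fun _ : X => c) :
    R.mulOp (fun _ => c) hc = c • 1 := by
  symm
  refine (R.mulOp_eq_iff _ hc _).2 fun k => ?_
  rw [smul_apply, one_apply_eq_self]
  filter_upwards [Lp.coeFn_smul c k] with p hp
  rw [hp, Pi.smul_apply, smul_eq_mul]

theorem star_mulOp {f : X → ℂ} (hf : IsBddBorel f) :
    star (R.mulOp f hf) = R.mulOp (fun x => star (f x)) hf.star := by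
  rw [ContinuousLinearMap.star_eq_adjoint]
  symm
  rw [ContinuousLinearMap.eq_adjoint_iff]
  intro g k
  rw [L2.inner_def, L2.inner_def]
  refine integral_congr_ae ?_
  filter_upwards [R.mulOp_ae f hf k, R.mulOp_ae _ hf.star g] with p h1 h2
  rw [h1, h2]
  simp only [RCLike.inner_apply, map_mul, RCLike.star_def, Complex.conj_conj]
  ring

/-- The multiplication operator by `f`, as an element of `L(R)`. -/
def cartanElt (f : X → ℂ) (hf : IsBddBorel f) : R.vonNeumann.toStarSubalgebra :=
  ⟨R.mulOp f hf, R.cartan_le ⟨f, hf, rfl⟩⟩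

theorem cartanElt_congr {f g : X → ℂ} (h : f = g) (hf : IsBddBorel f) (hg : IsBddBorel g) :
    R.cartanElt f hf = R.cartanElt g hg := by
  subst h; rfl

theorem cartanElt_mul {f g : X → ℂ} (hf : IsBddBorel f) (hg : IsBddBorel g) :
    R.cartanElt f hf * R.cartanElt g hg = R.cartanElt (fun x => f x * g x) (hf.mul hg) :=
  Subtype.ext (R.mulOp_mul hf hg)

theorem cartanElt_add {f g : X → ℂ} (hf : IsBddBorel f) (hg : IsBddBorel g) :
    R.cartanElt f hf + R.cartanElt g hg = R.cartanElt (fun x => f x + g x) (hf.add hg) :=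
  Subtype.ext (R.mulOp_add hf hg)

theorem cartanElt_const (c : ℂ) (hc : IsBddBorel fun _ : X => c) :
    R.cartanElt (fun _ => c) hc = c • 1 :=
  Subtype.ext (R.mulOp_const c hc)

theorem star_cartanElt {f : X → ℂ} (hf : IsBddBorel f) :
    star (R.cartanElt f hf) = R.cartanElt (fun x => star (f x)) hf.star :=
  Subtype.ext (R.star_mulOp hf)

/-- The projection `L_{1_A}`. -/
def indElt {A : Set X} (hA : MeasurableSet A) : R.vonNeumann.toStarSubalgebra :=
  R.cartanElt (A.indicator fun _ => 1) (isBddBorel_indicator hA 1)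

theorem star_indElt {A : Set X} (hA : MeasurableSet A) : star (R.indElt hA) = R.indElt hA := by
  rw [indElt, star_cartanElt]
  refine R.cartanElt_congr ?_ _ _
  ext x
  by_cases hx : x ∈ A <;> simp [hx]

theorem indElt_inter {A B : Set X} (hA : MeasurableSet A) (hB : MeasurableSet B) :
    R.indElt (hA.inter hB) = R.indElt hA * R.indElt hB := by
  rw [indElt, indElt, indElt, cartanElt_mul]
  refine R.cartanElt_congr ?_ _ _
  ext x
  by_cases hx : x ∈ A <;> by_cases hy : x ∈ B <;> simp [hx, hy]

theorem indElt_union {A B : Set X} (hA : MeasurableSet A) (hB : MeasurableSet B)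
    (hAB : Disjoint A B) : R.indElt (hA.union hB) = R.indElt hA + R.indElt hB := by
  rw [indElt, indElt, indElt, cartanElt_add]
  refine R.cartanElt_congr ?_ _ _
  exact Set.indicator_union_of_disjoint hAB _

theorem indElt_univ : R.indElt (MeasurableSet.univ : MeasurableSet (Set.univ : Set X)) = 1 := by
  rw [indElt, ← one_smul ℂ (1 : R.vonNeumann.toStarSubalgebra),
    ← R.cartanElt_const 1 ⟨measurable_const, 1, fun _ => by simp⟩]
  exact R.cartanElt_congr (Set.indicator_univ _) _ _

/-- On the diagonal every fibre of the relation measure is a single point. This identity is what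
makes the measure of a tracial vector have marginals `μ`. -/
theorem trace_indElt [IsFiniteMeasure μ] {A : Set X} (hA : MeasurableSet A) :
    R.trace (R.indElt hA) = μ.real A := by
  have hm : MeasurableSet (Set.diagonal X ∩ Prod.fst ⁻¹' A) :=
    measurableSet_diagonal.inter (measurable_fst hA)
  have hrel : R.relMeasure (Set.diagonal X ∩ Prod.fst ⁻¹' A) = μ A := by
    rw [R.relMeasure_apply hm, ← lintegral_indicator_one hA]
    refine lintegral_congr fun x => ?_
    by_cases hx : x ∈ A
    · have : {y | (x, y) ∈ Set.diagonal X ∩ Prod.fst ⁻¹' A ∧ R.rel x y} = {x} := by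
        ext y
        simp only [Set.mem_inter_iff, Set.mem_diagonal_iff, Set.mem_preimage, Set.mem_ofPred_eq,
          Set.mem_singleton_iff]
        exact ⟨fun h => h.1.1.symm, fun h => ⟨⟨h.symm, hx⟩, h ▸ R.rel.refl _⟩⟩
      rw [this]
      simp [hx]
    · have : {y | (x, y) ∈ Set.diagonal X ∩ Prod.fst ⁻¹' A ∧ R.rel x y} = ∅ := by
        ext y
        simp [hx]
      rw [this]
      simp [hx]
  show inner ℂ R.diagVector (R.mulOp _ (isBddBorel_indicator hA 1) R.diagVector) = _
  conv_lhs => enter [2]; rw [diagVector]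
  rw [L2.inner_indicatorConstLp_one, ← integral_indicator measurableSet_diagonal]
  have : (Set.diagonal X).indicator (fun p => (R.mulOp _ (isBddBorel_indicator hA 1)
      R.diagVector : X × X → ℂ) p) =ᵐ[R.relMeasure]
      (Set.diagonal X ∩ Prod.fst ⁻¹' A).indicator (fun _ => (1 : ℂ)) := by
    filter_upwards [R.mulOp_ae _ (isBddBorel_indicator hA 1) R.diagVector,
      indicatorConstLp_coeFn (p := 2) (s := Set.diagonal X) (hs := measurableSet_diagonal)
        (hμs := by rw [R.relMeasure_diagonal]; exact measure_ne_top μ _) (c := (1 : ℂ))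
        (μ := R.relMeasure)] with p h1 h2
    by_cases hp : p ∈ Set.diagonal X
    · rw [Set.indicator_of_mem hp, h1]
      show _ * (R.diagVector : X × X → ℂ) p = _
      rw [diagVector, h2, Set.indicator_of_mem hp]
      by_cases hpA : p.1 ∈ A
      · rw [Set.indicator_of_mem hpA, Set.indicator_of_mem (show p ∈ Set.diagonal X ∩ Prod.fst ⁻¹' A from ⟨hp, hpA⟩), one_mul]
      · rw [Set.indicator_of_notMem hpA, Set.indicator_of_notMem (fun h => hpA h.2), zero_mul]
    · rw [Set.indicator_of_notMem hp, Set.indicator_of_notMem (fun h => hp h.1)]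
  rw [integral_congr_ae this, integral_indicator hm, setIntegral_const, Measure.real, hrel]
  simp [Measure.real]

/-- The unitary of `θ`, as an element of `L(R)`. -/
def unitaryElt (θ : X ≃ᵐ X) (hθ : θ ∈ R.fullGroup) : R.vonNeumann.toStarSubalgebra :=
  ⟨R.unitary θ hθ, R.generators_subset (Or.inr ⟨θ, hθ, rfl⟩)⟩

theorem star_unitaryElt_mul_self {θ : X ≃ᵐ X} (hθ : θ ∈ R.fullGroup) :
    star (R.unitaryElt θ hθ) * R.unitaryElt θ hθ = 1 := by
  refine Subtype.ext ?_
  show star (R.unitary θ hθ) * R.unitary θ hθ = 1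
  rw [ContinuousLinearMap.star_eq_adjoint]
  refine (ContinuousLinearMap.norm_map_iff_adjoint_comp_self (R.unitary θ hθ)).1 fun g => ?_
  exact (Lp.compMeasurePreservingₗᵢ ℂ _ (R.measurePreserving_symm_prod hθ)).norm_map g

theorem unitaryElt_mul_unitaryElt_symm {θ : X ≃ᵐ X} (hθ : θ ∈ R.fullGroup)
    (hθ' : θ.symm ∈ R.fullGroup) : R.unitaryElt θ hθ * R.unitaryElt θ.symm hθ' = 1 := by
  refine Subtype.ext ?_
  show R.unitary θ hθ * R.unitary θ.symm hθ' = 1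
  ext1 g
  refine Lp.ext ?_
  have h1 := R.unitary_ae θ hθ (R.unitary θ.symm hθ' g)
  have h2 := (R.measurePreserving_symm_prod hθ).quasiMeasurePreserving.ae_eq
    (R.unitary_ae θ.symm hθ' g)
  filter_upwards [h1, h2] with p h1 h2
  rw [mul_apply_eq_comp, h1]
  simp only [Function.comp_apply] at h2
  rw [h2]
  simp

theorem unitaryElt_mul_star_self {θ : X ≃ᵐ X} (hθ : θ ∈ R.fullGroup)
    (hθ' : θ.symm ∈ R.fullGroup) :
    R.unitaryElt θ hθ * star (R.unitaryElt θ hθ) = 1 := by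
  have h1 := R.star_unitaryElt_mul_self hθ
  have h2 := R.unitaryElt_mul_unitaryElt_symm hθ hθ'
  rw [left_inv_eq_right_inv h1 h2, h2]

theorem indElt_mul_unitaryElt {θ : X ≃ᵐ X} (hθ : θ ∈ R.fullGroup) {A : Set X}
    (hA : MeasurableSet A) :
    R.indElt hA * R.unitaryElt θ hθ = R.unitaryElt θ hθ * R.indElt (θ.measurable hA) := by
  refine Subtype.ext ?_
  show R.mulOp _ (isBddBorel_indicator hA 1) * R.unitary θ hθ =
    R.unitary θ hθ * R.mulOp _ (isBddBorel_indicator (θ.measurable hA) 1)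
  ext1 g
  refine Lp.ext ?_
  have h1 := R.mulOp_ae _ (isBddBorel_indicator hA 1) (R.unitary θ hθ g)
  have h2 := R.unitary_ae θ hθ g
  have h3 := R.unitary_ae θ hθ (R.mulOp _ (isBddBorel_indicator (θ.measurable hA) 1) g)
  have h4 := (R.measurePreserving_symm_prod hθ).quasiMeasurePreserving.ae_eq
    (R.mulOp_ae _ (isBddBorel_indicator (θ.measurable hA) 1) g)
  filter_upwards [h1, h2, h3, h4] with p h1 h2 h3 h4
  rw [mul_apply_eq_comp, mul_apply_eq_comp, h1, h2, h3]
  simp only [Function.comp_apply] at h4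
  rw [h4]
  have hiff : θ.symm p.1 ∈ θ ⁻¹' A ↔ p.1 ∈ A := by
    rw [Set.mem_preimage, MeasurableEquiv.apply_symm_apply]
  by_cases hp : p.1 ∈ A
  · rw [Set.indicator_of_mem hp, Set.indicator_of_mem (hiff.2 hp)]
  · rw [Set.indicator_of_notMem hp, Set.indicator_of_notMem (mt hiff.1 hp)]

theorem star_unitaryElt_mul_indElt {θ : X ≃ᵐ X} (hθ : θ ∈ R.fullGroup) {A : Set X}
    (hA : MeasurableSet A) :
    star (R.unitaryElt θ hθ) * R.indElt hA =
      R.indElt (θ.measurable hA) * star (R.unitaryElt θ hθ) := by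
  have := congrArg star (R.indElt_mul_unitaryElt hθ hA)
  rwa [star_mul, star_mul, star_indElt, star_indElt] at this

end CountablePMPEquivRel

end

noncomputable section

/-! ### The measure of a tracial vector in a bimodule -/

/-- Round `f x` to the nearest of finitely many points of a dense sequence whose `ε`-balls cover the
compact disc containing the range. -/
theorem exists_simpleFunc_norm_sub_le {X : Type*} [MeasurableSpace X] {f : X → ℂ}
    (hf : IsBddBorel f) {ε : ℝ} (hε : 0 < ε) : ∃ s : SimpleFunc X ℂ, ∀ x, ‖f x - s x‖ ≤ ε := by
  obtain ⟨hfm, C, hC⟩ := hf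
  let e := TopologicalSpace.denseSeq ℂ
  have hcov : Metric.closedBall (0 : ℂ) C ⊆ ⋃ n, Metric.ball (e n) ε := fun z _ => by
    obtain ⟨n, hn⟩ := (TopologicalSpace.denseRange_denseSeq ℂ).exists_dist_lt z hε
    exact Set.mem_iUnion.2 ⟨n, hn⟩
  obtain ⟨t, ht⟩ := (isCompact_closedBall (0 : ℂ) C).elim_finite_subcover _
    (fun n => Metric.isOpen_ball) hcov
  obtain ⟨N, hN⟩ := t.bddAbove
  refine ⟨(SimpleFunc.nearestPt e N).comp f hfm, fun x => ?_⟩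
  obtain ⟨n, hnt, hn⟩ := Set.mem_iUnion₂.1 (ht (show f x ∈ Metric.closedBall 0 C by
    rw [mem_closedBall_zero_iff]; exact hC x))
  have h1 := SimpleFunc.edist_nearestPt_le e (f x) (hN hnt)
  rw [edist_dist, edist_dist, ENNReal.ofReal_le_ofReal_iff dist_nonneg] at h1
  rw [← dist_eq_norm, dist_comm, SimpleFunc.coe_comp, Function.comp_apply]
  refine h1.trans ?_
  rw [dist_comm]
  exact (Metric.mem_ball.1 hn).le

theorem norm_apply_of_star_mul_self {H : Type*} [NormedAddCommGroup H] [InnerProductSpace ℂ H]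
    [CompleteSpace H] {T : H →L[ℂ] H} (hT : star T * T = 1) (a : H) : ‖T a‖ = ‖a‖ := by
  rw [ContinuousLinearMap.star_eq_adjoint] at hT
  exact (ContinuousLinearMap.norm_map_iff_adjoint_comp_self T).2 hT a

namespace CountablePMPEquivRel

variable {X : Type u} [MeasurableSpace X] [StandardBorelSpace X] {μ : Measure X}
  (R : CountablePMPEquivRel X μ) {H : Type v} [NormedAddCommGroup H] [InnerProductSpace ℂ H]
  [CompleteSpace H]

/-- With `g = √(C² - |f|²)`, the relation `f̄ f + ḡ g = C²` is mapped by `π` to a sum of two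
positive operators, each therefore at most `C²`. Multiplicativity is required only for `f̄ f`, so
that the order-reversing right action is covered too. -/
theorem norm_apply_cartanElt_le (π : R.vonNeumann.toStarSubalgebra →ₗ[ℂ] (H →L[ℂ] H))
    (hone : π 1 = 1) (hmul : ∀ f hf, π (star (R.cartanElt f hf) * R.cartanElt f hf) =
      star (π (R.cartanElt f hf)) * π (R.cartanElt f hf))
    {f : X → ℂ} (hf : IsBddBorel f) {C : ℝ} (hC : ∀ x, ‖f x‖ ≤ C) (a : H) :
    ‖π (R.cartanElt f hf) a‖ ≤ |C| * ‖a‖ := by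
  let g : X → ℂ := fun x => (Real.sqrt (C ^ 2 - ‖f x‖ ^ 2) : ℂ)
  have hgm : Measurable g :=
    Complex.measurable_ofReal.comp ((measurable_const.sub (hf.1.norm.pow_const 2)).sqrt)
  have hsq : ∀ x, ‖f x‖ ^ 2 ≤ C ^ 2 := fun x => pow_le_pow_left₀ (norm_nonneg _) (hC x) 2
  have hg : IsBddBorel g := ⟨hgm, |C|, fun x => by
    simp only [g, Complex.norm_real, Real.norm_eq_abs, abs_of_nonneg (Real.sqrt_nonneg _)]
    rw [← Real.sqrt_sq_eq_abs]
    exact Real.sqrt_le_sqrt (by linarith [sq_nonneg ‖f x‖])⟩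
  have hrel : star (R.cartanElt f hf) * R.cartanElt f hf + star (R.cartanElt g hg) *
      R.cartanElt g hg = ((C : ℂ) ^ 2) • 1 := by
    have hc : IsBddBorel fun _ : X => (C : ℂ) ^ 2 := ⟨measurable_const, _, fun _ => le_rfl⟩
    rw [star_cartanElt, star_cartanElt, cartanElt_mul, cartanElt_mul, cartanElt_add,
      ← R.cartanElt_const _ hc]
    refine R.cartanElt_congr ?_ _ _
    ext x
    have h1 : star (f x) * f x = ((‖f x‖ ^ 2 : ℝ) : ℂ) := by
      rw [RCLike.star_def, Complex.conj_mul']; push_cast; rfl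
    have h2 : star (g x) * g x = ((C ^ 2 - ‖f x‖ ^ 2 : ℝ) : ℂ) := by
      rw [RCLike.star_def, Complex.conj_mul']
      simp only [g, Complex.norm_real, Real.norm_eq_abs, abs_of_nonneg (Real.sqrt_nonneg _)]
      rw [← Complex.ofReal_pow, Real.sq_sqrt (by linarith [hsq x])]
    rw [h1, h2]
    push_cast
    ring
  have hπ := congrArg (fun T => RCLike.re (inner ℂ a (π T a))) hrel
  rw [map_add, hmul, hmul, map_smul, hone] at hπ
  have hn : ∀ T : H →L[ℂ] H, RCLike.re (inner ℂ a ((star T * T) a)) = ‖T a‖ ^ 2 := fun T => by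
    rw [← inner_self_eq_norm_sq (𝕜 := ℂ), ContinuousLinearMap.star_eq_adjoint, mul_apply_eq_comp,
      ContinuousLinearMap.adjoint_inner_right]
  rw [add_apply, inner_add_right, map_add, hn, hn] at hπ
  have hr : RCLike.re (inner ℂ a ((((C : ℂ) ^ 2) • (1 : H →L[ℂ] H)) a)) = C ^ 2 * ‖a‖ ^ 2 := by
    rw [smul_apply, one_apply_eq_self, inner_smul_right, inner_self_eq_norm_sq_to_K]
    have : (C : ℂ) ^ 2 * (‖a‖ : ℂ) ^ 2 = ((C ^ 2 * ‖a‖ ^ 2 : ℝ) : ℂ) := by push_cast; ring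
    exact (congrArg RCLike.re this).trans (Complex.ofReal_re _)
  rw [hr] at hπ
  refine le_of_sq_le_sq ?_ (by positivity)
  rw [mul_pow, sq_abs]
  linarith [sq_nonneg ‖π (R.cartanElt g hg) a‖]

variable {R} (E : HilbertBimodule R.vonNeumann H)

/-- Linearity passes from indicators to simple functions, and the norm bound for both actions allows
uniform approximation of bounded Borel functions. -/
theorem central_of_forall_indElt {η : H}
    (h : ∀ A (hA : MeasurableSet A), E.lact (R.indElt hA) η = E.ract η (R.indElt hA)) :
    E.IsCentral R.cartan_le η := by
  have hs : ∀ (s : SimpleFunc X ℂ) (hs : IsBddBorel s),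
      E.lact (R.cartanElt s hs) η = E.ract η (R.cartanElt s hs) := by
    intro s
    induction s using SimpleFunc.induction with
    | @const c A hA =>
      intro hb
      have hc : IsBddBorel fun _ : X => c := ⟨measurable_const, _, fun _ => le_rfl⟩
      have : R.cartanElt _ hb = c • R.indElt hA := by
        rw [← one_mul (R.indElt hA), ← smul_mul_assoc, ← R.cartanElt_const c hc, indElt,
          cartanElt_mul]
        refine R.cartanElt_congr ?_ _ _
        ext x
        rw [SimpleFunc.coe_piecewise]
        by_cases hx : x ∈ A <;> simp [Set.piecewise, Set.indicator, hx]
      rw [this]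
      have h1 := h _ hA
      simp only [HilbertBimodule.lact, HilbertBimodule.ract, map_smul, MulOpposite.op_smul,
        smul_apply] at h1 ⊢
      rw [h1]
    | add hd h1 h2 =>
      intro hb
      rename_i f g
      have hbf : ∀ f : SimpleFunc X ℂ, IsBddBorel f := fun f =>
        ⟨f.measurable, f.exists_forall_norm_le⟩
      have : R.cartanElt _ hb = R.cartanElt f (hbf f) + R.cartanElt g (hbf g) := by
        rw [cartanElt_add]
        exact R.cartanElt_congr rfl _ _
      rw [this]
      have h1 := h1 (hbf f)
      have h2 := h2 (hbf g)
      simp only [HilbertBimodule.lact, HilbertBimodule.ract, map_add, MulOpposite.op_add,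
        add_apply] at h1 h2 ⊢
      rw [h1, h2]
  rintro b ⟨f, hf, rfl⟩
  show E.lact (R.cartanElt f hf) η = E.ract η (R.cartanElt f hf)
  rw [← sub_eq_zero, ← norm_le_zero_iff]
  refine le_of_forall_pos_le_add fun ε hε => ?_
  rw [zero_add]
  have hδ : 0 < ε / (2 * (‖η‖ + 1)) := by positivity
  obtain ⟨s, hsf⟩ := exists_simpleFunc_norm_sub_le hf hδ
  have hb : IsBddBorel s := ⟨s.measurable, s.exists_forall_norm_le⟩
  have hd : IsBddBorel fun x => f x - s x := ⟨hf.1.sub s.measurable, _, hsf⟩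
  have hfd : R.cartanElt f hf = R.cartanElt s hb + R.cartanElt _ hd := by
    rw [cartanElt_add]
    refine R.cartanElt_congr ?_ _ _
    ext x
    simp
  have hL := R.norm_apply_cartanElt_le E.left.toAlgHom.toLinearMap (map_one E.left)
    (fun f hf => by
      show E.left _ = star (E.left _) * E.left _
      rw [map_mul, map_star]) hd hsf η
  have hR : ‖E.right (MulOpposite.op (R.cartanElt _ hd)) η‖ ≤
      |ε / (2 * (‖η‖ + 1))| * ‖η‖ := by
    refine R.norm_apply_cartanElt_le (E.right.toAlgHom.toLinearMap ∘ₗ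
      (MulOpposite.opLinearEquiv ℂ).toLinearMap) (map_one E.right) (fun f hf => ?_) hd hsf η
    show E.right (MulOpposite.op _) = star (E.right (MulOpposite.op _)) * E.right (MulOpposite.op _)
    -- Commutativity of the functions undoes the reversal of products by the opposite algebra.
    have hc : star (R.cartanElt f hf) * R.cartanElt f hf =
        R.cartanElt f hf * star (R.cartanElt f hf) := by
      rw [star_cartanElt, cartanElt_mul, cartanElt_mul]
      exact R.cartanElt_congr (funext fun x => mul_comm _ _) _ _
    rw [hc, MulOpposite.op_mul, map_mul, ← map_star, MulOpposite.op_star]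
  have hmain : E.lact (R.cartanElt f hf) η - E.ract η (R.cartanElt f hf) =
      E.left (R.cartanElt _ hd) η - E.right (MulOpposite.op (R.cartanElt _ hd)) η := by
    have h1 := hs s hb
    simp only [HilbertBimodule.lact, HilbertBimodule.ract] at h1 ⊢
    rw [hfd, map_add, MulOpposite.op_add, map_add, add_apply, add_apply, h1]
    abel
  rw [hmain]
  refine (norm_sub_le _ _).trans ((add_le_add hL hR).trans ?_)
  rw [abs_of_pos hδ]
  have : ε / (2 * (‖η‖ + 1)) * ‖η‖ ≤ ε / 2 := by
    rw [div_mul_eq_mul_div, div_le_div_iff₀ (by positivity) (by positivity)]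
    nlinarith [norm_nonneg η]
  linarith

end CountablePMPEquivRel

end

/-! ### From tracial vectors to almost invariant measures -/

noncomputable section

namespace CountablePMPEquivRel

variable {X : Type u} [MeasurableSpace X] [StandardBorelSpace X] {μ : Measure X}
  {R : CountablePMPEquivRel X μ} {H : Type v} [NormedAddCommGroup H] [InnerProductSpace ℂ H]
  [CompleteSpace H] (E : HilbertBimodule R.vonNeumann H)

open Classical in
/-- `A ↦ (η ↦ 1_A η)`, and `0` if `A` is not measurable. -/
def leftProj (A : Set X) : H →L[ℂ] H :=
  if hA : MeasurableSet A then E.left (R.indElt hA) else 0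

open Classical in
/-- `A ↦ (η ↦ η 1_A)`, and `0` if `A` is not measurable. -/
def rightProj (A : Set X) : H →L[ℂ] H :=
  if hA : MeasurableSet A then E.right (MulOpposite.op (R.indElt hA)) else 0

theorem leftProj_of_measurableSet {A : Set X} (hA : MeasurableSet A) :
    leftProj E A = E.left (R.indElt hA) := dif_pos hA

theorem rightProj_of_measurableSet {A : Set X} (hA : MeasurableSet A) :
    rightProj E A = E.right (MulOpposite.op (R.indElt hA)) := dif_pos hA

theorem isProjectionFamily_leftProj : IsProjectionFamily (leftProj E) where
  univ := by rw [leftProj_of_measurableSet E MeasurableSet.univ, indElt_univ, map_one]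
  inter A B hA hB := by
    rw [leftProj_of_measurableSet E hA, leftProj_of_measurableSet E hB,
      leftProj_of_measurableSet E (hA.inter hB), indElt_inter, map_mul]
  union A B hA hB hAB := by
    rw [leftProj_of_measurableSet E hA, leftProj_of_measurableSet E hB,
      leftProj_of_measurableSet E (hA.union hB), indElt_union R hA hB hAB, map_add]
  star_eq A hA := by
    rw [leftProj_of_measurableSet E hA, ← map_star, star_indElt]

theorem isProjectionFamily_rightProj : IsProjectionFamily (rightProj E) where
  univ := by
    rw [rightProj_of_measurableSet E MeasurableSet.univ, indElt_univ, MulOpposite.op_one, map_one]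
  inter A B hA hB := by
    have : R.indElt (hA.inter hB) = R.indElt hB * R.indElt hA := by
      rw [← indElt_inter]
      exact R.cartanElt_congr (by rw [Set.inter_comm]) _ _
    rw [rightProj_of_measurableSet E hA, rightProj_of_measurableSet E hB,
      rightProj_of_measurableSet E (hA.inter hB), this, MulOpposite.op_mul, map_mul]
  union A B hA hB hAB := by
    rw [rightProj_of_measurableSet E hA, rightProj_of_measurableSet E hB,
      rightProj_of_measurableSet E (hA.union hB), indElt_union R hA hB hAB, MulOpposite.op_add,
      map_add]
  star_eq A hA := by
    rw [rightProj_of_measurableSet E hA, ← map_star, ← MulOpposite.op_star, star_indElt]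

theorem commute_leftProj_rightProj (A B : Set X) : Commute (leftProj E A) (rightProj E B) := by
  by_cases hA : MeasurableSet A
  · by_cases hB : MeasurableSet B
    · rw [leftProj_of_measurableSet E hA, rightProj_of_measurableSet E hB]
      exact E.commute _ _
    · rw [rightProj, dif_neg hB]
      exact Commute.zero_right _
  · rw [leftProj, dif_neg hA]
    exact Commute.zero_left _

section Tracial

variable {ξ : H}

/-- The pushforward of `ν` is the measure of the conjugated vector `ζ = u ξ u*`, and `‖ζ - ξ‖ = ‖u ξ
- ξ u‖`. Thus it suffices to compare the measures of two nearby unit vectors. -/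
theorem measureClose_of_unitary (hξ1 : ‖ξ‖ = 1) {ν : Measure (X × X)} [IsFiniteMeasure ν]
    (hν : ∀ A B, MeasurableSet A → MeasurableSet B →
      ν (A ×ˢ B) = ENNReal.ofReal (‖leftProj E A (rightProj E B ξ)‖ ^ 2))
    {θ : X ≃ᵐ X} (hθ : θ ∈ R.fullGroup) (hθ' : θ.symm ∈ R.fullGroup) :
    MeasureClose (ENNReal.ofReal
      (2 * ‖E.lact (R.unitaryElt θ hθ) ξ - E.ract ξ (R.unitaryElt θ hθ)‖))
      (ν.map (Prod.map θ θ)) ν := by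
  set u := R.unitaryElt θ hθ with hu
  have hl : ∀ a, ‖E.left u a‖ = ‖a‖ := norm_apply_of_star_mul_self (by
    rw [← map_star, ← map_mul, R.star_unitaryElt_mul_self hθ, map_one])
  have hr : ∀ a, ‖E.right (MulOpposite.op (star u)) a‖ = ‖a‖ := norm_apply_of_star_mul_self (by
    rw [← map_star, ← map_mul, ← MulOpposite.op_star, star_star, ← MulOpposite.op_mul,
      R.star_unitaryElt_mul_self hθ, MulOpposite.op_one, map_one])
  set ζ := E.right (MulOpposite.op (star u)) (E.left u ξ) with hζ
  have hζ1 : ‖ζ‖ = 1 := by rw [hζ, hr, hl, hξ1]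
  have hdist : ‖ζ - ξ‖ = ‖E.lact u ξ - E.ract ξ u‖ := by
    rw [← hr (E.lact u ξ - E.ract ξ u), map_sub]
    have h1 : E.right (MulOpposite.op (star u)) * E.right (MulOpposite.op u) = 1 := by
      rw [← map_mul, ← MulOpposite.op_mul, R.unitaryElt_mul_star_self hθ hθ', MulOpposite.op_one,
        map_one]
    have h2 : E.right (MulOpposite.op (star u)) (E.ract ξ u) = ξ :=
      congrArg (fun T : H →L[ℂ] H => T ξ) h1
    rw [h2]
    rfl
  rw [← hdist]
  have hT : Measurable (Prod.map θ θ) := θ.measurable.prodMap θ.measurable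
  refine (isProjectionFamily_leftProj E).measureClose (isProjectionFamily_rightProj E)
    (commute_leftProj_rightProj E) hζ1 hξ1 (fun A B hA hB => ?_) hν
  have hpre : Prod.map θ θ ⁻¹' (A ×ˢ B) = (θ ⁻¹' A) ×ˢ (θ ⁻¹' B) := rfl
  rw [Measure.map_apply hT (hA.prod hB), hpre, hν _ _ (θ.measurable hA) (θ.measurable hB)]
  -- Covariance of the projections: moving `u` on the left and `u*` on the right past them replaces
  -- `A` and `B` by their preimages under `θ`.
  have hop : (leftProj E A * rightProj E B) *
      (E.right (MulOpposite.op (star u)) * E.left u) =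
      (E.left u * E.right (MulOpposite.op (star u))) *
        (leftProj E (θ ⁻¹' A) * rightProj E (θ ⁻¹' B)) := by
    rw [leftProj_of_measurableSet E hA, rightProj_of_measurableSet E hB,
      leftProj_of_measurableSet E (θ.measurable hA), rightProj_of_measurableSet E (θ.measurable hB)]
    have h1 : E.right (MulOpposite.op (R.indElt hB)) * E.right (MulOpposite.op (star u)) =
        E.right (MulOpposite.op (star u)) *
          E.right (MulOpposite.op (R.indElt (θ.measurable hB))) := by
      rw [← map_mul, ← map_mul, ← MulOpposite.op_mul, ← MulOpposite.op_mul,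
        R.star_unitaryElt_mul_indElt hθ hB]
    have h2 : E.left (R.indElt hA) * E.left u =
        E.left u * E.left (R.indElt (θ.measurable hA)) := by
      rw [← map_mul, ← map_mul, R.indElt_mul_unitaryElt hθ hA]
    have c : ∀ x y, E.left x * E.right y = E.right y * E.left x := fun x y => (E.commute x y).eq
    calc _ = E.left (R.indElt hA) * (E.right (MulOpposite.op (R.indElt hB)) *
          E.right (MulOpposite.op (star u))) * E.left u := by simp only [mul_assoc]
      _ = E.left (R.indElt hA) * (E.right (MulOpposite.op (star u)) *
          (E.right (MulOpposite.op (R.indElt (θ.measurable hB))) * E.left u)) := by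
          rw [h1]; simp only [mul_assoc]
      _ = (E.left (R.indElt hA) * E.right (MulOpposite.op (star u))) *
          (E.left u * E.right (MulOpposite.op (R.indElt (θ.measurable hB)))) := by
          rw [← c]; simp only [mul_assoc]
      _ = E.right (MulOpposite.op (star u)) * (E.left (R.indElt hA) * E.left u) *
          E.right (MulOpposite.op (R.indElt (θ.measurable hB))) := by
          rw [c]; simp only [mul_assoc]
      _ = (E.right (MulOpposite.op (star u)) * E.left u) * (E.left (R.indElt (θ.measurable hA)) *
          E.right (MulOpposite.op (R.indElt (θ.measurable hB)))) := by
          rw [h2]; simp only [mul_assoc]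
      _ = _ := by rw [← c]
  have := congrArg (fun T : H →L[ℂ] H => ‖T ξ‖) hop
  have h3 : ‖leftProj E A (rightProj E B ζ)‖ =
      ‖E.left u (E.right (MulOpposite.op (star u))
        (leftProj E (θ ⁻¹' A) (rightProj E (θ ⁻¹' B) ξ)))‖ := this
  rw [h3, hl, hr]

variable [IsProbabilityMeasure μ]

theorem norm_leftProj_sq (hξ : E.IsTracial R.trace ξ) {A : Set X} (hA : MeasurableSet A) :
    ‖leftProj E A ξ‖ ^ 2 = μ.real A := by
  have hP := isProjectionFamily_leftProj E
  rw [norm_sq_of_isStarProjection (hP.star_eq A hA) (hP.mul_self hA),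
    leftProj_of_measurableSet E hA]
  have := (hξ (R.indElt hA)).1
  rw [R.trace_indElt hA] at this
  exact (congrArg RCLike.re this).trans (Complex.ofReal_re _)

theorem norm_rightProj_sq (hξ : E.IsTracial R.trace ξ) {A : Set X} (hA : MeasurableSet A) :
    ‖rightProj E A ξ‖ ^ 2 = μ.real A := by
  have hP := isProjectionFamily_rightProj E
  rw [norm_sq_of_isStarProjection (hP.star_eq A hA) (hP.mul_self hA),
    rightProj_of_measurableSet E hA]
  have := (hξ (R.indElt hA)).2
  rw [R.trace_indElt hA] at this
  exact (congrArg RCLike.re this).trans (Complex.ofReal_re _)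

/-- The measure on `X × X` of a tracial vector. -/
theorem exists_measure_of_isTracial (hξ : E.IsTracial R.trace ξ) :
    ∃ ν : Measure (X × X), ν.map Prod.fst = μ ∧ ν.map Prod.snd = μ ∧
      ∀ A B, MeasurableSet A → MeasurableSet B →
        ν (A ×ˢ B) = ENNReal.ofReal (‖leftProj E A (rightProj E B ξ)‖ ^ 2) := by
  have hb := (isProjectionFamily_leftProj E).isBimeasure (isProjectionFamily_rightProj E)
    (commute_leftProj_rightProj E) (fun A hA => norm_leftProj_sq E hξ hA)
    (fun A hA => norm_rightProj_sq E hξ hA)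
  obtain ⟨ν, hν⟩ := hb.exists_measure_prod
  refine ⟨ν, Measure.ext fun A hA => ?_, Measure.ext fun A hA => ?_, hν⟩
  · rw [Measure.map_apply measurable_fst hA, ← Set.prod_univ, hν A _ hA MeasurableSet.univ,
      ← hb.univ_right A hA]
  · rw [Measure.map_apply measurable_snd hA, ← Set.univ_prod, hν _ A MeasurableSet.univ hA,
      ← hb.univ_left A hA]

/-- The nearly central vector found by restricting to the diagonal is a legitimate competitor, so
the assumed gap `ε` bounds the off-diagonal mass `1 - ν(Δ)` from below. -/
theorem exists_isAlmostInvariant (hξ1 : ‖ξ‖ = 1) (hξ : E.IsTracial R.trace ξ)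
    {S : ℕ → Set X} (hS : ∀ k, MeasurableSet (S k)) {γ : ℕ → X ≃ᵐ X}
    (hγ : ∀ k, γ k ∈ R.fullGroup) (hγ' : ∀ k, (γ k).symm ∈ R.fullGroup) {N : ℕ}
    (hN : ∀ k ≤ N, ‖E.lact (R.indElt (hS k)) ξ - E.ract ξ (R.indElt (hS k))‖ ≤
      1 / (2 * ((N : ℝ) + 1)))
    (hN' : ∀ k ≤ N, ‖E.lact (R.unitaryElt (γ k) (hγ k)) ξ -
      E.ract ξ (R.unitaryElt (γ k) (hγ k))‖ ≤ 1 / (2 * ((N : ℝ) + 1)))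
    {ε : ℝ} (hε : ∀ η, E.IsCentral R.cartan_le η → ε ≤ ‖η - ξ‖ ^ 2) :
    ∃ ρ, IsAlmostInvariant μ S γ N ρ ∧ ε ≤ ρ.real Set.univ := by
  obtain ⟨ν, h1, h2, hν⟩ := exists_measure_of_isTracial E hξ
  have hprob : IsProbabilityMeasure ν := ⟨by
    have : (ν.map Prod.fst) Set.univ = 1 := by rw [h1, measure_univ]
    rwa [Measure.map_apply measurable_fst MeasurableSet.univ, Set.preimage_univ] at this⟩
  have hP := isProjectionFamily_leftProj E
  have hQ := isProjectionFamily_rightProj E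
  have hνr : ∀ A B, MeasurableSet A → MeasurableSet B →
      ‖leftProj E A (rightProj E B ξ)‖ ^ 2 = ν.real (A ×ˢ B) := fun A B hA hB => by
    rw [Measure.real, hν A B hA hB, ENNReal.toReal_ofReal (sq_nonneg _)]
  obtain ⟨U, hU, hsep⟩ := exists_seq_separating X MeasurableSet.empty Set.univ
  obtain ⟨η, hηc, hη⟩ := IsProjectionFamily.exists_central hP hQ (commute_leftProj_rightProj E) hU
    (fun x y h => hsep x (Set.mem_univ _) y (Set.mem_univ _) h) hνr
  have hcen : E.IsCentral R.cartan_le η := central_of_forall_indElt E fun A hA => by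
    have := hηc A hA
    rwa [leftProj_of_measurableSet E hA, rightProj_of_measurableSet E hA] at this
  have hεη := hε η hcen
  rw [hη, hξ1, one_pow] at hεη
  have hpos : (0 : ℝ) < (N : ℝ) + 1 := by positivity
  -- The commutator bound is at most `1`, so squaring keeps it below `1 / (N + 1)`. The factor `2`
  -- in the denominator is needed for the unitaries, where closeness costs twice the commutator.
  have hsq : ∀ k ≤ N, ‖leftProj E (S k) ξ - rightProj E (S k) ξ‖ ^ 2 ≤ 1 / ((N : ℝ) + 1) := by
    intro k hk
    have h3 := hN k hk
    rw [HilbertBimodule.lact, HilbertBimodule.ract, ← leftProj_of_measurableSet E (hS k),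
      ← rightProj_of_measurableSet E (hS k)] at h3
    have h4 : (1 : ℝ) / (2 * ((N : ℝ) + 1)) ≤ 1 / ((N : ℝ) + 1) :=
      one_div_le_one_div_of_le hpos (by linarith)
    have h5 : (1 : ℝ) / ((N : ℝ) + 1) ≤ 1 := by
      rw [div_le_one hpos]; linarith [(Nat.cast_nonneg N : (0 : ℝ) ≤ N)]
    have h6 := norm_nonneg (leftProj E (S k) ξ - rightProj E (S k) ξ)
    nlinarith
  have hnear : ∀ k ≤ N, ν (S k ×ˢ (S k)ᶜ) ≤ tol N ∧ ν ((S k)ᶜ ×ˢ S k) ≤ tol N := by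
    intro k hk
    have h3 := hsq k hk
    rw [hP.norm_sub_apply_sq hQ (hS k)] at h3
    rw [hν _ _ (hS k) (hS k).compl, hν _ _ (hS k).compl (hS k)]
    exact ⟨ENNReal.ofReal_le_ofReal (le_trans (le_add_of_nonneg_right (sq_nonneg _)) h3),
      ENNReal.ofReal_le_ofReal (le_trans (le_add_of_nonneg_left (sq_nonneg _)) h3)⟩
  obtain ⟨ρ, hρ, hρm⟩ := IsAlmostInvariant.of_measure h1 h2 hS (fun k hk => (hnear k hk).1)
    (fun k hk => (hnear k hk).2) (γ := γ) fun k hk F hF => by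
      refine (measureClose_of_unitary E hξ1 hν (hγ k) (hγ' k) F hF).trans (add_le_add_right ?_ _)
      refine ENNReal.ofReal_le_ofReal ?_
      have h3 := hN' k hk
      have h4 : 2 * ((1 : ℝ) / (2 * ((N : ℝ) + 1))) = 1 / ((N : ℝ) + 1) := by field_simp
      rw [← h4]
      exact mul_le_mul_of_nonneg_left h3 zero_le_two
  exact ⟨ρ, hρ, hρm ▸ hεη⟩

end Tracial

end CountablePMPEquivRel

end

/-! ### Contraposition of rigidity -/

theorem proposition2p2 {X : Type u} [MeasurableSpace X] [StandardBorelSpace X] (μ : Measure X)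
    [IsProbabilityMeasure μ] [NullSingletonClass μ] (R : CountablePMPEquivRel X μ) (hR : R.IsErgodic)
    (h : ¬ ∃ ν : ℕ → Measure (X × X),
      (∀ n, IsProbabilityMeasure (ν n)) ∧
      (∀ n, ν n (Set.diagonal X) = 0) ∧
      (∀ n, (ν n).map Prod.fst = μ ∧ (ν n).map Prod.snd = μ) ∧
      (∀ f₁ f₂ : X → ℂ, IsBddBorel f₁ → IsBddBorel f₂ →
        Tendsto (fun n => ∫ p, f₁ p.1 * f₂ p.2 ∂(ν n)) atTop (𝓝 (∫ x, f₁ x * f₂ x ∂μ))) ∧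
      (∀ θ ∈ R.fullGroup,
        Tendsto (fun n => measureDist ((ν n).map (Prod.map θ θ)) (ν n)) atTop (𝓝 0))) :
    CountablePMPEquivRel.IsRigid.{u, v} R := by
  classical
  obtain ⟨γ, hγ, hrel⟩ := R.exists_enumeration
  obtain ⟨𝒜, h𝒜c, h𝒜⟩ := exists_countable_measureDense μ
  obtain ⟨S, rfl⟩ := h𝒜c.exists_eq_range h𝒜.nonempty
  have hS : ∀ k, MeasurableSet (S k) := fun k => h𝒜.measurable _ ⟨k, rfl⟩
  have hγf : ∀ k, γ k ∈ R.fullGroup := fun k =>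
    ⟨hγ k, Eventually.of_forall fun x => (hrel _ _).2 ⟨k, rfl⟩⟩
  have hγf' : ∀ k, (γ k).symm ∈ R.fullGroup := fun k =>
    ⟨(hγ k).symm, Eventually.of_forall fun x => R.rel.symm ((hrel _ _).2 ⟨k, by simp⟩)⟩
  intro ε hε
  by_contra hcon
  push Not at hcon
  have hε2 : 0 < ε ^ 2 := pow_pos hε 2
  -- A distance gap `ε` gives off-diagonal mass `ε ^ 2`; the minimum with `1` meets the requirement
  -- `c ≤ 1` of the amplification. For each `N` the failure of rigidity is tested on the first `N +
  -- 1` projections and unitaries.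
  refine h (CountablePMPEquivRel.exists_seq_of_hasAlmostInvariant hR h𝒜 hγ hrel
    (c := min (ε ^ 2) 1) (lt_min hε2 one_pos) (min_le_right _ _) fun N => ?_)
  obtain ⟨H, _, _, _, E, ξ, hξ1, hξ, hF, hη⟩ := hcon
    ((Finset.range (N + 1)).image (fun k => R.indElt (hS k)) ∪
      (Finset.range (N + 1)).image (fun k => R.unitaryElt (γ k) (hγf k)))
    (1 / (2 * ((N : ℝ) + 1))) (by positivity)
  obtain ⟨ρ, hρ, hρm⟩ := CountablePMPEquivRel.exists_isAlmostInvariant E hξ1 hξ hS hγf hγf'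
    (fun k hk => hF _ (Finset.mem_union_left _ (Finset.mem_image_of_mem _
      (Finset.mem_range.2 (Nat.lt_succ_of_le hk)))))
    (fun k hk => hF _ (Finset.mem_union_right _ (Finset.mem_image_of_mem _
      (Finset.mem_range.2 (Nat.lt_succ_of_le hk)))))
    (ε := ε ^ 2) (fun η hcen => pow_le_pow_left₀ hε.le (hη η hcen).le 2)
  refine ⟨ρ, hρ, (min_le_left _ _).trans (hρm.trans (le_add_of_nonneg_right (by positivity)))⟩
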